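/- For every integer $n\ge 3$ there is a constant $c_2=c_2(n)\ge 0$ such that the following holds. Let $M$ be a closed (compact, without boundary) smooth $n$-manifold and $g_0$ a smooth Riemannian metric on $M$. Then there are constants $c=c(g_0)\ge 0$ and $C_1=C_1(n,g_0)>0$ such that, for every $T\in(0,\infty]$ and every smooth solution $g(t)$, $t\in[0,T)$, of the Ricci flow $\partial_t g_{ij}=-2R_{ij}$ on $M$ with $g(0)=g_0$, one has, at every point of $M$ and for every $t\in[0,T)$, $$R+c>0\qquad\text{and}\qquad \frac{|E|}{R+c}\;\le\; C_1+c_2\max_{M\times[0,t]}\sqrt{\frac{|W|}{R+c}} .$$ Furthermore, if $R>0$ everywhere on $M$ at time $t=0$, then, with the same $C_1$ and $c_2$, at every point of $M$ and for every $t\in[0,T)$, $$R>0\qquad\text{and}\qquad \frac{|E|}{R}\;\le\; C_1+c_2\max_{M\times[0,t]}\sqrt{\frac{|W|}{R}} .$$ (In both cases the maximum is attained.) Here $R_{ij}$ and $R$ are the Ricci and scalar curvature of $g(t)$, $E_{ij}=R_{ij}-\frac{R}{n}g_{ij}$ is the traceless Ricci tensor, $$W_{ijkl}=R_{ijkl}-\tfrac1{n-2}\left(g_{ik}R_{jl}+g_{jl}R_{ik}-g_{il}R_{jk}-g_{jk}R_{il}\right)+\tfrac{R}{(n-1)(n-2)}\left(g_{ik}g_{jl}-g_{il}g_{jk}\right)$$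 is the Weyl tensor (with the sign convention $R_{ik}=g^{jl}R_{ijkl}$), and $|\cdot|$ is the tensor norm given by $g(t)$, that is $|E|^2=g^{ia}g^{jb}E_{ij}E_{ab}$ and $|W|^2=g^{ia}g^{jb}g^{kc}g^{ld}W_{ijkl}W_{abcd}$. -/

import Mathlib

open scoped Manifold ContDiff

noncomputable section

namespace RicciFlow

/-! ### Curvature in local coordinates

In what follows `G : E n → Matrix (Fin n) (Fin n) ℝ` holds the components `g_ij` of a Riemannian
metric in a coordinate chart, as functions of the coordinates, and `y` is a point of the
coordinate domain. -/

/-- The model space `ℝⁿ`. -/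
abbrev E (n : ℕ) : Type := EuclideanSpace ℝ (Fin n)

/-- The partial derivative `∂_k f` of a function on `ℝⁿ`. -/
def partialDeriv {n : ℕ} (k : Fin n) (f : E n → ℝ) (y : E n) : ℝ :=
  fderiv ℝ f y (EuclideanSpace.single k 1)

/-- The Christoffel symbol
`Γ^l_ij = ½ g^{lm} (∂_i g_jm + ∂_j g_im - ∂_m g_ij)` of the Levi-Civita connection. -/
def christoffel {n : ℕ} (G : E n → Matrix (Fin n) (Fin n) ℝ) (y : E n) (l i j : Fin n) : ℝ :=
  (1 / 2) * ∑ m, (G y)⁻¹ l m *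
    (partialDeriv i (fun z => G z j m) y + partialDeriv j (fun z => G z i m) y
      - partialDeriv m (fun z => G z i j) y)

/-- The components `Rˡ_ijk` of the `(3,1)` curvature tensor,
`(∇_i ∇_j - ∇_j ∇_i) ∂_k = Rˡ_ijk ∂_l`. -/
def riemann31 {n : ℕ} (G : E n → Matrix (Fin n) (Fin n) ℝ) (y : E n) (l i j k : Fin n) : ℝ :=
  partialDeriv i (fun z => christoffel G z l j k) y
    - partialDeriv j (fun z => christoffel G z l i k) y
    + ∑ m, (christoffel G y m j k * christoffel G y l i m
      - christoffel G y m i k * christoffel G y l j m)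

/-- The components `R_ijkl = ⟨(∇_i ∇_j - ∇_j ∇_i) ∂_l, ∂_k⟩` of the `(4,0)` curvature tensor;
with this sign a metric of constant sectional curvature `K` has
`R_ijkl = K (g_ik g_jl - g_il g_jk)`. -/
def riemann {n : ℕ} (G : E n → Matrix (Fin n) (Fin n) ℝ) (y : E n) (i j k l : Fin n) : ℝ :=
  ∑ p, G y k p * riemann31 G y p i j l

/-- The components `R_ik = g^{jl} R_ijkl` of the Ricci tensor. -/
def ricci {n : ℕ} (G : E n → Matrix (Fin n) (Fin n) ℝ) (y : E n) (i k : Fin n) : ℝ :=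
  ∑ j, ∑ l, (G y)⁻¹ j l * riemann G y i j k l

/-- The scalar curvature `R = g^{ik} R_ik`. -/
def scalar {n : ℕ} (G : E n → Matrix (Fin n) (Fin n) ℝ) (y : E n) : ℝ :=
  ∑ i, ∑ k, (G y)⁻¹ i k * ricci G y i k

/-- The components `E_ij = R_ij - (R / n) g_ij` of the traceless Ricci tensor. -/
def tracelessRicci {n : ℕ} (G : E n → Matrix (Fin n) (Fin n) ℝ) (y : E n) (i j : Fin n) : ℝ :=
  ricci G y i j - scalar G y / n * G y i j

/-- The components `W_ijkl` of the `(4,0)` Weyl tensor. -/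
def weyl {n : ℕ} (G : E n → Matrix (Fin n) (Fin n) ℝ) (y : E n) (i j k l : Fin n) : ℝ :=
  riemann G y i j k l
    - 1 / ((n : ℝ) - 2) * (G y i k * ricci G y j l + G y j l * ricci G y i k
        - G y i l * ricci G y j k - G y j k * ricci G y i l)
    + scalar G y / (((n : ℝ) - 1) * ((n : ℝ) - 2)) * (G y i k * G y j l - G y i l * G y j k)

/-- The norm of a covariant 2-tensor `h` with respect to the inner product whose inverse matrix is
`A = (g^{ij})`: the square root of `g^{ia} g^{jb} h_ij h_ab`. -/
def norm2 {n : ℕ} (A : Matrix (Fin n) (Fin n) ℝ) (h : Fin n → Fin n → ℝ) : ℝ :=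
  √(∑ i, ∑ j, ∑ a, ∑ b, A i a * A j b * h i j * h a b)

/-- The norm of a covariant 4-tensor `h` with respect to the inner product whose inverse matrix is
`A = (g^{ij})`: the square root of `g^{ia} g^{jb} g^{kc} g^{ld} h_ijkl h_abcd`. -/
def norm4 {n : ℕ} (A : Matrix (Fin n) (Fin n) ℝ) (h : Fin n → Fin n → Fin n → Fin n → ℝ) : ℝ :=
  √(∑ i, ∑ j, ∑ k, ∑ l, ∑ a, ∑ b, ∑ c, ∑ d,
      A i a * A j b * A k c * A l d * h i j k l * h a b c d)

/-! ### Curvature of a Riemannian manifold -/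

section Manifold

variable {n : ℕ} {M : Type*} [TopologicalSpace M] [ChartedSpace (E n) M] [IsManifold (𝓡 n) ∞ M]

variable (n M) in
/-- A smooth Riemannian metric on the smooth `n`-manifold `M`. -/
abbrev Metric : Type _ :=
  Bundle.ContMDiffRiemannianMetric (𝓡 n) ∞ (E n) (fun x : M => TangentSpace (𝓡 n) x)

/-- The components `g_ij = g(∂_i, ∂_j)` of a metric in the chart `e`, at the point with
coordinates `y`. -/
def coordMetric (g : Metric n M) (e : OpenPartialHomeomorph M (E n)) (y : E n) :
    Matrix (Fin n) (Fin n) ℝ :=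
  Matrix.of fun i j =>
    g.inner (e.symm y)
      (mfderiv (𝓡 n) (𝓡 n) e.symm y (EuclideanSpace.single i (1 : ℝ) : E n))
      (mfderiv (𝓡 n) (𝓡 n) e.symm y (EuclideanSpace.single j (1 : ℝ) : E n))

/-- The scalar curvature `R` of `g` at the point `x`. -/
def scalarCurvature (g : Metric n M) (x : M) : ℝ :=
  scalar (coordMetric g (chartAt (E n) x)) (chartAt (E n) x x)

/-- The norm `|E|` of the traceless Ricci tensor of `g` at the point `x`. -/
def tracelessRicciNorm (g : Metric n M) (x : M) : ℝ :=
  norm2 (coordMetric g (chartAt (E n) x) (chartAt (E n) x x))⁻¹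
    (tracelessRicci (coordMetric g (chartAt (E n) x)) (chartAt (E n) x x))

/-- The norm `|W|` of the Weyl tensor of `g` at the point `x`. -/
def weylNorm (g : Metric n M) (x : M) : ℝ :=
  norm4 (coordMetric g (chartAt (E n) x) (chartAt (E n) x x))⁻¹
    (weyl (coordMetric g (chartAt (E n) x)) (chartAt (E n) x x))

/-- The time interval `[0, T)`, where `T = ⊤` is allowed. -/
def timeInterval (T : EReal) : Set ℝ := {t : ℝ | 0 ≤ t ∧ (t : EReal) < T}

/-- The family of metrics `g t`, `t ∈ [0, T)`, is a (smooth) solution of the Ricci flow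
`∂g_ij/∂t = -2 R_ij` on `M`. Both conditions are required in every smooth chart; the time
derivative at `t = 0` is one-sided. -/
structure IsRicciFlow (T : EReal) (g : ℝ → Metric n M) : Prop where
  /-- the components `g_ij` are jointly smooth functions of time and the coordinates -/
  smooth : ∀ e ∈ IsManifold.maximalAtlas (𝓡 n) ∞ M, ∀ i j : Fin n,
    ContDiffOn ℝ ∞ (fun p : ℝ × E n => coordMetric (g p.1) e p.2 i j)
      (timeInterval T ×ˢ e.target)
  /-- the Ricci flow equation -/
  evolution : ∀ e ∈ IsManifold.maximalAtlas (𝓡 n) ∞ M, ∀ y ∈ e.target, ∀ t ∈ timeInterval T,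
    ∀ i j : Fin n,
      HasDerivWithinAt (fun s => coordMetric (g s) e y i j)
        (-2 * ricci (coordMetric (g t) e) y i j) (timeInterval T) t

end Manifold

end RicciFlow

end

/-!
# Pinching of the traceless Ricci tensor along the Ricci flow

The estimate is an application of the maximum principle to `|E| / (R + c)`.

*Scalar curvature.* Since `(∂_t - Δ) R = 2 |Ric|² ≥ 0`, the minimum of `R` does not decrease
(`IsRicciFlow.le_scalarCurvature`), so `R + c ≥ δ > 0` persists if it holds initially.

*Traceless Ricci tensor.* Let `κ` be the maximum of `|E|² / (R + c)²` over `M × [0, t]`. If it is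
attained at a positive time, then `h = |E|² - κ (R + c)²` has the maximal value `0`, so that
`∇h = 0`, `Δh ≤ 0` and `∂_t h ≥ 0` there. One has
`(∂_t - Δ) |Ric|² = 4 Rm(Ric, Ric) - 2 |∇Ric|²`, and the Cauchy-Schwarz inequality applied
to `∇h = 0` shows that the gradient terms in `(∂_t - Δ) h` are nonpositive. Splitting `Rm(E, E)`
into its Weyl, Ricci and scalar parts, the reaction terms give `κ (R + c) ≤ |W| + 2 √κ (R + c) + |R|`
(`pinching_at_max`, `pinching_of_max`). Now `|R| ≤ (1 + 2 c / δ) (R + c)`, and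
`|W| ≤ m² (R + c)`, where `m` is the maximum of `√(|W| / (R + c))`, so `√κ ≤ 4 + 2 c / δ + m`.
If `κ` is attained at time `0`, it is bounded in terms of the initial metric. Hence the estimate
holds with `c₂ = 1` (`IsRicciFlow.pinching`); the first part of the theorem uses `c` with
`R + c ≥ 1` initially, the second part `c = 0`.

*Tensor calculus.* The curvature of a metric on an open set is computed in the ring of smooth
functions on that set, where the coordinate derivatives are commuting derivations. The structure
`DiffMetric` axiomatizes this situation, which turns the Bianchi identities, the transformation
laws (`DiffMetric.IsPullback`) and the evolution equations (`DiffMetric.IsNormal.mixed_box`) into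
identities of matrices over a commutative ring. The evolution equations are only needed at the
centre of normal coordinates, which a quadratic change of coordinates provides
(`IsMetricOn.exists_normal`). There the coordinate Laplacian agrees with `Δ` on functions, and
the evolution of `R` and `|Ric|²` follows from that of the mixed Ricci tensor `R^i_j`, of whose
powers they are traces.
-/

noncomputable section

namespace RicciFlow

open Matrix

/-! ### Differential rings and metrics over them -/

section Algebra

variable {n : ℕ} {C C' : Type*} [CommRing C] [Algebra ℝ C] [CommRing C'] [Algebra ℝ C']

/-- The entrywise derivative of a matrix. -/
def dMat (D : Derivation ℝ C C) (X : Matrix (Fin n) (Fin n) C) : Matrix (Fin n) (Fin n) C :=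
  X.map D

@[simp] lemma dMat_apply (D : Derivation ℝ C C) (X : Matrix (Fin n) (Fin n) C) (i j : Fin n) :
    dMat D X i j = D (X i j) := rfl

lemma dMat_add (D : Derivation ℝ C C) (X Y : Matrix (Fin n) (Fin n) C) :
    dMat D (X + Y) = dMat D X + dMat D Y := by ext; simp

lemma dMat_sub (D : Derivation ℝ C C) (X Y : Matrix (Fin n) (Fin n) C) :
    dMat D (X - Y) = dMat D X - dMat D Y := by ext; simp

lemma dMat_smul (D : Derivation ℝ C C) (a : C) (X : Matrix (Fin n) (Fin n) C) :
    dMat D (a • X) = D a • X + a • dMat D X := by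
  ext; simp [mul_comm]; ring

lemma dMat_sum (D : Derivation ℝ C C) (X : Fin n → Matrix (Fin n) (Fin n) C) :
    dMat D (∑ b, X b) = ∑ b, dMat D (X b) := by
  ext; simp [Matrix.sum_apply]

lemma dMat_transpose (D : Derivation ℝ C C) (X : Matrix (Fin n) (Fin n) C) :
    dMat D Xᵀ = (dMat D X)ᵀ := rfl

lemma dMat_mul (D : Derivation ℝ C C) (X Y : Matrix (Fin n) (Fin n) C) :
    dMat D (X * Y) = dMat D X * Y + X * dMat D Y := by
  ext i j
  simp only [dMat_apply, Matrix.mul_apply, map_sum, Derivation.leibniz, smul_eq_mul,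
    Matrix.add_apply, ← Finset.sum_add_distrib]
  exact Finset.sum_congr rfl fun k _ => by ring

lemma dMat_one (D : Derivation ℝ C C) : dMat D (1 : Matrix (Fin n) (Fin n) C) = 0 := by
  ext i j
  by_cases h : i = j <;> simp [h]

variable (C n) in
/-- A nondegenerate symmetric matrix `G` over a commutative ring `C` with commuting derivations
`∂₁, …, ∂ₙ`, together with its inverse `A`: the algebraic data from which the curvature of a
metric is computed. In the applications `C` is a ring of smooth functions on an open set. -/
structure DiffMetric where
  /-- the coordinate derivations `∂_k` -/
  d : Fin n → Derivation ℝ C C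
  /-- the coordinate derivations commute -/
  comm : ∀ i j f, d i (d j f) = d j (d i f)
  /-- the matrix `g_ij` -/
  G : Matrix (Fin n) (Fin n) C
  /-- the inverse matrix `g^ij` -/
  A : Matrix (Fin n) (Fin n) C
  /-- `g_ij` is symmetric -/
  symm : Gᵀ = G
  /-- `A` is the inverse of `G` -/
  inv : A * G = 1

namespace DiffMetric

variable (g : DiffMetric n C)

lemma symm_apply (i j : Fin n) : g.G i j = g.G j i := congrFun (congrFun g.symm j) i

lemma inv' : g.G * g.A = 1 := mul_eq_one_comm.1 g.inv

lemma A_symm : g.Aᵀ = g.A := by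
  have h : g.Aᵀ * g.G = 1 := by
    rw [← g.symm, ← Matrix.transpose_mul, g.inv', Matrix.transpose_one]
  calc g.Aᵀ = g.Aᵀ * (g.G * g.A) := by rw [g.inv', mul_one]
    _ = g.A := by rw [← mul_assoc, h, one_mul]

lemma dMat_comm (i j : Fin n) (X : Matrix (Fin n) (Fin n) C) :
    dMat (g.d i) (dMat (g.d j) X) = dMat (g.d j) (dMat (g.d i) X) := by
  ext; simp [g.comm i j]

/-- The Christoffel symbols of the first kind, `(g.first i) a j = ⟨∇_i ∂_j, ∂_a⟩`. -/
def first (i : Fin n) : Matrix (Fin n) (Fin n) C :=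
  Matrix.of fun a j => (1 / 2 : ℝ) • (g.d i (g.G j a) + g.d j (g.G i a) - g.d a (g.G i j))

/-- The connection matrices `(g.Γ i) l j = Γ^l_ij`. -/
def Γ (i : Fin n) : Matrix (Fin n) (Fin n) C := g.A * g.first i

lemma G_mul_Γ (i : Fin n) : g.G * g.Γ i = g.first i := by
  rw [Γ, ← mul_assoc, g.inv', one_mul]

lemma first_symm (i j a : Fin n) : g.first i a j = g.first j a i := by
  simp only [first, Matrix.of_apply, g.symm_apply i j]
  rw [add_comm]

/-- The Levi-Civita connection is torsion free. -/
lemma Γ_symm (i j l : Fin n) : g.Γ i l j = g.Γ j l i := by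
  simp only [Γ, Matrix.mul_apply, g.first_symm i j]

/-- The Levi-Civita connection is compatible with the metric. -/
lemma compat (i : Fin n) : dMat (g.d i) g.G = g.G * g.Γ i + (g.Γ i)ᵀ * g.G := by
  have : (g.Γ i)ᵀ * g.G = (g.first i)ᵀ := by
    rw [← g.G_mul_Γ, Matrix.transpose_mul, g.symm]
  rw [this, G_mul_Γ]
  ext a j
  simp only [dMat_apply, Matrix.add_apply, Matrix.transpose_apply, first, Matrix.of_apply,
    ← smul_add, g.symm_apply j a]
  have : g.d i (g.G a j) + g.d j (g.G i a) - g.d a (g.G i j) +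
      (g.d i (g.G a j) + g.d a (g.G i j) - g.d j (g.G i a)) = (2 : ℝ) • g.d i (g.G a j) := by
    rw [two_smul]; ring
  rw [this, smul_smul]; norm_num

/-- The curvature matrices `(g.Rm i j) l k = R^l_ijk`. -/
def Rm (i j : Fin n) : Matrix (Fin n) (Fin n) C :=
  dMat (g.d i) (g.Γ j) - dMat (g.d j) (g.Γ i) + (g.Γ i * g.Γ j - g.Γ j * g.Γ i)

lemma Rm_swap (i j : Fin n) : g.Rm j i = -g.Rm i j := by
  simp only [Rm]; abel

/-- The components `R_ijkl` of the curvature tensor. -/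
def riem (i j k l : Fin n) : C := (g.G * g.Rm i j) k l

/-- The matrix `R_ik` of the Ricci tensor. -/
def Ric : Matrix (Fin n) (Fin n) C :=
  Matrix.of fun i k => ∑ j, ∑ l, g.A j l * g.riem i j k l

/-- Antisymmetry of the curvature tensor in the last two indices, in matrix form; it comes from
`∂_i ∂_j g = ∂_j ∂_i g` and metric compatibility. -/
lemma G_mul_Rm_antisymm (i j : Fin n) : g.G * g.Rm i j + (g.Rm i j)ᵀ * g.G = 0 := by
  have h := g.dMat_comm i j g.G
  simp only [compat, dMat_add, dMat_mul, dMat_transpose] at h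
  rw [← sub_eq_zero] at h
  rw [← h, Rm]
  simp only [Matrix.transpose_add, Matrix.transpose_sub, Matrix.transpose_mul]
  noncomm_ring

lemma riem_antisymm (i j k l : Fin n) : g.riem i j l k = -g.riem i j k l := by
  have h := congrFun (congrFun (g.G_mul_Rm_antisymm i j) l) k
  have h2 : (g.Rm i j)ᵀ * g.G = (g.G * g.Rm i j)ᵀ := by rw [Matrix.transpose_mul, g.symm]
  rw [h2] at h
  exact eq_neg_of_add_eq_zero_left h

lemma riem_antisymm_left (i j k l : Fin n) : g.riem j i k l = -g.riem i j k l := by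
  simp [riem, g.Rm_swap i j]

/-- The Ricci tensor is the trace `R_jk = R^l_ljk` of the curvature. -/
lemma Ric_apply (j k : Fin n) : g.Ric j k = ∑ l, g.Rm l j l k := by
  have h : ∀ a, g.Rm a j a k = ∑ l, g.A a l * g.riem a j l k := by
    intro a
    have : g.Rm a j = g.A * (g.G * g.Rm a j) := by rw [← mul_assoc, g.inv, one_mul]
    conv_lhs => rw [this, Matrix.mul_apply]
    rfl
  simp only [Ric, Matrix.of_apply, h]
  refine Finset.sum_congr rfl fun a _ => Finset.sum_congr rfl fun l _ => ?_
  rw [g.riem_antisymm j a l k, g.riem_antisymm_left a j l k, neg_neg]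

/-- The first Bianchi identity. -/
lemma first_bianchi (i j k l : Fin n) : g.Rm i j l k + g.Rm j k l i + g.Rm k i l j = 0 := by
  simp only [Rm, Matrix.add_apply, Matrix.sub_apply, dMat_apply, Matrix.mul_apply]
  rw [g.Γ_symm i k l, g.Γ_symm j i l, g.Γ_symm k j l]
  have h1 : ∀ m, g.Γ j m i = g.Γ i m j := fun m => g.Γ_symm _ _ _
  have h2 : ∀ m, g.Γ k m j = g.Γ j m k := fun m => g.Γ_symm _ _ _
  have h3 : ∀ m, g.Γ i m k = g.Γ k m i := fun m => g.Γ_symm _ _ _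
  simp only [h1, h2, h3]
  ring

lemma trace_Rm (i j : Fin n) : (g.Rm i j).trace = 0 := by
  have h1 : g.Rm i j = g.A * (g.G * g.Rm i j) := by rw [← mul_assoc, g.inv, one_mul]
  have h2 : (g.Rm i j).trace = -(g.Rm i j).trace := by
    conv_lhs => rw [h1, ← Matrix.trace_transpose, Matrix.transpose_mul, g.A_symm,
      Matrix.transpose_mul, g.symm, eq_neg_of_add_eq_zero_right (g.G_mul_Rm_antisymm i j),
      Matrix.neg_mul, Matrix.trace_neg, Matrix.trace_mul_comm, ← h1]
  have h3 : (2 : ℝ) • (g.Rm i j).trace = 0 := by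
    rw [two_smul]; nth_rewrite 1 [h2]; simp
  have := congrArg (fun x => (1 / 2 : ℝ) • x) h3
  simpa [smul_smul] using this

lemma Ric_symm : g.Ricᵀ = g.Ric := by
  ext j k
  have h : ∑ l, (g.Rm l k l j + g.Rm k j l l + g.Rm j l l k) = 0 :=
    Finset.sum_eq_zero fun l _ => g.first_bianchi l k j l
  have h2 : ∀ l, g.Rm j l l k = -g.Rm l j l k := fun l => by simp [g.Rm_swap l j]
  simp only [Finset.sum_add_distrib, h2, Finset.sum_neg_distrib, ← Ric_apply] at h
  have h3 : ∑ l, g.Rm k j l l = 0 := g.trace_Rm k j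
  rw [h3, add_zero] at h
  exact eq_of_sub_eq_zero (by rw [Matrix.transpose_apply, sub_eq_add_neg]; exact h)

/-- The second Bianchi identity, in matrix form. -/
lemma bianchi (a b c : Fin n) :
    dMat (g.d a) (g.Rm b c) + (g.Γ a * g.Rm b c - g.Rm b c * g.Γ a)
      + (dMat (g.d b) (g.Rm c a) + (g.Γ b * g.Rm c a - g.Rm c a * g.Γ b))
      + (dMat (g.d c) (g.Rm a b) + (g.Γ c * g.Rm a b - g.Rm a b * g.Γ c)) = 0 := by
  simp only [Rm, dMat_add, dMat_sub, dMat_mul]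
  rw [g.dMat_comm b a (g.Γ c), g.dMat_comm c a (g.Γ b), g.dMat_comm c b (g.Γ a)]
  noncomm_ring

/-- The mixed Ricci tensor `R^i_j`. -/
def mixed : Matrix (Fin n) (Fin n) C := g.A * g.Ric

/-- The scalar curvature. -/
def scal : C := g.mixed.trace

/-! ### Change of coordinates -/

/-- `g'` is the pullback of `g` along the ring homomorphism `f` ("composition with the coordinate
change") with Jacobian matrix `J`. -/
structure IsPullback (g' : DiffMetric n C') (f : C →ₐ[ℝ] C') (J : Matrix (Fin n) (Fin n) C') :
    Prop where
  /-- the chain rule -/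
  chain : ∀ i x, g'.d i (f x) = ∑ a, J a i * f (g.d a x)
  /-- the second derivatives of the coordinate change commute -/
  hess : ∀ i j a, g'.d i (J a j) = g'.d j (J a i)
  /-- `g'` is the pulled back metric -/
  metric : g'.G = Jᵀ * g.G.map f * J

namespace IsPullback

variable {g} {g' : DiffMetric n C'} {f : C →ₐ[ℝ] C'} {J : Matrix (Fin n) (Fin n) C'}
  (H : g.IsPullback g' f J)

include H

lemma left_inv : (g'.A * Jᵀ * g.G.map f) * J = 1 := by
  rw [← g'.inv, H.metric]; noncomm_ring

lemma right_inv : J * (g'.A * Jᵀ * g.G.map f) = 1 := mul_eq_one_comm.1 H.left_inv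

lemma A_map : J * g'.A * Jᵀ = g.A.map f := by
  have h1 : g.G.map f * g.A.map f = 1 := by
    rw [← Matrix.map_mul, g.inv', Matrix.map_one _ (map_zero f) (map_one f)]
  calc J * g'.A * Jᵀ = J * (g'.A * Jᵀ * g.G.map f) * g.A.map f := by
        simp only [mul_assoc, h1, mul_one]
    _ = _ := by rw [H.right_inv, one_mul]

lemma dMat_map (i : Fin n) (X : Matrix (Fin n) (Fin n) C) :
    dMat (g'.d i) (X.map f) = ∑ a, J a i • (dMat (g.d a) X).map f := by
  ext p q
  simp [H.chain, Matrix.sum_apply]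

end IsPullback

/-- The pulled back connection matrix. -/
def pullΓ (f : C →ₐ[ℝ] C') (J : Matrix (Fin n) (Fin n) C') (i : Fin n) :
    Matrix (Fin n) (Fin n) C' := ∑ b, J b i • (g.Γ b).map f

/-- The pulled back curvature matrix. -/
def pullRm (f : C →ₐ[ℝ] C') (J : Matrix (Fin n) (Fin n) C') (i j : Fin n) :
    Matrix (Fin n) (Fin n) C' := ∑ a, ∑ b, (J a i * J b j) • (g.Rm a b).map f

lemma map_matrix_add (f : C →ₐ[ℝ] C') (X Y : Matrix (Fin n) (Fin n) C) :
    (X + Y).map f = X.map f + Y.map f := by ext; simp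

/-- A family `Y_i` of matrices that is antisymmetric as `(Y_i)_aj = -(Y_i)_ja` and symmetric as
`(Y_i)_aj = (Y_j)_ai` vanishes; this is the uniqueness of the Levi-Civita connection. -/
lemma eq_zero_of_antisymm_of_symm (Y : Fin n → Matrix (Fin n) (Fin n) C)
    (h1 : ∀ i, Y i + (Y i)ᵀ = 0) (h2 : ∀ i j a, Y i a j = Y j a i) (i : Fin n) : Y i = 0 := by
  have h1' : ∀ i a j, Y i a j = -Y i j a := fun i a j =>
    eq_neg_of_add_eq_zero_left (congrFun (congrFun (h1 i) a) j)
  ext a j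
  have : Y i a j = - Y i a j := by
    calc Y i a j = Y j a i := h2 _ _ _
      _ = -Y j i a := h1' _ _ _
      _ = -Y a i j := by rw [h2 j a i]
      _ = Y a j i := by rw [h1' a i j, neg_neg]
      _ = Y i j a := h2 _ _ _
      _ = -Y i a j := h1' _ _ _
  have h3 : (2 : ℝ) • Y i a j = 0 := by
    rw [two_smul]; nth_rewrite 1 [this]; simp
  have := congrArg (fun x => (1 / 2 : ℝ) • x) h3
  simpa [smul_smul] using this

namespace IsPullback

variable {g} {g' : DiffMetric n C'} {f : C →ₐ[ℝ] C'} {J : Matrix (Fin n) (Fin n) C'}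
  (H : g.IsPullback g' f J)

include H

/-- The transformation law of the connection. -/
lemma gauge (i : Fin n) : J * g'.Γ i = g.pullΓ f J i * J + dMat (g'.d i) J := by
  set Z : Fin n → Matrix (Fin n) (Fin n) C' :=
    fun i => J * g'.Γ i - (g.pullΓ f J i * J + dMat (g'.d i) J)
  have hZ : ∀ i, Jᵀ * g.G.map f * Z i = 0 := by
    refine eq_zero_of_antisymm_of_symm (fun i => Jᵀ * g.G.map f * Z i) ?_ ?_
    · intro i
      have hG : (g.G.map f)ᵀ = g.G.map f := by rw [← Matrix.transpose_map, g.symm]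
      have h1 := g'.compat i
      have h2 : dMat (g'.d i) (g.G.map f) =
          g.G.map f * g.pullΓ f J i + (g.pullΓ f J i)ᵀ * g.G.map f := by
        rw [H.dMat_map]
        simp only [compat, map_matrix_add, Matrix.map_mul, smul_add, Finset.sum_add_distrib, pullΓ,
          Matrix.mul_sum, Matrix.transpose_sum, Matrix.sum_mul, Matrix.transpose_smul,
          Matrix.mul_smul, Matrix.smul_mul, Matrix.transpose_map]
      rw [H.metric, dMat_mul, dMat_mul, h2, dMat_transpose] at h1
      rw [← sub_eq_zero] at h1
      rw [← neg_eq_zero, ← h1]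
      simp only [Z, Matrix.transpose_mul, Matrix.transpose_sub, Matrix.transpose_add,
        Matrix.transpose_transpose, hG]
      noncomm_ring
    · intro i j a
      have h3 : ∀ i j b, Z i b j = Z j b i := by
        intro i j b
        have e1 : (J * g'.Γ i) b j = (J * g'.Γ j) b i := by
          simp only [Matrix.mul_apply, g'.Γ_symm i j]
        have e2 : (g.pullΓ f J i * J) b j = (g.pullΓ f J j * J) b i := by
          simp only [Matrix.mul_apply, pullΓ, Matrix.sum_apply, Finset.sum_mul, Matrix.smul_apply,
            Matrix.map_apply, smul_eq_mul]
          rw [Finset.sum_comm]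
          refine Finset.sum_congr rfl fun p _ => Finset.sum_congr rfl fun q _ => ?_
          rw [g.Γ_symm]; ring
        simp only [Z, Matrix.sub_apply, Matrix.add_apply, e1, e2, dMat_apply, H.hess i j]
      simp only [Matrix.mul_apply (M := Jᵀ * g.G.map f), h3 i j]
  have : Z i = 0 := by
    calc Z i = J * (g'.A * Jᵀ * g.G.map f) * Z i := by rw [H.right_inv, one_mul]
      _ = J * g'.A * (Jᵀ * g.G.map f * Z i) := by noncomm_ring
      _ = 0 := by rw [hZ i, mul_zero]
  exact sub_eq_zero.1 this

lemma dMat_pullΓ (i j : Fin n) : dMat (g'.d i) (g.pullΓ f J j) =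
    (∑ b, g'.d i (J b j) • (g.Γ b).map f)
      + ∑ a, ∑ b, (J a i * J b j) • (dMat (g.d a) (g.Γ b)).map f := by
  simp only [pullΓ, dMat_sum, dMat_smul, H.dMat_map, Finset.sum_add_distrib]
  congr 1
  rw [Finset.sum_comm]
  refine Finset.sum_congr rfl fun b _ => ?_
  rw [Finset.smul_sum]
  refine Finset.sum_congr rfl fun a _ => ?_
  rw [smul_smul, mul_comm]

/-- The pulled back curvature is the curvature of the pulled back connection. -/
lemma pullRm_eq (i j : Fin n) : g.pullRm f J i j =
    dMat (g'.d i) (g.pullΓ f J j) - dMat (g'.d j) (g.pullΓ f J i)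
      + (g.pullΓ f J i * g.pullΓ f J j - g.pullΓ f J j * g.pullΓ f J i) := by
  have hm : ∀ i j, g.pullΓ f J i * g.pullΓ f J j =
      ∑ a, ∑ b, (J a i * J b j) • ((g.Γ a).map f * (g.Γ b).map f) := by
    intro i j
    simp only [pullΓ, Matrix.sum_mul, Matrix.mul_sum, Matrix.smul_mul, Matrix.mul_smul]
    rw [Finset.sum_comm]
    refine Finset.sum_congr rfl fun a _ => ?_
    rw [Finset.smul_sum]
    refine Finset.sum_congr rfl fun b _ => ?_
    rw [smul_smul, mul_comm]
  rw [H.dMat_pullΓ, H.dMat_pullΓ, hm, hm]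
  simp only [H.hess j i, pullRm]
  rw [Finset.sum_comm (f := fun a b => (J a j * J b i) • (dMat (g.d a) (g.Γ b)).map f),
    Finset.sum_comm (f := fun a b => (J a j * J b i) • ((g.Γ a).map f * (g.Γ b).map f)),
    add_sub_add_left_eq_sub]
  simp only [← Finset.sum_sub_distrib, ← Finset.sum_add_distrib]
  refine Finset.sum_congr rfl fun a _ => Finset.sum_congr rfl fun b _ => ?_
  rw [mul_comm (J b j), ← smul_sub, ← smul_sub, ← smul_add]
  congr 1
  ext p q
  simp [Rm, Matrix.mul_apply]

/-- The transformation law of the curvature. -/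
lemma curvature (i j : Fin n) : J * g'.Rm i j = g.pullRm f J i j * J := by
  have hd : ∀ i, dMat (g'.d i) J = J * g'.Γ i - g.pullΓ f J i * J := fun i => by
    rw [H.gauge i]; abel
  have h := g'.dMat_comm i j J
  rw [hd, hd, dMat_sub, dMat_sub, dMat_mul, dMat_mul, dMat_mul, dMat_mul, hd, hd,
    ← sub_eq_zero] at h
  rw [← sub_eq_zero, ← h, H.pullRm_eq, Rm]
  noncomm_ring

lemma riem_eq (i j k l : Fin n) : g'.riem i j k l =
    ∑ a, ∑ b, ∑ c, ∑ e, J a i * J b j * J c k * J e l * f (g.riem a b c e) := by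
  have h : g'.G * g'.Rm i j = ∑ a, ∑ b, (J a i * J b j) • (Jᵀ * (g.G * g.Rm a b).map f * J) := by
    rw [H.metric, mul_assoc, H.curvature, pullRm]
    simp only [Matrix.sum_mul, Matrix.mul_sum, Matrix.smul_mul, Matrix.mul_smul, Matrix.map_mul,
      mul_assoc]
  rw [riem, h]
  simp only [Matrix.sum_apply, Matrix.smul_apply, Matrix.mul_apply (N := J), smul_eq_mul,
    Matrix.mul_apply (M := Jᵀ), Finset.sum_mul, Finset.mul_sum, Matrix.transpose_apply,
    Matrix.map_apply]
  refine Finset.sum_congr rfl fun a _ => Finset.sum_congr rfl fun b _ => ?_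
  rw [Finset.sum_comm]
  refine Finset.sum_congr rfl fun c _ => Finset.sum_congr rfl fun e _ => ?_
  rw [riem]; ring

/-- The transformation law of the Ricci tensor. -/
lemma Ric_eq : g'.Ric = Jᵀ * g.Ric.map f * J := by
  set K := g'.A * Jᵀ * g.G.map f with hK
  have hR : ∀ i j, g'.Rm i j = K * g.pullRm f J i j * J := fun i j => by
    rw [mul_assoc, ← H.curvature, ← mul_assoc, H.left_inv, one_mul]
  have hJK : ∀ a c, ∑ l, J a l * K l c = (1 : Matrix (Fin n) (Fin n) C') a c := fun a c => by
    rw [← H.right_inv, Matrix.mul_apply]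
  ext j k
  rw [Ric_apply]
  have e1 : ∀ l, g'.Rm l j l k = ∑ q, ∑ p, ∑ a, ∑ b,
      (J a l * K l p) * (J b j * f (g.Rm a b p q) * J q k) := by
    intro l
    rw [hR, Matrix.mul_apply]
    simp only [Matrix.mul_apply, pullRm, Matrix.sum_apply, Matrix.smul_apply, smul_eq_mul,
      Finset.mul_sum, Finset.sum_mul, Matrix.map_apply]
    refine Finset.sum_congr rfl fun q _ => Finset.sum_congr rfl fun p _ =>
      Finset.sum_congr rfl fun a _ => Finset.sum_congr rfl fun b _ => by ring
  simp only [e1]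
  rw [Finset.sum_comm, Matrix.mul_apply]
  refine Finset.sum_congr rfl fun q _ => ?_
  simp only [Matrix.mul_apply, Matrix.transpose_apply, Matrix.map_apply, Ric_apply, map_sum,
    Finset.sum_mul, Finset.mul_sum]
  rw [Finset.sum_comm]
  have e2 : ∀ p, ∑ l, ∑ a, ∑ b, (J a l * K l p) * (J b j * f (g.Rm a b p q) * J q k)
      = ∑ b, J b j * f (g.Rm p b p q) * J q k := by
    intro p
    rw [Finset.sum_comm]
    have : ∀ a, ∑ l, ∑ b, (J a l * K l p) * (J b j * f (g.Rm a b p q) * J q k)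
        = (1 : Matrix (Fin n) (Fin n) C') a p * ∑ b, J b j * f (g.Rm a b p q) * J q k := by
      intro a
      rw [← hJK, Finset.sum_mul]
      simp only [Finset.mul_sum]
    simp only [this]
    rw [Finset.sum_eq_single p]
    · simp
    · intro b _ hb; simp [hb]
    · simp
  simp only [e2]
  rw [Finset.sum_comm]

lemma mixed_eq : J * g'.mixed = g.mixed.map f * J := by
  have : (g.mixed).map f = g.A.map f * g.Ric.map f := by rw [mixed, Matrix.map_mul]
  rw [this, mixed, H.Ric_eq, ← H.A_map]
  noncomm_ring

lemma trace_mixed_pow (k : ℕ) : (g'.mixed ^ k).trace = f (g.mixed ^ k).trace := by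
  have h : ∀ k : ℕ, J * g'.mixed ^ k = (g.mixed.map f) ^ k * J := by
    intro k
    induction k with
    | zero => simp
    | succ k ih => rw [pow_succ, ← mul_assoc, ih, mul_assoc, H.mixed_eq, pow_succ, mul_assoc]
  have h2 : g'.mixed ^ k = (g'.A * Jᵀ * g.G.map f) * ((g.mixed.map f) ^ k * J) := by
    rw [← h, ← mul_assoc, H.left_inv, one_mul]
  have h3 : (g.mixed.map f) ^ k = (g.mixed ^ k).map f :=
    (map_pow (f.toRingHom.mapMatrix) g.mixed k).symm
  rw [h2, Matrix.trace_mul_comm, mul_assoc, H.right_inv, mul_one, h3]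
  simp [Matrix.trace]

end IsPullback

end DiffMetric

end Algebra
/-! ### Evolution of the Ricci tensor in normal coordinates -/

section Evolution

variable {n : ℕ} {C : Type*} [CommRing C] [Algebra ℝ C]

/-- A symmetric array contracted with an antisymmetric one vanishes. -/
lemma sum_symm_mul_antisymm (X Y : Fin n → Fin n → ℝ)
    (hX : ∀ i j, X i j = X j i) (hY : ∀ i j, Y i j = -Y j i) : ∑ i, ∑ j, X i j * Y i j = 0 := by
  have : ∑ i, ∑ j, X i j * Y i j = -∑ i, ∑ j, X i j * Y i j := by
    conv_lhs => rw [Finset.sum_comm]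
    simp only [← Finset.sum_neg_distrib]
    refine Finset.sum_congr rfl fun i _ => Finset.sum_congr rfl fun j _ => ?_
    rw [hX, hY]; ring
  linarith

namespace DiffMetric

variable (g : DiffMetric n C)

/-- `dt` is a time derivative under which `g` solves the Ricci flow. -/
structure IsFlow (dt : Derivation ℝ C C) : Prop where
  /-- the time derivative commutes with the coordinate derivatives -/
  comm : ∀ i f, dt (g.d i f) = g.d i (dt f)
  /-- the Ricci flow equation -/
  flow : dMat dt g.G = -(2 : ℝ) • g.Ric

/-- The point at which `ev` evaluates is the centre of normal coordinates: the metric is the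
identity matrix and the Christoffel symbols vanish. -/
structure IsNormal (ev : C →ₐ[ℝ] ℝ) : Prop where
  /-- the metric is the identity matrix at the point -/
  metric : g.G.map ev = 1
  /-- the Christoffel symbols vanish at the point -/
  christoffel : ∀ i, (g.Γ i).map ev = 0

variable {g}

lemma map_matrix_mul (ev : C →ₐ[ℝ] ℝ) (X Y : Matrix (Fin n) (Fin n) C) :
    (X * Y).map ev = X.map ev * Y.map ev := Matrix.map_mul

lemma map_matrix_sub (ev : C →ₐ[ℝ] ℝ) (X Y : Matrix (Fin n) (Fin n) C) :
    (X - Y).map ev = X.map ev - Y.map ev := by ext; simp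

lemma map_matrix_smul (ev : C →ₐ[ℝ] ℝ) (a : ℝ) (X : Matrix (Fin n) (Fin n) C) :
    (a • X).map ev = a • X.map ev := by ext; simp

variable (g) in
/-- The derivatives `∂_a Γ^l_ij` at the point, as `g.P ev a i l j`. -/
def P (ev : C →ₐ[ℝ] ℝ) (a i : Fin n) : Matrix (Fin n) (Fin n) ℝ := (dMat (g.d a) (g.Γ i)).map ev

variable (g) in
/-- The second derivatives `∂_a ∂_b R_ij` at the point, as `g.S ev a b i j`. -/
def S (ev : C →ₐ[ℝ] ℝ) (a b : Fin n) : Matrix (Fin n) (Fin n) ℝ :=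
  (dMat (g.d a) (dMat (g.d b) g.Ric)).map ev

lemma P_symm (ev : C →ₐ[ℝ] ℝ) (a i l j : Fin n) : g.P ev a i l j = g.P ev a j l i := by
  simp [P, g.Γ_symm i j l]

lemma S_comm (ev : C →ₐ[ℝ] ℝ) (a b : Fin n) : g.S ev a b = g.S ev b a := by
  rw [S, dMat_comm, S]

namespace IsNormal

variable {ev : C →ₐ[ℝ] ℝ} (H : g.IsNormal ev)

include H

lemma inverse : g.A.map ev = 1 := by
  have h : (g.A * g.G).map ev = 1 := by
    rw [g.inv, Matrix.map_one _ (map_zero ev) (map_one ev)]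
  rwa [map_matrix_mul, H.metric, mul_one] at h

lemma dG (k : Fin n) : (dMat (g.d k) g.G).map ev = 0 := by
  rw [compat, map_matrix_add, map_matrix_mul, map_matrix_mul, Matrix.transpose_map, H.christoffel]
  simp

lemma dA (k : Fin n) : (dMat (g.d k) g.A).map ev = 0 := by
  have h : (dMat (g.d k) (g.A * g.G)).map ev = 0 := by
    rw [g.inv, dMat_one, Matrix.map_zero _ (map_zero ev)]
  rwa [dMat_mul, map_matrix_add, map_matrix_mul, map_matrix_mul, H.dG, H.metric, mul_one, mul_zero,
    add_zero] at h

lemma ddG (a b : Fin n) :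
    (dMat (g.d a) (dMat (g.d b) g.G)).map ev = g.P ev a b + (g.P ev a b)ᵀ := by
  rw [compat, dMat_add, dMat_mul, dMat_mul, dMat_transpose]
  simp only [map_matrix_add, map_matrix_mul, Matrix.transpose_map, H.christoffel, H.metric, P]
  simp

lemma ddA (a b : Fin n) :
    (dMat (g.d a) (dMat (g.d b) g.A)).map ev = -(g.P ev a b + (g.P ev a b)ᵀ) := by
  have h : (dMat (g.d a) (dMat (g.d b) (g.A * g.G))).map ev = 0 := by
    rw [g.inv, dMat_one]
    ext; simp
  simp only [dMat_mul, dMat_add, map_matrix_add, map_matrix_mul, H.metric, H.inverse, H.dA, H.dG, H.ddG,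
    mul_one, one_mul, mul_zero, add_zero, zero_add] at h
  exact eq_neg_of_add_eq_zero_left h

lemma Rm_ev (i j l k : Fin n) : ev (g.Rm i j l k) = g.P ev i j l k - g.P ev j i l k := by
  have : (g.Rm i j).map ev = g.P ev i j - g.P ev j i := by
    simp only [Rm, map_matrix_add, map_matrix_sub, map_matrix_mul, H.christoffel, P]
    simp
  exact congrFun (congrFun this l) k

lemma riem_ev (i j l k : Fin n) : ev (g.riem i j l k) = ev (g.Rm i j l k) := by
  have : (g.G * g.Rm i j).map ev = (g.Rm i j).map ev := by
    rw [map_matrix_mul, H.metric, one_mul]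
  exact congrFun (congrFun this l) k

lemma Rm_antisymm (i j l k : Fin n) : ev (g.Rm i j k l) = -ev (g.Rm i j l k) := by
  rw [← H.riem_ev, ← H.riem_ev, g.riem_antisymm, map_neg]

omit H in
lemma Rm_antisymm_left (ev : C →ₐ[ℝ] ℝ) (i j l k : Fin n) :
    ev (g.Rm j i l k) = -ev (g.Rm i j l k) := by
  rw [g.Rm_swap i j]; simp

omit H in
lemma Ric_ev (ev : C →ₐ[ℝ] ℝ) (i k : Fin n) : ev (g.Ric i k) = ∑ l, ev (g.Rm l i l k) := by
  rw [g.Ric_apply, map_sum]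

lemma Ric_ev' (i k : Fin n) : ev (g.Ric i k) = ∑ l, ev (g.Rm i l k l) := by
  rw [Ric_ev]
  refine Finset.sum_congr rfl fun l _ => ?_
  rw [H.Rm_antisymm, Rm_antisymm_left, neg_neg]

/-- The twice differentiated identity `g^{ak} R^l_cak = g^{lp} R_cp`. -/
lemma sum_ddRm (c l d : Fin n) :
    ∑ a, ev (g.d d (g.d l (g.Rm c a l a))) = g.S ev d l c l
      - ∑ p, (g.P ev d l l p + g.P ev d l p l) * ev (g.Ric c p)
      + ∑ a, ∑ k, (g.P ev d l a k + g.P ev d l k a) * ev (g.Rm c a l k) := by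
  have h : ∑ a, ∑ k, g.A a k * g.Rm c a l k = ∑ p, g.A l p * g.Ric c p := by
    have e : ∀ a, g.Rm c a = g.A * (g.G * g.Rm c a) := fun a => by
      rw [← mul_assoc, g.inv, one_mul]
    have e2 : ∀ a k, g.Rm c a l k = ∑ p, g.A l p * g.riem c a p k := fun a k => by
      conv_lhs => rw [e a, Matrix.mul_apply]
      rfl
    simp only [e2, Ric, Matrix.of_apply, Finset.mul_sum]
    calc _ = ∑ a, ∑ p, ∑ k, g.A a k * (g.A l p * g.riem c a p k) :=
          Finset.sum_congr rfl fun a _ => Finset.sum_comm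
      _ = ∑ p, ∑ a, ∑ k, g.A a k * (g.A l p * g.riem c a p k) := Finset.sum_comm
      _ = _ := Finset.sum_congr rfl fun p _ => Finset.sum_congr rfl fun a _ =>
          Finset.sum_congr rfl fun k _ => by ring
  have hA : ∀ i j, ev (g.A i j) = (1 : Matrix (Fin n) (Fin n) ℝ) i j := fun i j =>
    congrFun (congrFun H.inverse i) j
  have hdA : ∀ k i j, ev (g.d k (g.A i j)) = 0 := fun k i j => congrFun (congrFun (H.dA k) i) j
  have hddA : ∀ a b i j, ev (g.d a (g.d b (g.A i j))) = -(g.P ev a b i j + g.P ev a b j i) :=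
    fun a b i j => congrFun (congrFun (H.ddA a b) i) j
  have h2 := congrArg (fun x => ev (g.d d (g.d l x))) h
  simp only [map_sum, Derivation.leibniz, smul_eq_mul, map_add, map_mul, hA, hdA, hddA, mul_zero,
    zero_mul, add_zero, Finset.sum_add_distrib, Matrix.one_apply, ite_mul, one_mul,
    Finset.sum_ite_eq, Finset.mem_univ, if_true, mul_neg, Finset.sum_neg_distrib,
    Finset.sum_const_zero] at h2
  have e3 : ev (g.d d (g.d l (g.Ric c l))) = g.S ev d l c l := rfl
  rw [e3] at h2
  have e4 : ∀ p, (g.P ev d l l p + g.P ev d l p l) * ev (g.Ric c p) =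
    ev (g.Ric c p) * (g.P ev d l l p + g.P ev d l p l) := fun p => mul_comm _ _
  have e5 : ∀ a k, (g.P ev d l a k + g.P ev d l k a) * ev (g.Rm c a l k) =
    ev (g.Rm c a l k) * (g.P ev d l a k + g.P ev d l k a) := fun a k => mul_comm _ _
  simp only [e4, e5]
  linarith

/-- The contracted second Bianchi identity `2 ∇^a R_ca = ∇_c R`, differentiated once, in normal
coordinates. -/
lemma contracted_bianchi (c d : Fin n) :
    2 * ∑ a, g.S ev d a c a =
      ∑ a, g.S ev d c a a + 2 * ∑ a, ∑ m, ev (g.Ric c m) * g.P ev d a m a := by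
  have hs' : ∀ i j, ev (g.Ric i j) = ev (g.Ric j i) := fun i j => by
    rw [← congrFun (congrFun g.Ric_symm i) j]; rfl
  have key : ∀ a l, ev (g.d d (g.d a (g.Rm l c l a))) + ev (g.d d (g.d l (g.Rm c a l a)))
      + ev (g.d d (g.d c (g.Rm a l l a)))
      + ((∑ m, g.P ev d a l m * ev (g.Rm l c m a)) - ∑ m, ev (g.Rm l c l m) * g.P ev d a m a)
      + ((∑ m, g.P ev d l l m * ev (g.Rm c a m a)) - ∑ m, ev (g.Rm c a l m) * g.P ev d l m a)
      + ((∑ m, g.P ev d c l m * ev (g.Rm a l m a)) - ∑ m, ev (g.Rm a l l m) * g.P ev d c m a)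
      = 0 := by
    intro a l
    have h := congrArg (fun X => (dMat (g.d d) X).map ev) (g.bianchi a l c)
    have h0 : (dMat (g.d d) (0 : Matrix (Fin n) (Fin n) C)).map ev = 0 := by ext; simp
    simp only [dMat_add, dMat_sub, dMat_mul, map_matrix_add, map_matrix_sub, map_matrix_mul, H.christoffel,
      zero_mul, mul_zero, add_zero, zero_add, h0] at h
    have h2 := congrFun (congrFun h l) a
    simp only [Matrix.add_apply, Matrix.sub_apply, Matrix.mul_apply, Matrix.map_apply,
      Matrix.zero_apply, dMat_apply] at h2
    simp only [P, Matrix.map_apply, dMat_apply]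
    linarith
  have hsum : ∑ a, ∑ l, (ev (g.d d (g.d a (g.Rm l c l a))) + ev (g.d d (g.d l (g.Rm c a l a)))
      + ev (g.d d (g.d c (g.Rm a l l a)))
      + ((∑ m, g.P ev d a l m * ev (g.Rm l c m a)) - ∑ m, ev (g.Rm l c l m) * g.P ev d a m a)
      + ((∑ m, g.P ev d l l m * ev (g.Rm c a m a)) - ∑ m, ev (g.Rm c a l m) * g.P ev d l m a)
      + ((∑ m, g.P ev d c l m * ev (g.Rm a l m a)) - ∑ m, ev (g.Rm a l l m) * g.P ev d c m a))
      = 0 := Finset.sum_eq_zero fun a _ => Finset.sum_eq_zero fun l _ => key a l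
  simp only [Finset.sum_add_distrib, Finset.sum_sub_distrib] at hsum
  have T1 : ∑ a, ∑ l, ev (g.d d (g.d a (g.Rm l c l a))) = ∑ a, g.S ev d a c a := by
    refine Finset.sum_congr rfl fun a _ => ?_
    simp only [S, Matrix.map_apply, dMat_apply, Ric_apply, map_sum]
  have T3 : ∑ a, ∑ l, ev (g.d d (g.d c (g.Rm a l l a))) = -∑ a, g.S ev d c a a := by
    rw [← Finset.sum_neg_distrib]
    refine Finset.sum_congr rfl fun a _ => ?_
    simp only [S, Matrix.map_apply, dMat_apply, Ric_apply, map_sum, ← Finset.sum_neg_distrib]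
    refine Finset.sum_congr rfl fun l _ => ?_
    rw [g.Rm_swap l a]; simp
  have T2 : ∑ a, ∑ l, ev (g.d d (g.d l (g.Rm c a l a))) = ∑ l, g.S ev d l c l
      - ∑ l, ∑ p, g.P ev d l l p * ev (g.Ric c p) - ∑ l, ∑ p, ev (g.Ric c p) * g.P ev d l p l
      + ∑ a, ∑ l, ∑ k, ev (g.Rm c a l k) * g.P ev d l k a := by
    rw [Finset.sum_comm]
    simp only [H.sum_ddRm, add_mul, Finset.sum_add_distrib, Finset.sum_sub_distrib]
    have z : ∑ l, ∑ a, ∑ k, g.P ev d l a k * ev (g.Rm c a l k) = 0 := by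
      rw [Finset.sum_comm]
      refine Finset.sum_eq_zero fun a _ => ?_
      exact sum_symm_mul_antisymm (fun l k => g.P ev d l a k) (fun l k => ev (g.Rm c a l k))
        (fun l k => P_symm _ _ _ _ _) (fun l k => H.Rm_antisymm _ _ _ _)
    have z2 : ∑ l, ∑ a, ∑ k, g.P ev d l k a * ev (g.Rm c a l k)
        = ∑ a, ∑ l, ∑ k, ev (g.Rm c a l k) * g.P ev d l k a := by
      rw [Finset.sum_comm]
      exact Finset.sum_congr rfl fun _ _ => Finset.sum_congr rfl fun _ _ =>
        Finset.sum_congr rfl fun _ _ => mul_comm _ _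
    have z3 : ∀ l p, g.P ev d l p l * ev (g.Ric c p) = ev (g.Ric c p) * g.P ev d l p l :=
      fun _ _ => mul_comm _ _
    rw [z, z2]
    simp only [z3]
    ring
  have c1 : ∑ a, ∑ l, ∑ m, g.P ev d a l m * ev (g.Rm l c m a) = 0 := by
    rw [Finset.sum_comm]
    refine Finset.sum_eq_zero fun l _ => ?_
    exact sum_symm_mul_antisymm (fun a m => g.P ev d a l m) (fun a m => ev (g.Rm l c m a))
      (fun a m => P_symm _ _ _ _ _) (fun a m => H.Rm_antisymm _ _ _ _)
  have c2 : ∑ a, ∑ l, ∑ m, ev (g.Rm l c l m) * g.P ev d a m a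
      = ∑ a, ∑ m, ev (g.Ric c m) * g.P ev d a m a := by
    refine Finset.sum_congr rfl fun a _ => ?_
    rw [Finset.sum_comm]
    refine Finset.sum_congr rfl fun m _ => ?_
    rw [Ric_ev, Finset.sum_mul]
  have c3 : ∑ a, ∑ l, ∑ m, g.P ev d l l m * ev (g.Rm c a m a)
      = ∑ l, ∑ m, g.P ev d l l m * ev (g.Ric c m) := by
    rw [Finset.sum_comm]
    refine Finset.sum_congr rfl fun l _ => ?_
    rw [Finset.sum_comm]
    refine Finset.sum_congr rfl fun m _ => ?_
    rw [H.Ric_ev', Finset.mul_sum]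
  have c5 : ∑ a, ∑ l, ∑ m, g.P ev d c l m * ev (g.Rm a l m a)
      = -∑ l, ∑ m, g.P ev d c l m * ev (g.Ric l m) := by
    rw [Finset.sum_comm, ← Finset.sum_neg_distrib]
    refine Finset.sum_congr rfl fun l _ => ?_
    rw [Finset.sum_comm, ← Finset.sum_neg_distrib]
    refine Finset.sum_congr rfl fun m _ => ?_
    rw [Ric_ev, Finset.mul_sum, ← Finset.sum_neg_distrib]
    refine Finset.sum_congr rfl fun a _ => ?_
    rw [H.Rm_antisymm]; ring
  have c6 : ∑ a, ∑ l, ∑ m, ev (g.Rm a l l m) * g.P ev d c m a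
      = -∑ l, ∑ m, g.P ev d c l m * ev (g.Ric l m) := by
    have : ∑ l, ∑ m, g.P ev d c l m * ev (g.Ric l m)
        = ∑ a, ∑ m, g.P ev d c m a * ev (g.Ric a m) := by
      rw [Finset.sum_comm]
      refine Finset.sum_congr rfl fun a _ => Finset.sum_congr rfl fun m _ => ?_
      rw [hs' a m]
    rw [this, ← Finset.sum_neg_distrib]
    refine Finset.sum_congr rfl fun a _ => ?_
    rw [Finset.sum_comm, ← Finset.sum_neg_distrib]
    refine Finset.sum_congr rfl fun m _ => ?_
    rw [Ric_ev, Finset.mul_sum, ← Finset.sum_neg_distrib]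
    refine Finset.sum_congr rfl fun l _ => ?_
    rw [Rm_antisymm_left]; ring
  rw [T1, T2, T3, c1, c2, c3, c5, c6] at hsum
  linarith

section Flow

variable {dt : Derivation ℝ C C} (hf : g.IsFlow dt)

include hf

omit H in
lemma _root_.RicciFlow.DiffMetric.IsFlow.dMat_comm (i : Fin n) (X : Matrix (Fin n) (Fin n) C) :
    dMat dt (dMat (g.d i) X) = dMat (g.d i) (dMat dt X) := by
  ext; simp [hf.comm]

lemma dtA : (dMat dt g.A).map ev = (2 : ℝ) • g.Ric.map ev := by
  have h : (dMat dt (g.A * g.G)).map ev = 0 := by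
    rw [g.inv, dMat_one, Matrix.map_zero _ (map_zero ev)]
  rw [dMat_mul, map_matrix_add, map_matrix_mul, map_matrix_mul, H.metric, hf.flow, H.inverse, mul_one,
    one_mul, map_matrix_smul] at h
  rw [eq_neg_of_add_eq_zero_left h, neg_smul, neg_neg]

/-- The variation of the Christoffel symbols, differentiated once. -/
lemma d_dtΓ (a i l j : Fin n) : ev (g.d a (dt (g.Γ i l j))) =
    -(g.S ev a i j l + g.S ev a j i l - g.S ev a l i j)
      + 2 * ∑ m, ev (g.Ric l m) * g.P ev a i m j := by
  have h1 := congrArg (fun X => (dMat (g.d a) (dMat dt X)).map ev) (g.G_mul_Γ i)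
  simp only [dMat_mul, dMat_add, map_matrix_add, map_matrix_mul, H.christoffel, H.metric, H.dG, hf.flow,
    map_matrix_smul, mul_zero, zero_mul, one_mul, zero_add] at h1
  have h2 := congrFun (congrFun h1 l) j
  have hfl : ∀ p q, dt (g.G p q) = -(2 : ℝ) • g.Ric p q := fun p q =>
    congrFun (congrFun hf.flow p) q
  simp only [Matrix.add_apply, Matrix.mul_apply, Matrix.smul_apply, Matrix.map_apply, dMat_apply,
    first, Matrix.of_apply, Derivation.map_smul, map_smul, map_add, map_sub, hf.comm, hfl,
    smul_eq_mul] at h2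
  simp only [S, P, Matrix.map_apply, dMat_apply, Finset.mul_sum]
  have : ∀ m, 2 * (ev (g.Ric l m) * ev (g.d a (g.Γ i m j)))
      = -(-2 * ev (g.Ric l m) * ev (g.d a (g.Γ i m j))) := fun m => by ring
  simp only [this, Finset.sum_neg_distrib]
  linarith

/-- The evolution of the Ricci tensor in normal coordinates. -/
lemma dtRic (j k : Fin n) : ev (dt (g.Ric j k)) =
    ∑ l, g.S ev l l j k + 2 * ∑ l, ∑ m, ev (g.Ric l m) * ev (g.Rm l j m k)
      - ∑ a, ∑ m, ev (g.Ric k m) * g.P ev j a m a - ∑ a, ∑ m, ev (g.Ric j m) * g.P ev k a m a := by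
  have hs := g.Ric_symm
  have e1 : ∀ i j, (dMat dt (g.Rm i j)).map ev =
      (dMat (g.d i) (dMat dt (g.Γ j))).map ev - (dMat (g.d j) (dMat dt (g.Γ i))).map ev := by
    intro i j
    simp only [Rm, dMat_add, dMat_sub, dMat_mul, map_matrix_add, map_matrix_sub, map_matrix_mul,
      H.christoffel, hf.dMat_comm]
    simp
  have e2 : ∀ l, ev (dt (g.Rm l j l k)) =
      ev (g.d l (dt (g.Γ j l k))) - ev (g.d j (dt (g.Γ l l k))) := fun l =>
    congrFun (congrFun (e1 l j) l) k
  have hS : ∀ a b i j, g.S ev a b i j = g.S ev a b j i := fun a b i j => by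
    have : (g.S ev a b)ᵀ = g.S ev a b := by
      simp only [S, ← Matrix.transpose_map, ← dMat_transpose, hs]
    exact congrFun (congrFun this j) i
  rw [g.Ric_apply, map_sum, map_sum]
  simp only [e2, H.d_dtΓ hf, H.Rm_ev, mul_sub, Finset.sum_sub_distrib, Finset.sum_add_distrib,
    Finset.sum_neg_distrib, ← Finset.mul_sum]
  have b1 := H.contracted_bianchi k j
  have b2 := H.contracted_bianchi j k
  have f1 : ∑ l, g.S ev l j k l = ∑ a, g.S ev j a k a :=
    Finset.sum_congr rfl fun a _ => by rw [S_comm]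
  have f2 : ∑ l, g.S ev l k j l = ∑ a, g.S ev k a j a :=
    Finset.sum_congr rfl fun a _ => by rw [S_comm]
  have f3 : ∑ l, g.S ev j l k l = ∑ l, g.S ev j l l k :=
    Finset.sum_congr rfl fun a _ => by rw [hS]
  have f4 : ∑ l, g.S ev k j l l = ∑ l, g.S ev j k l l :=
    Finset.sum_congr rfl fun a _ => by rw [S_comm]
  linarith

/-- The evolution of the mixed Ricci tensor `R^i_k` in normal coordinates. The commutator with
`Σ_l ∂_l Γ^i_lm` is due to the use of the coordinate Laplacian; it does not contribute to traces
of powers. -/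
lemma mixed_box (i k : Fin n) :
    ev (dt (g.mixed i k)) - ∑ l, ev (g.d l (g.d l (g.mixed i k))) =
      2 * ∑ l, ∑ m, ev (g.Ric l m) * ev (g.Rm l i m k)
        + ((∑ l, g.P ev l l) * g.Ric.map ev - g.Ric.map ev * (∑ l, g.P ev l l)) i k := by
  have hs := g.Ric_symm
  have hr : (g.Ric.map ev)ᵀ = g.Ric.map ev := by rw [← Matrix.transpose_map, hs]
  set r := g.Ric.map ev with hrdef
  set Q := ∑ l, g.P ev l l with hQ
  have e1 : (dMat dt g.mixed).map ev = (2 : ℝ) • r * r + (dMat dt g.Ric).map ev := by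
    simp only [mixed, dMat_mul, map_matrix_add, map_matrix_mul, H.dtA hf, H.inverse, one_mul, hrdef]
  have e2 : ∀ l, (dMat (g.d l) (dMat (g.d l) g.mixed)).map ev =
      -(g.P ev l l + (g.P ev l l)ᵀ) * r + g.S ev l l := by
    intro l
    simp only [mixed, dMat_mul, dMat_add, map_matrix_add, map_matrix_mul, H.ddA, H.dA, H.inverse,
      one_mul, zero_mul, add_zero, zero_add, hrdef, S]
  have e1' : ev (dt (g.mixed i k)) = _ := congrFun (congrFun e1 i) k
  have e2' : ∀ l, ev (g.d l (g.d l (g.mixed i k))) = _ := fun l => congrFun (congrFun (e2 l) i) k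
  -- tracing the curvature relates the two traces of the derivatives of the Christoffel symbols
  have hT : ∀ j m, ∑ a, g.P ev j a m a = Q m j + r j m := by
    intro j m
    have : r j m = ∑ l, ev (g.Rm j l m l) := H.Ric_ev' j m
    rw [this, hQ, Matrix.sum_apply, ← Finset.sum_add_distrib]
    refine Finset.sum_congr rfl fun a _ => ?_
    rw [H.Rm_ev, P_symm ev a a m j]
    ring
  have e3 : ev (dt (g.Ric i k)) = ∑ l, g.S ev l l i k
      + 2 * ∑ l, ∑ m, ev (g.Ric l m) * ev (g.Rm l i m k)
      - (Qᵀ * r + r * r) i k - (r * Q + r * r) i k := by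
    rw [H.dtRic hf]
    have t1 : ∑ a, ∑ m, ev (g.Ric k m) * g.P ev i a m a = (Qᵀ * r + r * r) i k := by
      rw [Finset.sum_comm, Matrix.add_apply, Matrix.mul_apply, Matrix.mul_apply,
        ← Finset.sum_add_distrib]
      refine Finset.sum_congr rfl fun m _ => ?_
      rw [← Finset.mul_sum, hT, ← congrFun (congrFun hr m) k]
      simp only [Matrix.transpose_apply]
      change r k m * _ = _
      ring
    have t2 : ∑ a, ∑ m, ev (g.Ric i m) * g.P ev k a m a = (r * Q + r * r) i k := by
      rw [Finset.sum_comm, Matrix.add_apply, Matrix.mul_apply, Matrix.mul_apply,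
        ← Finset.sum_add_distrib]
      refine Finset.sum_congr rfl fun m _ => ?_
      rw [← Finset.mul_sum, hT, ← congrFun (congrFun hr k) m]
      simp only [Matrix.transpose_apply]
      change r i m * _ = _
      ring
    rw [t1, t2]
  have e4 : ∑ l, (-(g.P ev l l + (g.P ev l l)ᵀ) * r + g.S ev l l) i k
      = -((Q + Qᵀ) * r) i k + ∑ l, g.S ev l l i k := by
    simp only [Matrix.add_apply, Finset.sum_add_distrib]
    congr 1
    rw [← Matrix.sum_apply, ← Finset.sum_mul, Finset.sum_neg_distrib, Finset.sum_add_distrib,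
      ← Matrix.transpose_sum, ← hQ, neg_mul, Matrix.neg_apply]
  rw [e1']
  simp only [e2']
  rw [e4]
  simp only [Matrix.add_apply, Matrix.map_apply, dMat_apply, e3, Matrix.smul_mul, add_mul,
    Matrix.sub_apply, Matrix.smul_apply, smul_eq_mul]
  ring

end Flow

end IsNormal

end DiffMetric

end Evolution
section Evolution

variable {n : ℕ} {C : Type*} [CommRing C] [Algebra ℝ C]

namespace DiffMetric.IsNormal

variable {g : DiffMetric n C} {ev : C →ₐ[ℝ] ℝ} {dt : Derivation ℝ C C}
  (H : g.IsNormal ev) (hf : g.IsFlow dt)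

include H

lemma mixed_ev : g.mixed.map ev = g.Ric.map ev := by
  rw [mixed, map_matrix_mul, H.inverse, one_mul]

lemma mixed_apply_ev (i j : Fin n) : ev (g.mixed i j) = ev (g.Ric i j) :=
  congrFun (congrFun H.mixed_ev i) j

lemma d_mixed_ev (l i j : Fin n) : ev (g.d l (g.mixed i j)) = ev (g.d l (g.Ric i j)) := by
  have : (dMat (g.d l) g.mixed).map ev = (dMat (g.d l) g.Ric).map ev := by
    rw [mixed, dMat_mul, map_matrix_add, map_matrix_mul, map_matrix_mul, H.dA, H.inverse, one_mul, zero_mul,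
      zero_add]
  exact congrFun (congrFun this i) j

include hf

/-- The evolution equation `(∂_t - Δ) R = 2 |Ric|²` of the scalar curvature. -/
lemma scal_box : ev (dt g.scal) - ∑ l, ev (g.d l (g.d l g.scal)) =
    2 * ∑ i, ∑ j, ev (g.Ric i j) ^ 2 := by
  have h : ∑ i, (ev (dt (g.mixed i i)) - ∑ l, ev (g.d l (g.d l (g.mixed i i)))) =
      2 * ∑ i, ∑ j, ev (g.Ric i j) ^ 2 := by
    simp only [H.mixed_box hf, Finset.sum_add_distrib]
    have h0 : ∑ i, ((∑ l, g.P ev l l) * g.Ric.map ev - g.Ric.map ev * (∑ l, g.P ev l l)) i i = 0 :=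
      by
        change Matrix.trace _ = 0
        rw [Matrix.trace_sub, Matrix.trace_mul_comm, sub_self]
    rw [h0, add_zero, ← Finset.mul_sum]
    congr 1
    rw [Finset.sum_comm]
    refine Finset.sum_congr rfl fun l _ => ?_
    rw [Finset.sum_comm]
    refine Finset.sum_congr rfl fun m _ => ?_
    rw [← Finset.mul_sum, ← H.Ric_ev']
    ring
  rw [← h, Finset.sum_sub_distrib, Finset.sum_comm]
  simp [scal, Matrix.trace]

/-- The evolution equation `(∂_t - Δ) |Ric|² = 4 Rm(Ric, Ric) - 2 |∇ Ric|²`. -/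
lemma trace_sq_box :
    ev (dt (g.mixed ^ 2).trace) - ∑ l, ev (g.d l (g.d l (g.mixed ^ 2).trace)) =
      4 * ∑ i, ∑ k, ∑ l, ∑ m, ev (g.Ric i k) * ev (g.Ric l m) * ev (g.Rm l i m k)
        - 2 * ∑ l, ∑ i, ∑ j, ev (g.d l (g.Ric i j)) ^ 2 := by
  have hs := g.Ric_symm
  have hs' : ∀ i j, g.Ric i j = g.Ric j i := fun i j => congrFun (congrFun hs j) i
  have e1 : ev (dt (g.mixed ^ 2).trace) = 2 * ∑ i, ∑ j, ev (g.Ric i j) * ev (dt (g.mixed j i)) := by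
    have : ∑ i, ∑ j, ev (dt (g.mixed i j)) * ev (g.Ric j i)
        = ∑ i, ∑ j, ev (g.Ric i j) * ev (dt (g.mixed j i)) := by
      rw [Finset.sum_comm]
      exact Finset.sum_congr rfl fun _ _ => Finset.sum_congr rfl fun _ _ => mul_comm _ _
    simp only [sq, Matrix.trace, Matrix.diag_apply, Matrix.mul_apply, map_sum, Derivation.leibniz,
      smul_eq_mul, map_add, map_mul, H.mixed_apply_ev, Finset.sum_add_distrib]
    simp only [mul_comm (ev (g.Ric _ _)) (ev (dt (g.mixed _ _)))] at this ⊢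
    rw [two_mul, Finset.sum_comm (f := fun i j => ev (dt (g.mixed i j)) * ev (g.Ric j i))]
  have e2 : ∀ l, ev (g.d l (g.d l (g.mixed ^ 2).trace)) =
      2 * (∑ i, ∑ j, ev (g.Ric i j) * ev (g.d l (g.d l (g.mixed j i))))
        + 2 * ∑ i, ∑ j, ev (g.d l (g.Ric i j)) ^ 2 := by
    intro l
    have h1 : ∑ i, ∑ j, ev (g.Ric j i) * ev (g.d l (g.d l (g.mixed i j)))
        = ∑ i, ∑ j, ev (g.Ric i j) * ev (g.d l (g.d l (g.mixed j i))) := Finset.sum_comm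
    have h2 : ∀ i j, ev (g.d l (g.Ric i j)) * ev (g.d l (g.Ric j i)) =
        ev (g.d l (g.Ric i j)) ^ 2 := fun i j => by rw [hs' j i, sq]
    simp only [sq (g.mixed), Matrix.trace, Matrix.diag_apply, Matrix.mul_apply, map_sum,
      Derivation.leibniz,
      smul_eq_mul, map_add, map_mul, H.mixed_apply_ev, H.d_mixed_ev, Finset.sum_add_distrib, h1,
      h2]
    have h3 : ∑ i, ∑ j, ev (g.d l (g.Ric j i)) ^ 2 = ∑ i, ∑ j, ev (g.d l (g.Ric i j)) ^ 2 :=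
      Finset.sum_comm
    rw [h3]
    ring
  have e3 : ∀ i j, ev (dt (g.mixed j i)) = ∑ l, ev (g.d l (g.d l (g.mixed j i)))
      + (2 * ∑ l, ∑ m, ev (g.Ric l m) * ev (g.Rm l j m i)
        + ((∑ l, g.P ev l l) * g.Ric.map ev - g.Ric.map ev * (∑ l, g.P ev l l)) j i) := by
    intro i j
    rw [← H.mixed_box hf]; ring
  have e4 : ∑ i, ∑ j, ev (g.Ric i j) *
      ((∑ l, g.P ev l l) * g.Ric.map ev - g.Ric.map ev * (∑ l, g.P ev l l)) j i = 0 := by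
    have : (g.Ric.map ev * ((∑ l, g.P ev l l) * g.Ric.map ev
        - g.Ric.map ev * (∑ l, g.P ev l l))).trace = 0 := by
      rw [mul_sub, Matrix.trace_sub, Matrix.trace_mul_comm, mul_assoc, Matrix.trace_mul_comm,
        mul_assoc, sub_self]
    simpa only [Matrix.trace, Matrix.diag_apply, Matrix.mul_apply (M := g.Ric.map ev) (N := _ - _),
      Matrix.map_apply] using this
  have e5 : ∑ i, ∑ j, ev (g.Ric i j) * (∑ l, ev (g.d l (g.d l (g.mixed j i))))
      = ∑ l, ∑ i, ∑ j, ev (g.Ric i j) * ev (g.d l (g.d l (g.mixed j i))) := by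
    simp only [Finset.mul_sum]
    rw [Finset.sum_comm]
    rw [Finset.sum_comm (t := Finset.univ) (s := Finset.univ)
      (f := fun l i => ∑ j, ev (g.Ric i j) * ev (g.d l (g.d l (g.mixed j i))))]
    rw [Finset.sum_comm]
    exact Finset.sum_congr rfl fun _ _ => Finset.sum_comm
  have e6 : ∑ i, ∑ j, ev (g.Ric i j) * (2 * ∑ l, ∑ m, ev (g.Ric l m) * ev (g.Rm l j m i))
      = 2 * ∑ i, ∑ k, ∑ l, ∑ m, ev (g.Ric i k) * ev (g.Ric l m) * ev (g.Rm l i m k) := by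
    simp only [Finset.mul_sum]
    rw [Finset.sum_comm]
    refine Finset.sum_congr rfl fun i _ => Finset.sum_congr rfl fun k _ =>
      Finset.sum_congr rfl fun l _ => Finset.sum_congr rfl fun m _ => ?_
    rw [hs' k i]; ring
  rw [e1]
  simp only [e2, e3, mul_add, Finset.sum_add_distrib]
  rw [e4, e5, e6]
  simp only [← Finset.mul_sum]
  ring

end DiffMetric.IsNormal

end Evolution

/-! ### The pinching inequality at a point -/

section Pointwise

variable {n : ℕ}

/-- The Cauchy-Schwarz inequality for matrices. -/
lemma sum_mul_le_sqrt (X Y : Fin n → Fin n → ℝ) :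
    ∑ i, ∑ j, X i j * Y i j ≤ √(∑ i, ∑ j, X i j ^ 2) * √(∑ i, ∑ j, Y i j ^ 2) := by
  have := Real.sum_mul_le_sqrt_mul_sqrt (Finset.univ : Finset (Fin n × Fin n))
    (fun p => X p.1 p.2) (fun p => Y p.1 p.2)
  simpa only [Fintype.sum_prod_type] using this

/-- `|⟨W(E), E⟩| ≤ |W| |E|²`. -/
lemma sum_four_le (W : Fin n → Fin n → Fin n → Fin n → ℝ) (X : Matrix (Fin n) (Fin n) ℝ) :
    ∑ i, ∑ k, ∑ l, ∑ m, X i k * X l m * W l i m k ≤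
      √(∑ i, ∑ j, ∑ k, ∑ l, W i j k l ^ 2) * ∑ i, ∑ j, X i j ^ 2 := by
  have := Real.sum_mul_le_sqrt_mul_sqrt (Finset.univ : Finset (Fin n × Fin n × Fin n × Fin n))
    (fun p => W p.1 p.2.1 p.2.2.1 p.2.2.2) (fun p => X p.2.1 p.2.2.2 * X p.1 p.2.2.1)
  simp only [Fintype.sum_prod_type] at this
  have h1 : ∑ i, ∑ j, ∑ k, ∑ l, (X j l * X i k) ^ 2 = (∑ i, ∑ j, X i j ^ 2) ^ 2 := by
    rw [sq, Finset.sum_mul_sum]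
    refine Finset.sum_congr rfl fun i _ => Finset.sum_congr rfl fun j _ => ?_
    rw [Finset.sum_mul_sum]
    exact Finset.sum_congr rfl fun k _ => Finset.sum_congr rfl fun l _ => by ring
  rw [h1, Real.sqrt_sq (by positivity)] at this
  refine le_trans (le_of_eq ?_) this
  calc ∑ i, ∑ k, ∑ l, ∑ m, X i k * X l m * W l i m k
      = ∑ i, ∑ l, ∑ k, ∑ m, X i k * X l m * W l i m k :=
        Finset.sum_congr rfl fun _ _ => Finset.sum_comm
    _ = ∑ l, ∑ i, ∑ k, ∑ m, X i k * X l m * W l i m k := Finset.sum_comm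
    _ = ∑ l, ∑ i, ∑ m, ∑ k, X i k * X l m * W l i m k :=
        Finset.sum_congr rfl fun _ _ => Finset.sum_congr rfl fun _ _ => Finset.sum_comm
    _ = _ := Finset.sum_congr rfl fun _ _ => Finset.sum_congr rfl fun _ _ =>
        Finset.sum_congr rfl fun _ _ => Finset.sum_congr rfl fun _ _ => by ring

/-- `|tr X³| ≤ |X|³`. -/
lemma abs_trace_cube_le (X : Matrix (Fin n) (Fin n) ℝ) :
    |(X * X * X).trace| ≤ (∑ i, ∑ j, X i j ^ 2) * √(∑ i, ∑ j, X i j ^ 2) := by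
  set q := ∑ i, ∑ j, X i j ^ 2 with hq
  have hq0 : 0 ≤ q := by positivity
  have h2 : √(∑ i, ∑ j, (X * X) i j ^ 2) ≤ q := by
    rw [Real.sqrt_le_left hq0, sq, hq]
    have : ∀ i j, (X * X) i j ^ 2 ≤ (∑ k, X i k ^ 2) * ∑ k, X k j ^ 2 := fun i j => by
      rw [Matrix.mul_apply]; exact Finset.sum_mul_sq_le_sq_mul_sq _ _ _
    calc ∑ i, ∑ j, (X * X) i j ^ 2 ≤ ∑ i, ∑ j, (∑ k, X i k ^ 2) * ∑ k, X k j ^ 2 :=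
          Finset.sum_le_sum fun i _ => Finset.sum_le_sum fun j _ => this i j
      _ = _ := by
          rw [← Finset.sum_mul_sum]
          congr 1
          exact Finset.sum_comm
  have h3 : √(∑ i, ∑ j, X j i ^ 2) = √q := by rw [Finset.sum_comm]
  have h4 : (X * X * X).trace = ∑ i, ∑ j, (X * X) i j * X j i := by
    simp only [Matrix.trace, Matrix.diag_apply, Matrix.mul_apply (M := X * X)]
  rw [h4, abs_le]
  constructor
  · have := sum_mul_le_sqrt (fun i j => -(X * X) i j) (fun i j => X j i)
    simp only [neg_mul, Finset.sum_neg_distrib, neg_sq] at this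
    rw [h3] at this
    nlinarith [mul_le_mul_of_nonneg_right h2 (Real.sqrt_nonneg q)]
  · have := sum_mul_le_sqrt (fun i j => (X * X) i j) (fun i j => X j i)
    rw [h3] at this
    nlinarith [mul_le_mul_of_nonneg_right h2 (Real.sqrt_nonneg q)]

/-- The decomposition of `Rm(E, E)` into its Weyl, Ricci and scalar parts, for a trace free
symmetric `E = r - (s/n) δ`, in an orthonormal frame. -/
lemma curvature_decomposition (Rv W : Fin n → Fin n → Fin n → Fin n → ℝ)
    (r X : Matrix (Fin n) (Fin n) ℝ) (a b s : ℝ)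
    (hX : Xᵀ = X) (hX0 : X.trace = 0) (hr : r = X + (s / n) • (1 : Matrix (Fin n) (Fin n) ℝ))
    (hW : ∀ i j k l, W i j k l = Rv i j k l
      - a * ((1 : Matrix (Fin n) (Fin n) ℝ) i k * r j l + (1 : Matrix (Fin n) (Fin n) ℝ) j l * r i k
        - (1 : Matrix (Fin n) (Fin n) ℝ) i l * r j k - (1 : Matrix (Fin n) (Fin n) ℝ) j k * r i l)
      + b * ((1 : Matrix (Fin n) (Fin n) ℝ) i k * (1 : Matrix (Fin n) (Fin n) ℝ) j l
        - (1 : Matrix (Fin n) (Fin n) ℝ) i l * (1 : Matrix (Fin n) (Fin n) ℝ) j k)) :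
    ∑ i, ∑ k, ∑ l, ∑ m, X i k * X l m * Rv l i m k =
      ∑ i, ∑ k, ∑ l, ∑ m, X i k * X l m * W l i m k
        - 2 * a * ((X * X * X).trace + s / n * ∑ i, ∑ j, X i j ^ 2)
        + b * ∑ i, ∑ j, X i j ^ 2 := by
  have hXs : ∀ i j, X i j = X j i := fun i j => congrFun (congrFun hX j) i
  have htr : ∑ i, X i i = 0 := hX0
  have hrs : ∀ i j, r i j = r j i := by
    intro i j
    have : rᵀ = r := by rw [hr]; simp [hX]
    exact congrFun (congrFun this j) i
  have hXXr : (X * X * r).trace = (X * X * X).trace + s / n * ∑ i, ∑ j, X i j ^ 2 := by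
    have h1 : (X * X).trace = ∑ i, ∑ j, X i j ^ 2 := by
      simp only [Matrix.trace, Matrix.diag_apply, Matrix.mul_apply]
      refine Finset.sum_congr rfl fun i _ => Finset.sum_congr rfl fun j _ => ?_
      rw [hXs j i, sq]
    rw [hr, mul_add, Matrix.trace_add, Matrix.mul_smul, mul_one, Matrix.trace_smul, h1, smul_eq_mul]
  rw [← hXXr]
  have hR : ∀ i k l m, X i k * X l m * Rv l i m k = X i k * X l m * W l i m k
      + (a * (X i k * r i k * (X l m * (1 : Matrix (Fin n) (Fin n) ℝ) l m))
      + a * (X i k * (1 : Matrix (Fin n) (Fin n) ℝ) i k * (X l m * r l m))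
      - a * (X i k * (X l m * r i m * (1 : Matrix (Fin n) (Fin n) ℝ) l k))
      - a * (X i k * (X l m * r l k * (1 : Matrix (Fin n) (Fin n) ℝ) i m)))
      - (b * (X i k * (1 : Matrix (Fin n) (Fin n) ℝ) i k
          * (X l m * (1 : Matrix (Fin n) (Fin n) ℝ) l m))
        - b * (X i k * (X l m * (1 : Matrix (Fin n) (Fin n) ℝ) l k *
          (1 : Matrix (Fin n) (Fin n) ℝ) i m))) := by
    intro i k l m
    rw [hW]; ring
  simp only [hR, Finset.sum_add_distrib, Finset.sum_sub_distrib, ← Finset.mul_sum]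
  have o1 : ∑ i, ∑ k, X i k * (1 : Matrix (Fin n) (Fin n) ℝ) i k = 0 := by
    simp [Matrix.one_apply, htr]
  have o2 : ∀ f : Fin n → Fin n → ℝ,
      ∑ i, ∑ k, f i k * (∑ l, ∑ m, X l m * (1 : Matrix (Fin n) (Fin n) ℝ) l m) = 0 := by
    intro f; simp [o1]
  have o3 : ∀ c : ℝ, ∑ i, ∑ k, X i k * (1 : Matrix (Fin n) (Fin n) ℝ) i k * c = 0 := by
    intro c; simp only [← Finset.sum_mul, o1, zero_mul]
  have o4 : ∑ i, ∑ k, X i k * (∑ l, ∑ m, X l m * r i m * (1 : Matrix (Fin n) (Fin n) ℝ) l k)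
      = (X * X * r).trace := by
    simp only [Matrix.trace, Matrix.diag_apply, Matrix.mul_apply, Finset.sum_mul, Finset.mul_sum]
    refine Finset.sum_congr rfl fun i _ => ?_
    have : ∀ k, ∑ l, ∑ m, X i k * (X l m * r i m * (1 : Matrix (Fin n) (Fin n) ℝ) l k)
        = ∑ m, X i k * X k m * r m i := by
      intro k
      rw [Finset.sum_comm]
      refine Finset.sum_congr rfl fun m _ => ?_
      simp only [Matrix.one_apply, mul_ite, mul_one, mul_zero, Finset.sum_ite_eq', Finset.mem_univ,
        if_true]
      rw [hrs i m]; ring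
    simp only [this]
    exact Finset.sum_comm
  have o5 : ∑ i, ∑ k, X i k * (∑ l, ∑ m, X l m * r l k * (1 : Matrix (Fin n) (Fin n) ℝ) i m)
      = (X * X * r).trace := by
    simp only [Matrix.trace, Matrix.diag_apply, Matrix.mul_apply, Finset.sum_mul]
    have h1 : ∀ i k, X i k * (∑ l, ∑ m, X l m * r l k * (1 : Matrix (Fin n) (Fin n) ℝ) i m)
        = ∑ l, X l i * X i k * r k l := by
      intro i k
      simp only [Matrix.one_apply, mul_ite, mul_one, mul_zero, Finset.sum_ite_eq, Finset.mem_univ,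
        if_true, Finset.mul_sum]
      refine Finset.sum_congr rfl fun l _ => ?_
      rw [hrs k l]; ring
    simp only [h1]
    calc ∑ i, ∑ k, ∑ l, X l i * X i k * r k l = ∑ i, ∑ l, ∑ k, X l i * X i k * r k l :=
          Finset.sum_congr rfl fun _ _ => Finset.sum_comm
      _ = ∑ l, ∑ i, ∑ k, X l i * X i k * r k l := Finset.sum_comm
      _ = _ := Finset.sum_congr rfl fun _ _ => Finset.sum_comm
  have o6 : ∑ i, ∑ k, X i k * (∑ l, ∑ m, X l m * (1 : Matrix (Fin n) (Fin n) ℝ) l k *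
      (1 : Matrix (Fin n) (Fin n) ℝ) i m) = ∑ i, ∑ j, X i j ^ 2 := by
    refine Finset.sum_congr rfl fun i _ => Finset.sum_congr rfl fun k _ => ?_
    simp only [Matrix.one_apply, mul_ite, mul_one, mul_zero, Finset.sum_ite_eq, Finset.mem_univ,
      if_true, Finset.sum_ite_eq']
    rw [hXs k i, sq]
  rw [o2, o3, o3, o4, o5, o6]
  ring

/-- The algebraic heart of the maximum principle argument: at a point where
`h = |E|² - κ (R + c)²` attains a maximum with value zero, the reaction terms in the evolution of
`h` force `κ (R + c) ≤ |W| + 2 √κ (R + c) + |R|`. Here `r` is the Ricci tensor, `s` the scalar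
curvature, `D l` the derivative of the Ricci tensor in the direction `l`. -/
lemma pinching_at_max (hn : 3 ≤ n) (Rv W : Fin n → Fin n → Fin n → Fin n → ℝ)
    (r : Matrix (Fin n) (Fin n) ℝ) (D : Fin n → Matrix (Fin n) (Fin n) ℝ) (s c κ : ℝ)
    (hrs : rᵀ = r) (hs : s = r.trace)
    (hRic : ∀ i k, ∑ l, Rv l i l k = r i k) (hRic' : ∀ i k, ∑ l, Rv i l k l = r i k)
    (hW : ∀ i j k l, W i j k l = Rv i j k l
      - 1 / ((n : ℝ) - 2) * ((1 : Matrix (Fin n) (Fin n) ℝ) i k * r j l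
        + (1 : Matrix (Fin n) (Fin n) ℝ) j l * r i k
        - (1 : Matrix (Fin n) (Fin n) ℝ) i l * r j k - (1 : Matrix (Fin n) (Fin n) ℝ) j k * r i l)
      + s / (((n : ℝ) - 1) * ((n : ℝ) - 2)) * ((1 : Matrix (Fin n) (Fin n) ℝ) i k *
          (1 : Matrix (Fin n) (Fin n) ℝ) j l
        - (1 : Matrix (Fin n) (Fin n) ℝ) i l * (1 : Matrix (Fin n) (Fin n) ℝ) j k))
    (hκ : 0 < κ) (hφ : 0 < s + c)
    (hq : ∑ i, ∑ j, r i j ^ 2 - s ^ 2 / n = κ * (s + c) ^ 2)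
    (hgrad : ∀ l, ∑ i, ∑ j, r i j * D l i j - s * (D l).trace / n = κ * (s + c) * (D l).trace)
    (hbox : 0 ≤ (4 * ∑ i, ∑ k, ∑ l, ∑ m, r i k * r l m * Rv l i m k
        - 2 * ∑ l, ∑ i, ∑ j, D l i j ^ 2)
      - (4 * s * ∑ i, ∑ j, r i j ^ 2 - 2 * ∑ l, (D l).trace ^ 2) / n
      - κ * (4 * (s + c) * ∑ i, ∑ j, r i j ^ 2 - 2 * ∑ l, (D l).trace ^ 2)) :
    κ * (s + c) ≤ √(∑ i, ∑ j, ∑ k, ∑ l, W i j k l ^ 2) + 2 * √κ * (s + c) + |s| := by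
  have hn3 : (3 : ℝ) ≤ n := by exact_mod_cast hn
  have hn0 : (n : ℝ) ≠ 0 := by positivity
  set X : Matrix (Fin n) (Fin n) ℝ := r - (s / n) • (1 : Matrix (Fin n) (Fin n) ℝ) with hXdef
  have hX : Xᵀ = X := by simp [hXdef, hrs]
  have hX0 : X.trace = 0 := by
    simp only [hXdef, Matrix.trace_sub, Matrix.trace_smul, Matrix.trace_one, Fintype.card_fin,
      smul_eq_mul, ← hs]
    field_simp; ring
  have hr : r = X + (s / n) • (1 : Matrix (Fin n) (Fin n) ℝ) := by simp [hXdef]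
  have hrX : ∀ i j, r i j = X i j + s / n * (1 : Matrix (Fin n) (Fin n) ℝ) i j := fun i j => by
    conv_lhs => rw [hr]
    simp
  -- orthogonality of the trace free part and the trace part
  have horth : ∀ Y : Matrix (Fin n) (Fin n) ℝ,
      ∑ i, ∑ j, r i j * Y i j = ∑ i, ∑ j, X i j * Y i j + s / n * Y.trace := by
    intro Y
    simp only [hrX, add_mul, Finset.sum_add_distrib]
    congr 1
    simp [Matrix.one_apply, Matrix.trace, Finset.mul_sum]
  set q := ∑ i, ∑ j, X i j ^ 2 with hqdef
  have hrr : ∑ i, ∑ j, r i j ^ 2 = q + s ^ 2 / n := by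
    have h1 := horth r
    have h2 := horth X
    have h3 : ∑ i, ∑ j, X i j * r i j = ∑ i, ∑ j, r i j * X i j := by simp only [mul_comm]
    rw [hX0] at h2
    simp only [sq]
    rw [h1, h3, h2, ← hs, hqdef]
    simp only [sq]
    ring
  have hqκ : q = κ * (s + c) ^ 2 := by rw [← hq, hrr]; ring
  have hq0 : 0 < q := by rw [hqκ]; positivity
  have hsq : √q = √κ * (s + c) := by
    rw [hqκ, Real.sqrt_mul hκ.le, Real.sqrt_sq hφ.le]
  -- the gradient terms have a sign, by the Cauchy-Schwarz inequality
  have hD : ∀ l, κ * (D l).trace ^ 2 ≤ ∑ i, ∑ j, D l i j ^ 2 - (D l).trace ^ 2 / n := by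
    intro l
    set τ := (D l).trace with hτ
    set Y : Matrix (Fin n) (Fin n) ℝ := D l - (τ / n) • (1 : Matrix (Fin n) (Fin n) ℝ) with hY
    have hYD : ∀ i j, Y i j = D l i j - τ / n * (1 : Matrix (Fin n) (Fin n) ℝ) i j := fun i j => by
      simp [hY]
    have hone : ∀ Z : Matrix (Fin n) (Fin n) ℝ,
        ∑ i, ∑ j, Z i j * (1 : Matrix (Fin n) (Fin n) ℝ) i j = Z.trace := by
      intro Z; simp [Matrix.one_apply, Matrix.trace]
    have hYY : ∑ i, ∑ j, Y i j ^ 2 = ∑ i, ∑ j, D l i j ^ 2 - τ ^ 2 / n := by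
      have : ∀ i j, Y i j ^ 2 = D l i j ^ 2 - 2 * (τ / n) *
          (D l i j * (1 : Matrix (Fin n) (Fin n) ℝ) i j)
          + (τ / n) ^ 2 * ((1 : Matrix (Fin n) (Fin n) ℝ) i j * (1 : Matrix (Fin n) (Fin n) ℝ) i j) :=
        fun i j => by rw [hYD]; ring
      simp only [this, Finset.sum_add_distrib, Finset.sum_sub_distrib, ← Finset.mul_sum, hone,
        Matrix.trace_one, Fintype.card_fin, ← hτ]
      field_simp; ring
    have hXY : ∑ i, ∑ j, X i j * Y i j = κ * (s + c) * τ := by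
      have : ∀ i j, X i j * Y i j = X i j * D l i j - τ / n *
          (X i j * (1 : Matrix (Fin n) (Fin n) ℝ) i j) := fun i j => by rw [hYD]; ring
      simp only [this, Finset.sum_sub_distrib, ← Finset.mul_sum, hone, hX0]
      rw [← hgrad l, horth (D l), ← hτ]; ring
    have hCS : (∑ i, ∑ j, X i j * Y i j) ^ 2 ≤ q * ∑ i, ∑ j, Y i j ^ 2 := by
      have := Finset.sum_mul_sq_le_sq_mul_sq (Finset.univ : Finset (Fin n × Fin n))
        (fun p => X p.1 p.2) (fun p => Y p.1 p.2)
      simpa only [Fintype.sum_prod_type] using this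
    rw [hXY, hYY, hqκ] at hCS
    have h5 : 0 < κ * (s + c) ^ 2 := by positivity
    refine le_of_mul_le_mul_left ?_ h5
    calc κ * (s + c) ^ 2 * (κ * τ ^ 2) = (κ * (s + c) * τ) ^ 2 := by ring
      _ ≤ _ := hCS
  have hDsum : κ * ∑ l, (D l).trace ^ 2 ≤
      ∑ l, ∑ i, ∑ j, D l i j ^ 2 - (∑ l, (D l).trace ^ 2) / n := by
    rw [Finset.mul_sum, Finset.sum_div, ← Finset.sum_sub_distrib]
    exact Finset.sum_le_sum fun l _ => hD l
  -- replacing the Ricci tensor by its trace free part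
  have hRR : ∑ i, ∑ k, ∑ l, ∑ m, r i k * r l m * Rv l i m k =
      ∑ i, ∑ k, ∑ l, ∑ m, X i k * X l m * Rv l i m k + 2 * (s / n) * q + s ^ 3 / n ^ 2 := by
    have e1 : ∀ i k, ∑ l, ∑ m, r l m * Rv l i m k =
        ∑ l, ∑ m, X l m * Rv l i m k + s / n * r i k := by
      intro i k
      have := horth (Matrix.of fun l m => Rv l i m k)
      simpa only [Matrix.of_apply, Matrix.trace, Matrix.diag_apply, hRic] using this
    have e2 : ∀ l m, ∑ i, ∑ k, r i k * Rv l i m k =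
        ∑ i, ∑ k, X i k * Rv l i m k + s / n * r l m := by
      intro l m
      have := horth (Matrix.of fun i k => Rv l i m k)
      simpa only [Matrix.of_apply, Matrix.trace, Matrix.diag_apply, hRic'] using this
    have sw : ∀ Y Z : Matrix (Fin n) (Fin n) ℝ, ∑ i, ∑ k, Y i k * (∑ l, ∑ m, Z l m * Rv l i m k)
        = ∑ l, ∑ m, Z l m * (∑ i, ∑ k, Y i k * Rv l i m k) := by
      intro Y Z
      have a1 : ∑ i, ∑ k, Y i k * (∑ l, ∑ m, Z l m * Rv l i m k) =
          ∑ p : Fin n × Fin n, ∑ p' : Fin n × Fin n,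
            Y p.1 p.2 * (Z p'.1 p'.2 * Rv p'.1 p.1 p'.2 p.2) := by
        simp only [Fintype.sum_prod_type, Finset.mul_sum]
      have a2 : ∑ l, ∑ m, Z l m * (∑ i, ∑ k, Y i k * Rv l i m k) =
          ∑ p' : Fin n × Fin n, ∑ p : Fin n × Fin n,
            Z p'.1 p'.2 * (Y p.1 p.2 * Rv p'.1 p.1 p'.2 p.2) := by
        simp only [Fintype.sum_prod_type, Finset.mul_sum]
      rw [a1, a2, Finset.sum_comm]
      exact Finset.sum_congr rfl fun _ _ => Finset.sum_congr rfl fun _ _ => by ring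
    have f1 : ∀ Y Z : Matrix (Fin n) (Fin n) ℝ, ∑ i, ∑ k, ∑ l, ∑ m, Y i k * Z l m * Rv l i m k
        = ∑ i, ∑ k, Y i k * (∑ l, ∑ m, Z l m * Rv l i m k) := by
      intro Y Z; simp only [Finset.mul_sum, mul_assoc]
    have hXr : ∑ i, ∑ j, X i j * r i j = q := by
      have h2 := horth X
      rw [hX0] at h2
      have h3 : ∑ i, ∑ j, X i j * r i j = ∑ i, ∑ j, r i j * X i j := by simp only [mul_comm]
      rw [h3, h2, hqdef]; simp only [sq]; ring
    have hrr' : ∑ i, ∑ j, r i j * r i j = q + s ^ 2 / n := by rw [← hrr]; simp only [sq]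
    rw [f1, f1]
    simp only [e1, mul_add, Finset.sum_add_distrib]
    rw [sw r X]
    simp only [e2, mul_add, Finset.sum_add_distrib]
    rw [← sw X X]
    have g1 : ∀ Y : Matrix (Fin n) (Fin n) ℝ, ∑ i, ∑ j, Y i j * (s / n * r i j)
        = s / n * ∑ i, ∑ j, Y i j * r i j := by
      intro Y; simp only [Finset.mul_sum]
      exact Finset.sum_congr rfl fun _ _ => Finset.sum_congr rfl fun _ _ => by ring
    rw [g1, g1, hXr, hrr']
    field_simp
    ring
  have hdec := curvature_decomposition Rv W r X (1 / ((n : ℝ) - 2))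
    (s / (((n : ℝ) - 1) * ((n : ℝ) - 2))) s hX hX0 hr hW
  have hWX := sum_four_le W X
  have hcube := abs_trace_cube_le X
  rw [← hqdef] at hdec hWX hcube
  set w := √(∑ i, ∑ j, ∑ k, ∑ l, W i j k l ^ 2)
  set θ := (X * X * X).trace
  set ωW := ∑ i, ∑ k, ∑ l, ∑ m, X i k * X l m * W l i m k
  have hmain : κ * (s + c) * (q + s ^ 2 / n) ≤ ωW - 2 * (1 / ((n : ℝ) - 2)) * θ
      + (((n : ℝ) - 2) / (n * ((n : ℝ) - 1))) * s * q := by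
    rw [hRR, hdec, hrr] at hbox
    have e : (2 * (s / n) * q + s ^ 3 / n ^ 2) - s * (q + s ^ 2 / n) / n
        - 2 * (1 / ((n : ℝ) - 2)) * (s / n * q) + s / (((n : ℝ) - 1) * ((n : ℝ) - 2)) * q
        = (((n : ℝ) - 2) / (n * ((n : ℝ) - 1))) * s * q := by
      have h1 : (n : ℝ) - 1 ≠ 0 := by linarith
      have h2 : (n : ℝ) - 2 ≠ 0 := by linarith
      field_simp; ring
    rw [← e]
    have hd : (4 * s * (q + s ^ 2 / n) - 2 * ∑ l, (D l).trace ^ 2) / n =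
        4 * (s * (q + s ^ 2 / n) / n) - 2 * ((∑ l, (D l).trace ^ 2) / n) := by ring
    rw [hd] at hbox
    linarith
  have hα : (((n : ℝ) - 2) / (n * ((n : ℝ) - 1))) * s ≤ |s| := by
    have h1 : 0 ≤ ((n : ℝ) - 2) / (n * ((n : ℝ) - 1)) :=
      div_nonneg (by linarith) (mul_nonneg (by linarith) (by linarith))
    have h2 : ((n : ℝ) - 2) / (n * ((n : ℝ) - 1)) ≤ 1 := by
      rw [div_le_one (mul_pos (by linarith) (by linarith))]; nlinarith
    calc _ ≤ ((n : ℝ) - 2) / (n * ((n : ℝ) - 1)) * |s| :=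
          mul_le_mul_of_nonneg_left (le_abs_self s) h1
      _ ≤ 1 * |s| := mul_le_mul_of_nonneg_right h2 (abs_nonneg s)
      _ = |s| := one_mul _
  have hβ : -(2 * (1 / ((n : ℝ) - 2)) * θ) ≤ 2 * (q * √q) := by
    have h1 : 0 ≤ 1 / ((n : ℝ) - 2) := div_nonneg zero_le_one (by linarith)
    have h2 : 1 / ((n : ℝ) - 2) ≤ 1 := by rw [div_le_one (by linarith)]; linarith
    have h3 : -θ ≤ q * √q := (neg_le_abs θ).trans hcube
    have h4 : 0 ≤ q * √q := by positivity
    calc -(2 * (1 / ((n : ℝ) - 2)) * θ) = 2 * (1 / ((n : ℝ) - 2)) * (-θ) := by ring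
      _ ≤ 2 * (1 / ((n : ℝ) - 2)) * (q * √q) := mul_le_mul_of_nonneg_left h3 (by linarith)
      _ ≤ 2 * 1 * (q * √q) := mul_le_mul_of_nonneg_right (by linarith) h4
      _ = _ := by ring
  have hfin : κ * (s + c) * q ≤ (w + 2 * √q + |s|) * q := by
    have h1 : 0 ≤ κ * (s + c) * (s ^ 2 / n) := by positivity
    have h2 := mul_le_mul_of_nonneg_right hα hq0.le
    have h3 : κ * (s + c) * q + κ * (s + c) * (s ^ 2 / n) = κ * (s + c) * (q + s ^ 2 / n) := by ring
    have h4 : (w + 2 * √q + |s|) * q = w * q + 2 * (q * √q) + |s| * q := by ring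
    linarith
  have := le_of_mul_le_mul_right hfin hq0
  rw [hsq] at this
  linarith

end Pointwise

/-! ### Tensor norms -/

section Norms

open scoped Kronecker

variable {n : ℕ}

/-- A 4-tensor as a vector indexed by `(Fin n × Fin n) × (Fin n × Fin n)`. -/
def vec4 (h : Fin n → Fin n → Fin n → Fin n → ℝ) : (Fin n × Fin n) × (Fin n × Fin n) → ℝ :=
  fun p => h p.1.1 p.1.2 p.2.1 p.2.2

/-- The fourth Kronecker power of a matrix, acting on 4-tensors. -/
def kron4 (A : Matrix (Fin n) (Fin n) ℝ) :
    Matrix ((Fin n × Fin n) × (Fin n × Fin n)) ((Fin n × Fin n) × (Fin n × Fin n)) ℝ :=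
  (A ⊗ₖ A) ⊗ₖ (A ⊗ₖ A)

lemma kron4_mul (A B : Matrix (Fin n) (Fin n) ℝ) : kron4 (A * B) = kron4 A * kron4 B := by
  simp only [kron4, Matrix.mul_kronecker_mul]

lemma kron4_transpose (A : Matrix (Fin n) (Fin n) ℝ) : kron4 Aᵀ = (kron4 A)ᵀ := rfl

lemma norm4_eq (A : Matrix (Fin n) (Fin n) ℝ) (h : Fin n → Fin n → Fin n → Fin n → ℝ) :
    norm4 A h = √(vec4 h ⬝ᵥ kron4 A *ᵥ vec4 h) := by
  simp only [norm4, vec4, kron4, dotProduct, Matrix.mulVec, Fintype.sum_prod_type,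
    Finset.mul_sum]
  refine congrArg Real.sqrt ?_
  iterate 8 refine Finset.sum_congr rfl fun _ _ => ?_
  simp only [Matrix.kroneckerMap_apply]
  ring

/-- The pullback of a covariant 4-tensor by the Jacobian matrix `J`. -/
def pull4 (J : Matrix (Fin n) (Fin n) ℝ) (h : Fin n → Fin n → Fin n → Fin n → ℝ)
    (i j k l : Fin n) : ℝ :=
  ∑ a, ∑ b, ∑ c, ∑ d, J a i * J b j * J c k * J d l * h a b c d

lemma vec4_pull4 (J : Matrix (Fin n) (Fin n) ℝ) (h : Fin n → Fin n → Fin n → Fin n → ℝ) :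
    vec4 (pull4 J h) = kron4 Jᵀ *ᵥ vec4 h := by
  ext ⟨⟨i, j⟩, k, l⟩
  simp only [vec4, pull4, kron4, Matrix.mulVec, dotProduct, Fintype.sum_prod_type,
    Matrix.kroneckerMap_apply, Matrix.transpose_apply]
  refine Finset.sum_congr rfl fun a _ => Finset.sum_congr rfl fun b _ =>
    Finset.sum_congr rfl fun c _ => Finset.sum_congr rfl fun d _ => by ring

/-- The norm of a 4-tensor does not depend on the coordinates. -/
lemma norm4_pull4 (A A' J : Matrix (Fin n) (Fin n) ℝ) (hA : J * A' * Jᵀ = A)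
    (h : Fin n → Fin n → Fin n → Fin n → ℝ) : norm4 A' (pull4 J h) = norm4 A h := by
  rw [norm4_eq, norm4_eq, vec4_pull4, ← hA, kron4_mul, kron4_mul, kron4_transpose]
  congr 1
  rw [Matrix.dotProduct_mulVec, Matrix.vecMul_mulVec, ← Matrix.dotProduct_mulVec,
    Matrix.mulVec_mulVec, Matrix.transpose_transpose, Matrix.mul_assoc]

lemma norm4_one (h : Fin n → Fin n → Fin n → Fin n → ℝ) :
    norm4 1 h = √(∑ i, ∑ j, ∑ k, ∑ l, h i j k l ^ 2) := by
  have : kron4 (1 : Matrix (Fin n) (Fin n) ℝ) = 1 := by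
    simp [kron4]
  rw [norm4_eq, this, Matrix.one_mulVec]
  simp only [dotProduct, vec4, Fintype.sum_prod_type, sq]

lemma pull4_add (J : Matrix (Fin n) (Fin n) ℝ) (h k : Fin n → Fin n → Fin n → Fin n → ℝ)
    (i j p q : Fin n) : pull4 J (fun a b c d => h a b c d + k a b c d) i j p q =
      pull4 J h i j p q + pull4 J k i j p q := by
  simp only [pull4, mul_add, Finset.sum_add_distrib]

lemma pull4_sub (J : Matrix (Fin n) (Fin n) ℝ) (h k : Fin n → Fin n → Fin n → Fin n → ℝ)
    (i j p q : Fin n) : pull4 J (fun a b c d => h a b c d - k a b c d) i j p q =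
      pull4 J h i j p q - pull4 J k i j p q := by
  simp only [pull4, mul_sub, Finset.sum_sub_distrib]

lemma pull4_smul (J : Matrix (Fin n) (Fin n) ℝ) (r : ℝ) (h : Fin n → Fin n → Fin n → Fin n → ℝ)
    (i j p q : Fin n) : pull4 J (fun a b c d => r * h a b c d) i j p q = r * pull4 J h i j p q := by
  simp only [pull4, Finset.mul_sum]
  refine Finset.sum_congr rfl fun a _ => Finset.sum_congr rfl fun b _ =>
    Finset.sum_congr rfl fun c _ => Finset.sum_congr rfl fun d _ => by ring

/-- The pullback of a tensor product of two 2-tensors. -/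
lemma pull4_mul (J X Y : Matrix (Fin n) (Fin n) ℝ) (i j k l : Fin n) :
    pull4 J (fun a b c d => X a c * Y b d) i j k l = (Jᵀ * X * J) i k * (Jᵀ * Y * J) j l := by
  have e : ∀ (Z : Matrix (Fin n) (Fin n) ℝ) i k,
      (Jᵀ * Z * J) i k = ∑ a, ∑ c, J a i * J c k * Z a c := by
    intro Z i k
    simp only [Matrix.mul_apply, Matrix.transpose_apply, Finset.sum_mul]
    rw [Finset.sum_comm]
    exact Finset.sum_congr rfl fun a _ => Finset.sum_congr rfl fun c _ => by ring
  rw [e, e, pull4, Finset.sum_mul_sum]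
  refine Finset.sum_congr rfl fun a _ => Finset.sum_congr rfl fun b _ => ?_
  rw [Finset.sum_mul_sum]
  exact Finset.sum_congr rfl fun c _ => Finset.sum_congr rfl fun d _ => by ring

lemma pull4_perm (J : Matrix (Fin n) (Fin n) ℝ) (h : Fin n → Fin n → Fin n → Fin n → ℝ)
    (i j k l : Fin n) : pull4 J (fun a b c d => h a b d c) i j k l = pull4 J h i j l k := by
  simp only [pull4]
  refine Finset.sum_congr rfl fun a _ => Finset.sum_congr rfl fun b _ => ?_
  rw [Finset.sum_comm]
  exact Finset.sum_congr rfl fun c _ => Finset.sum_congr rfl fun d _ => by ring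

/-- The Weyl tensor built from given components of the metric, the curvature tensor, the Ricci
tensor and the scalar curvature. -/
def weylOf (G : Matrix (Fin n) (Fin n) ℝ) (Rv : Fin n → Fin n → Fin n → Fin n → ℝ)
    (r : Matrix (Fin n) (Fin n) ℝ) (s : ℝ) (i j k l : Fin n) : ℝ :=
  Rv i j k l - 1 / ((n : ℝ) - 2) * (G i k * r j l + G j l * r i k - G i l * r j k - G j k * r i l)
    + s / (((n : ℝ) - 1) * ((n : ℝ) - 2)) * (G i k * G j l - G i l * G j k)

/-- The Weyl tensor is a tensor. -/
lemma weylOf_pull4 (J G : Matrix (Fin n) (Fin n) ℝ) (Rv : Fin n → Fin n → Fin n → Fin n → ℝ)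
    (r : Matrix (Fin n) (Fin n) ℝ) (s : ℝ) :
    weylOf (Jᵀ * G * J) (pull4 J Rv) (Jᵀ * r * J) s = pull4 J (weylOf G Rv r s) := by
  funext i j k l
  have h1 := pull4_mul J G r i j k l
  have h2 : pull4 J (fun a b c d => G b d * r a c) i j k l =
      (Jᵀ * G * J) j l * (Jᵀ * r * J) i k := by
    have := pull4_mul J r G i j k l
    simp only [mul_comm] at this ⊢
    exact this
  have h3 : pull4 J (fun a b c d => G a d * r b c) i j k l =
      (Jᵀ * G * J) i l * (Jᵀ * r * J) j k :=
    (pull4_perm J (fun a b c d => G a c * r b d) i j k l).trans (pull4_mul J G r i j l k)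
  have h4 : pull4 J (fun a b c d => G b c * r a d) i j k l =
      (Jᵀ * G * J) j k * (Jᵀ * r * J) i l := by
    have := (pull4_perm J (fun a b c d => r a c * G b d) i j k l).trans (pull4_mul J r G i j l k)
    simp only [mul_comm] at this ⊢
    exact this
  have h5 := pull4_mul J G G i j k l
  have h6 : pull4 J (fun a b c d => G a d * G b c) i j k l =
      (Jᵀ * G * J) i l * (Jᵀ * G * J) j k :=
    (pull4_perm J (fun a b c d => G a c * G b d) i j k l).trans (pull4_mul J G G i j l k)
  simp only [weylOf]
  rw [← h1, ← h2, ← h3, ← h4, ← h5, ← h6]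
  simp only [← pull4_add, ← pull4_sub, ← pull4_smul]
  rfl

/-- The norm of the traceless Ricci tensor in terms of the mixed Ricci tensor. -/
lemma norm2_traceless (A G R : Matrix (Fin n) (Fin n) ℝ) (hn : n ≠ 0) (hAG : A * G = 1)
    (hA : Aᵀ = A) (hG : Gᵀ = G) (hR : Rᵀ = R) :
    norm2 A (fun i j => R i j - (A * R).trace / n * G i j) =
      √(((A * R) ^ 2).trace - (A * R).trace ^ 2 / n) := by
  have hn' : (n : ℝ) ≠ 0 := by exact_mod_cast hn
  set s := (A * R).trace with hs
  set h : Matrix (Fin n) (Fin n) ℝ := R - (s / n) • G with hh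
  have hsymm : hᵀ = h := by simp [hh, hR, hG]
  have e1 : ∑ i, ∑ j, ∑ a, ∑ b, A i a * A j b * (R i j - s / n * G i j) * (R a b - s / n * G a b)
      = (A * h * (A * h)).trace := by
    have hc : ∀ i j, R i j - s / n * G i j = h i j := fun i j => by simp [hh]
    have hsym' : ∀ i j, h i j = h j i := fun i j => congrFun (congrFun hsymm j) i
    have hA' : ∀ i j, A i j = A j i := fun i j => congrFun (congrFun hA j) i
    simp only [hc, Matrix.trace, Matrix.diag_apply, Matrix.mul_apply, Finset.sum_mul,
      Finset.mul_sum]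
    refine Finset.sum_congr rfl fun i _ => ?_
    calc ∑ j, ∑ a, ∑ b, A i a * A j b * h i j * h a b
        = ∑ j, ∑ b, ∑ a, A i a * A j b * h i j * h a b :=
          Finset.sum_congr rfl fun _ _ => Finset.sum_comm
      _ = ∑ b, ∑ j, ∑ a, A i a * A j b * h i j * h a b := Finset.sum_comm
      _ = _ := Finset.sum_congr rfl fun b _ => Finset.sum_congr rfl fun j _ =>
          Finset.sum_congr rfl fun a _ => by rw [hA' b j, hsym' j i]; ring
  have e2 : (A * h * (A * h)).trace = ((A * R) ^ 2).trace - s ^ 2 / n := by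
    have : A * h = A * R - (s / n) • 1 := by rw [hh, Matrix.mul_sub, Matrix.mul_smul, hAG]
    rw [this]
    simp only [Matrix.sub_mul, Matrix.mul_sub, Matrix.trace_sub, Matrix.smul_mul, Matrix.mul_smul,
      Matrix.one_mul, Matrix.mul_one, Matrix.trace_smul, Matrix.trace_one, Fintype.card_fin,
      smul_eq_mul, ← hs, sq]
    field_simp
    ring
  rw [norm2, e1, e2]

end Norms

/-! ### Rings of smooth functions -/

section SmoothRing

open TopologicalSpace Filter Topology

variable {X Y : Type*} [NormedAddCommGroup X] [NormedSpace ℝ X] [NormedAddCommGroup Y]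
  [NormedSpace ℝ Y]

/-- The algebra of smooth real functions on an open subset `O` of a normed space. Working in this
ring makes the coordinate derivations everywhere defined, so that tensor calculus becomes
algebra. -/
def SmoothRing (O : Opens X) : Subalgebra ℝ (O → ℝ) where
  carrier := {f | ∃ F : X → ℝ, ContDiffOn ℝ ∞ F O ∧ ∀ p : O, F p = f p}
  mul_mem' := by
    rintro f g ⟨F, hF, hF'⟩ ⟨G, hG, hG'⟩
    exact ⟨fun p => F p * G p, hF.mul hG, fun p => by simp [hF', hG']⟩
  add_mem' := by
    rintro f g ⟨F, hF, hF'⟩ ⟨G, hG, hG'⟩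
    exact ⟨fun p => F p + G p, hF.add hG, fun p => by simp [hF', hG']⟩
  algebraMap_mem' r := ⟨fun _ => r, contDiffOn_const, fun _ => rfl⟩

namespace SmoothRing

variable {O : Opens X}

/-- A function on the whole space that represents an element of the ring of smooth functions. -/
def rep (f : SmoothRing O) : X → ℝ := f.2.choose

lemma contDiffOn_rep (f : SmoothRing O) : ContDiffOn ℝ ∞ (rep f) O := f.2.choose_spec.1

@[simp] lemma rep_apply (f : SmoothRing O) (p : O) : (rep f) p = f.1 p := f.2.choose_spec.2 p

/-- The element of the ring of smooth functions defined by a function that is smooth on `O`. -/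
def mk (F : X → ℝ) (hF : ContDiffOn ℝ ∞ F O) : SmoothRing O := ⟨fun p => F p, F, hF, fun _ => rfl⟩

@[simp] lemma mk_apply (F : X → ℝ) (hF : ContDiffOn ℝ ∞ F O) (p : O) : (mk F hF).1 p = F p := rfl

lemma differentiableAt_rep (f : SmoothRing O) (p : O) : DifferentiableAt ℝ (rep f) p :=
  ((contDiffOn_rep f).contDiffAt (O.isOpen.mem_nhds p.2)).differentiableAt (by simp)

lemma fderiv_rep (f : SmoothRing O) (F : X → ℝ) (h : ∀ p : O, f.1 p = F p) (p : O) :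
    fderiv ℝ (rep f) p = fderiv ℝ F p := by
  refine Filter.EventuallyEq.fderiv_eq ?_
  filter_upwards [O.isOpen.mem_nhds p.2] with q hq
  rw [← h ⟨q, hq⟩, ← rep_apply]

/-- The derivative in the direction of the constant vector field `v`. -/
def dir (v : X) : Derivation ℝ (SmoothRing O) (SmoothRing O) :=
  Derivation.mk'
    { toFun := fun f => mk (fun p => fderiv ℝ (rep f) p v)
        (((contDiffOn_rep f).fderiv_of_isOpen (m := ∞) O.isOpen (by simp)).clm_apply contDiffOn_const)
      map_add' := by
        intro f g
        ext p
        change fderiv ℝ (rep (f + g)) p v = fderiv ℝ (rep f) p v + fderiv ℝ (rep g) p v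
        rw [fderiv_rep (f + g) (fun q => (rep f) q + (rep g) q) (fun q => by simp),
          fderiv_fun_add ((differentiableAt_rep f) p) ((differentiableAt_rep g) p)]
        rfl
      map_smul' := by
        intro r f
        ext p
        change fderiv ℝ (rep (r • f)) p v = r * fderiv ℝ (rep f) p v
        rw [fderiv_rep (r • f) (fun q => r * (rep f) q) (fun q => by simp),
          fderiv_const_mul ((differentiableAt_rep f) p)]
        rfl }
    (by
      intro f g
      ext p
      change fderiv ℝ (rep (f * g)) p v = f.1 p * fderiv ℝ (rep g) p v + g.1 p * fderiv ℝ (rep f) p v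
      rw [fderiv_rep (f * g) (fun q => (rep f) q * (rep g) q) (fun q => by simp),
        fderiv_fun_mul ((differentiableAt_rep f) p) ((differentiableAt_rep g) p)]
      simp)

lemma dir_apply (v : X) (f : SmoothRing O) (p : O) : (dir v f).1 p = fderiv ℝ (rep f) p v := rfl

lemma dir_apply_of (v : X) (f : SmoothRing O) (F : X → ℝ) (h : ∀ p : O, f.1 p = F p) (p : O) :
    (dir v f).1 p = fderiv ℝ F p v := by
  rw [dir_apply, fderiv_rep f F h]

lemma dir_comm (v w : X) (f : SmoothRing O) : dir v (dir w f) = dir w (dir v f) := by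
  ext p
  have h1 : ∀ v w : X, (dir v (dir w f)).1 p = fderiv ℝ (fderiv ℝ (rep f)) p v w := by
    intro v w
    rw [dir_apply_of v (dir w f) (fun q => fderiv ℝ (rep f) q w) (fun q => rfl)]
    have hd : DifferentiableAt ℝ (fderiv ℝ (rep f)) p :=
      (((contDiffOn_rep f).fderiv_of_isOpen (m := ∞) O.isOpen (by simp)).contDiffAt
        (O.isOpen.mem_nhds p.2)).differentiableAt (by simp)
    rw [fderiv_clm_apply hd (differentiableAt_const _)]
    simp
  rw [h1, h1]
  have hs : IsSymmSndFDerivAt ℝ (rep f) p :=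
    ((contDiffOn_rep f).contDiffAt (O.isOpen.mem_nhds p.2)).isSymmSndFDerivAt
      (by simpa using WithTop.coe_le_coe.2 (le_top (a := (2 : ℕ∞))))
  exact hs.eq v w

/-- Evaluation at a point. -/
def eval (p : O) : SmoothRing O →ₐ[ℝ] ℝ := (Pi.evalAlgHom ℝ (fun _ : O => ℝ) p).comp
  (SmoothRing O).val

@[simp] lemma eval_apply (p : O) (f : SmoothRing O) : eval p f = f.1 p := rfl

lemma ext_eval {f g : SmoothRing O} (h : ∀ p, eval p f = eval p g) : f = g :=
  Subtype.ext (funext h)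

/-- Composition with a smooth map. -/
def comap {O' : Opens Y} (Φ : Y → X) (hΦ : ContDiffOn ℝ ∞ Φ O') (hm : ∀ p ∈ O', Φ p ∈ O) :
    SmoothRing O →ₐ[ℝ] SmoothRing O' where
  toFun f := ⟨fun p => f.1 ⟨Φ p, hm p p.2⟩, fun p => (rep f) (Φ p),
    (contDiffOn_rep f).comp hΦ hm, fun p => rep_apply f ⟨Φ p, hm p p.2⟩⟩
  map_one' := rfl
  map_mul' _ _ := rfl
  map_zero' := rfl
  map_add' _ _ := rfl
  commutes' _ := rfl

/-- The chain rule. -/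
lemma dir_comap {O' : Opens Y} (Φ : Y → X) (hΦ : ContDiffOn ℝ ∞ Φ O') (hm : ∀ p ∈ O', Φ p ∈ O)
    (w : Y) (f : SmoothRing O) (p : O') :
    (dir w (comap Φ hΦ hm f)).1 p = fderiv ℝ (rep f) (Φ p) (fderiv ℝ Φ p w) := by
  rw [dir_apply_of w _ (fun q => (rep f) (Φ q))
    (fun q => (rep_apply f ⟨Φ q, hm q q.2⟩).symm)]
  have h1 : DifferentiableAt ℝ (rep f) (Φ p) := (differentiableAt_rep f) ⟨Φ p, hm p p.2⟩
  have h2 : DifferentiableAt ℝ Φ p :=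
    (hΦ.contDiffAt (O'.isOpen.mem_nhds p.2)).differentiableAt (by simp)
  have := fderiv_comp (p : Y) h1 h2
  change fderiv ℝ ((rep f) ∘ Φ) p w = _
  rw [this]; rfl

end SmoothRing

end SmoothRing

/-! ### The differential ring of a time dependent metric -/

section Field

open TopologicalSpace SmoothRing

variable {n : ℕ}

/-- The coordinate vector `∂_k` in space-time. -/
def spaceVec (k : Fin n) : ℝ × E n := (0, EuclideanSpace.single k 1)

/-- The time vector `∂_t` in space-time. -/
def timeVec (n : ℕ) : ℝ × E n := (1, 0)

lemma partialDeriv_slice (O : Opens (ℝ × E n)) (f : SmoothRing O) (F : ℝ → E n → ℝ)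
    (h : ∀ p : O, f.1 p = F p.1.1 p.1.2) (k : Fin n) (p : O) :
    partialDeriv k (fun z => F p.1.1 z) p.1.2 = (dir (spaceVec k) f).1 p := by
  have hev : (fun z => F p.1.1 z) =ᶠ[nhds p.1.2] fun z => (rep f) (p.1.1, z) := by
    have hc : Continuous fun z : E n => (p.1.1, z) := by fun_prop
    filter_upwards [(O.isOpen.preimage hc).mem_nhds p.2] with z hz
    have := h ⟨(p.1.1, z), hz⟩
    rw [← this, ← rep_apply]
  rw [partialDeriv, hev.fderiv_eq]
  have h1 : HasFDerivAt (rep f) (fderiv ℝ (rep f) (p.1.1, p.1.2)) (p.1.1, p.1.2) :=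
    ((differentiableAt_rep f) p).hasFDerivAt
  have h2 : HasFDerivAt (fun z : E n => (p.1.1, z)) (ContinuousLinearMap.inr ℝ ℝ (E n)) p.1.2 :=
    hasFDerivAt_prodMk_right _ _
  have h3 := h1.comp p.1.2 h2
  have h4 : fderiv ℝ (fun z => (rep f) (p.1.1, z)) p.1.2 = _ := h3.fderiv
  rw [h4, dir_apply]
  rfl

lemma hasDerivAt_slice (O : Opens (ℝ × E n)) (f : SmoothRing O) (F : ℝ → E n → ℝ)
    (h : ∀ p : O, f.1 p = F p.1.1 p.1.2) (p : O) :
    HasDerivAt (fun s => F s p.1.2) ((dir (timeVec n) f).1 p) p.1.1 := by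
  have hev : (fun s => F s p.1.2) =ᶠ[nhds p.1.1] fun s => (rep f) (s, p.1.2) := by
    have hc : Continuous fun s : ℝ => (s, p.1.2) := by fun_prop
    filter_upwards [(O.isOpen.preimage hc).mem_nhds p.2] with z hz
    have := h ⟨(z, p.1.2), hz⟩
    rw [← this, ← rep_apply]
  have h1 : HasFDerivAt (rep f) (fderiv ℝ (rep f) (p.1.1, p.1.2)) (p.1.1, p.1.2) :=
    ((differentiableAt_rep f) p).hasFDerivAt
  have h2 : HasFDerivAt (fun s : ℝ => (s, p.1.2)) (ContinuousLinearMap.inl ℝ ℝ (E n)) p.1.1 :=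
    hasFDerivAt_prodMk_left _ _
  have h3 := (h1.comp p.1.1 h2).hasDerivAt
  exact h3.congr_of_eventuallyEq hev

/-- The entries of the inverse of a smooth invertible matrix are smooth. -/
lemma contDiffOn_inv {X : Type*} [NormedAddCommGroup X] [NormedSpace ℝ X] {s : Set X}
    {G : X → Matrix (Fin n) (Fin n) ℝ} (hG : ∀ i j, ContDiffOn ℝ ∞ (fun p => G p i j) s)
    (hd : ∀ p ∈ s, (G p).det ≠ 0) (i j : Fin n) : ContDiffOn ℝ ∞ (fun p => (G p)⁻¹ i j) s := by
  have hdet : ∀ H : X → Matrix (Fin n) (Fin n) ℝ, (∀ i j, ContDiffOn ℝ ∞ (fun p => H p i j) s) →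
      ContDiffOn ℝ ∞ (fun p => (H p).det) s := by
    intro H hH
    simp only [Matrix.det_apply']
    exact ContDiffOn.sum fun σ _ => contDiffOn_const.mul (contDiffOn_prod fun k _ => hH _ _)
  simp only [Matrix.inv_def, Matrix.smul_apply, Ring.inverse_eq_inv', smul_eq_mul,
    Matrix.adjugate_apply]
  refine ((hdet G hG).inv hd).mul (hdet _ fun a b => ?_)
  simp only [Matrix.updateRow_apply]
  split_ifs
  · exact contDiffOn_const
  · exact hG a b

/-- The components `G` are smooth functions on the open set `O` of space-time, and form an
invertible symmetric matrix at each point. -/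
structure IsMetricOn (O : Opens (ℝ × E n)) (G : ℝ → E n → Matrix (Fin n) (Fin n) ℝ) : Prop where
  /-- smoothness -/
  smooth : ∀ i j, ContDiffOn ℝ ∞ (fun p : ℝ × E n => G p.1 p.2 i j) O
  /-- symmetry -/
  symm : ∀ p ∈ O, (G p.1 p.2)ᵀ = G p.1 p.2
  /-- nondegeneracy -/
  det_ne : ∀ p ∈ O, (G p.1 p.2).det ≠ 0

namespace IsMetricOn

variable {O : Opens (ℝ × E n)} {G : ℝ → E n → Matrix (Fin n) (Fin n) ℝ} (hG : IsMetricOn O G)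

/-- The algebraic metric over the ring of smooth functions defined by the components `G`. -/
def toDiffMetric : DiffMetric n (SmoothRing O) where
  d k := dir (spaceVec k)
  comm i j f := dir_comm _ _ f
  G := Matrix.of fun i j => SmoothRing.mk _ (hG.smooth i j)
  A := Matrix.of fun i j => SmoothRing.mk (fun p => (G p.1 p.2)⁻¹ i j)
    (contDiffOn_inv hG.smooth hG.det_ne i j)
  symm := by
    ext i j p
    exact congrFun (congrFun (hG.symm p p.2) i) j
  inv := by
    refine Matrix.ext fun i j => ext_eval fun p => ?_
    have := congrFun (congrFun (Matrix.nonsing_inv_mul (G p.1.1 p.1.2)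
      (isUnit_iff_ne_zero.2 (hG.det_ne p p.2))) i) j
    rw [Matrix.mul_apply] at this
    rw [Matrix.mul_apply, map_sum]
    simp only [map_mul, eval_apply, Matrix.of_apply, mk_apply]
    rw [this]
    by_cases h : i = j
    · subst h; simp only [Matrix.one_apply_eq]; exact (map_one (eval p)).symm
    · simp only [Matrix.one_apply_ne h]; exact (map_zero (eval p)).symm

lemma G_apply (p : O) (i j : Fin n) : (hG.toDiffMetric.G i j).1 p = G p.1.1 p.1.2 i j := rfl

lemma A_apply (p : O) (i j : Fin n) : (hG.toDiffMetric.A i j).1 p = (G p.1.1 p.1.2)⁻¹ i j := rfl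

lemma dG_apply (p : O) (i j k : Fin n) : (hG.toDiffMetric.d k (hG.toDiffMetric.G i j)).1 p =
    partialDeriv k (fun z => G p.1.1 z i j) p.1.2 :=
  (partialDeriv_slice O (hG.toDiffMetric.G i j) (fun t z => G t z i j) (fun _ => rfl) k p).symm

lemma Γ_apply (p : O) (l i j : Fin n) :
    (hG.toDiffMetric.Γ i l j).1 p = christoffel (G p.1.1) p.1.2 l i j := by
  have : eval p (hG.toDiffMetric.Γ i l j) = christoffel (G p.1.1) p.1.2 l i j := by
    rw [DiffMetric.Γ, Matrix.mul_apply, map_sum, christoffel, Finset.mul_sum]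
    refine Finset.sum_congr rfl fun m _ => ?_
    simp only [DiffMetric.first, Matrix.of_apply, map_mul, map_smul, map_add, map_sub, eval_apply,
      dG_apply, A_apply, smul_eq_mul]
    ring
  exact this

lemma Rm_apply (p : O) (l i j k : Fin n) :
    (hG.toDiffMetric.Rm i j l k).1 p = riemann31 (G p.1.1) p.1.2 l i j k := by
  have hd : ∀ a i l j, eval p (hG.toDiffMetric.d a (hG.toDiffMetric.Γ i l j)) =
      partialDeriv a (fun z => christoffel (G p.1.1) z l i j) p.1.2 := fun a i l j =>
    (partialDeriv_slice O (hG.toDiffMetric.Γ i l j) (fun t z => christoffel (G t) z l i j)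
      (fun q => hG.Γ_apply q l i j) a p).symm
  have hΓ : ∀ i l j, eval p (hG.toDiffMetric.Γ i l j) = christoffel (G p.1.1) p.1.2 l i j :=
    fun i l j => hG.Γ_apply p l i j
  have : eval p (hG.toDiffMetric.Rm i j l k) = riemann31 (G p.1.1) p.1.2 l i j k := by
    simp only [DiffMetric.Rm, Matrix.add_apply, Matrix.sub_apply, dMat_apply, Matrix.mul_apply,
      map_add, map_sub, map_sum, map_mul, hd, hΓ, riemann31, Finset.sum_sub_distrib]
    congr 2
    exact Finset.sum_congr rfl fun _ _ => mul_comm _ _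
    exact Finset.sum_congr rfl fun _ _ => mul_comm _ _
  exact this

lemma riem_apply (p : O) (i j k l : Fin n) :
    (hG.toDiffMetric.riem i j k l).1 p = riemann (G p.1.1) p.1.2 i j k l := by
  have : eval p (hG.toDiffMetric.riem i j k l) = riemann (G p.1.1) p.1.2 i j k l := by
    simp only [DiffMetric.riem, Matrix.mul_apply, map_sum, map_mul, riemann, eval_apply, Rm_apply,
      G_apply]
  exact this

lemma Ric_apply (p : O) (i k : Fin n) :
    (hG.toDiffMetric.Ric i k).1 p = ricci (G p.1.1) p.1.2 i k := by
  have : eval p (hG.toDiffMetric.Ric i k) = ricci (G p.1.1) p.1.2 i k := by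
    simp only [DiffMetric.Ric, Matrix.of_apply, map_sum, map_mul, ricci, eval_apply, riem_apply,
      A_apply]
  exact this

lemma A_map (p : O) : hG.toDiffMetric.A.map (eval p) = (G p.1.1 p.1.2)⁻¹ := rfl

lemma Ric_map (p : O) : hG.toDiffMetric.Ric.map (eval p) = Matrix.of (ricci (G p.1.1) p.1.2) :=
  Matrix.ext fun i k => hG.Ric_apply p i k

lemma mixed_map (p : O) : hG.toDiffMetric.mixed.map (eval p) =
    (G p.1.1 p.1.2)⁻¹ * Matrix.of (ricci (G p.1.1) p.1.2) := by
  rw [DiffMetric.mixed, DiffMetric.map_matrix_mul, A_map, Ric_map]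

end IsMetricOn

end Field
section Invariants

variable {n : ℕ} {C C' : Type*} [CommRing C] [Algebra ℝ C] [CommRing C'] [Algebra ℝ C']

namespace DiffMetric

variable (g : DiffMetric n C)

/-- The squared norm `|E|² = |Ric|² - R²/n` of the traceless Ricci tensor. -/
def tracelessSq : C := (g.mixed ^ 2).trace - (1 / n : ℝ) • g.scal ^ 2

/-- The norm of the Weyl tensor at the point at which `ev` evaluates. -/
def weylNormAt (ev : C →ₐ[ℝ] ℝ) : ℝ :=
  norm4 (g.A.map ev) (weylOf (g.G.map ev) (fun i j k l => ev (g.riem i j k l)) (g.Ric.map ev)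
    (ev g.scal))

namespace IsPullback

variable {g} {g' : DiffMetric n C'} {f : C →ₐ[ℝ] C'} {J : Matrix (Fin n) (Fin n) C'}
  (H : g.IsPullback g' f J)

include H

lemma scal_eq : g'.scal = f g.scal := by
  simpa [scal] using H.trace_mixed_pow 1

lemma tracelessSq_eq : g'.tracelessSq = f g.tracelessSq := by
  simp [tracelessSq, H.scal_eq, H.trace_mixed_pow 2]

lemma weylNormAt_eq (ev : C' →ₐ[ℝ] ℝ) : g'.weylNormAt ev = g.weylNormAt (ev.comp f) := by
  have hA := congrArg (fun X => X.map ev) H.A_map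
  have hG := congrArg (fun X => X.map ev) H.metric
  have hR := congrArg (fun X => X.map ev) H.Ric_eq
  simp only [map_matrix_mul, Matrix.transpose_map, Matrix.map_map] at hA hG hR
  have hRm : (fun i j k l => ev (g'.riem i j k l)) =
      pull4 (J.map ev) (fun i j k l => (ev.comp f) (g.riem i j k l)) := by
    funext i j k l
    simp only [H.riem_eq, map_sum, map_mul, pull4, Matrix.map_apply]
    rfl
  rw [weylNormAt, weylNormAt, hRm, hG, hR, H.scal_eq, weylOf_pull4]
  exact norm4_pull4 _ _ _ hA _

end IsPullback

lemma IsNormal.weylNormAt_eq {g : DiffMetric n C} {ev : C →ₐ[ℝ] ℝ} (H : g.IsNormal ev) :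
    g.weylNormAt ev = √(∑ i, ∑ j, ∑ k, ∑ l,
      weylOf 1 (fun i j k l => ev (g.Rm i j k l)) (g.Ric.map ev) (ev g.scal) i j k l ^ 2) := by
  rw [weylNormAt, H.inverse, norm4_one, H.metric]
  simp only [H.riem_ev]

end DiffMetric

end Invariants

section Concrete

open TopologicalSpace SmoothRing

variable {n : ℕ} {O : Opens (ℝ × E n)} {G : ℝ → E n → Matrix (Fin n) (Fin n) ℝ}

/-- The squared norm of the traceless Ricci tensor, through the mixed Ricci tensor. -/
def tracelessSq (G : E n → Matrix (Fin n) (Fin n) ℝ) (y : E n) : ℝ :=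
  (((G y)⁻¹ * Matrix.of (ricci G y)) ^ 2).trace - 1 / n * scalar G y ^ 2

namespace IsMetricOn

variable (hG : IsMetricOn O G)

include hG in
lemma scalar_eq_trace (p : O) : scalar (G p.1.1) p.1.2 =
    ((G p.1.1 p.1.2)⁻¹ * Matrix.of (ricci (G p.1.1) p.1.2)).trace := by
  have h := congrArg (fun X => X.map (eval p)) hG.toDiffMetric.Ric_symm
  simp only [Matrix.transpose_map, hG.Ric_map] at h
  simp only [scalar, Matrix.trace, Matrix.diag_apply, Matrix.mul_apply]
  refine Finset.sum_congr rfl fun i _ => Finset.sum_congr rfl fun k _ => ?_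
  exact congrArg _ (congrFun (congrFun h k) i)

lemma scal_apply (p : O) : hG.toDiffMetric.scal.1 p = scalar (G p.1.1) p.1.2 := by
  rw [hG.scalar_eq_trace, ← hG.mixed_map]
  change eval p hG.toDiffMetric.scal = _
  simp only [DiffMetric.scal, Matrix.trace, map_sum]
  rfl

lemma tracelessSq_apply (p : O) :
    hG.toDiffMetric.tracelessSq.1 p = tracelessSq (G p.1.1) p.1.2 := by
  change eval p hG.toDiffMetric.tracelessSq = _
  rw [tracelessSq, ← hG.mixed_map, DiffMetric.tracelessSq, map_sub, map_smul, map_pow,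
    eval_apply, eval_apply, hG.scal_apply, smul_eq_mul]
  congr 1
  rw [sq, sq, ← DiffMetric.map_matrix_mul]
  change eval p _ = _
  simp only [Matrix.trace, map_sum]
  rfl

include hG in
lemma norm2_eq (hn : n ≠ 0) (p : O) : norm2 (G p.1.1 p.1.2)⁻¹ (tracelessRicci (G p.1.1) p.1.2) =
    √(tracelessSq (G p.1.1) p.1.2) := by
  have h := congrArg (fun X => X.map (eval p)) hG.toDiffMetric.Ric_symm
  simp only [Matrix.transpose_map, hG.Ric_map] at h
  have hA := congrArg (fun X => X.map (eval p)) hG.toDiffMetric.A_symm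
  simp only [Matrix.transpose_map, hG.A_map] at hA
  have := norm2_traceless (G p.1.1 p.1.2)⁻¹ (G p.1.1 p.1.2)
    (Matrix.of (ricci (G p.1.1) p.1.2)) hn
    (Matrix.nonsing_inv_mul _ (isUnit_iff_ne_zero.2 (hG.det_ne p p.2))) hA
    (hG.symm p p.2) h
  rw [← hG.scalar_eq_trace] at this
  rw [tracelessSq, one_div_mul_eq_div, ← this]
  rfl

lemma weyl_eq (p : O) : hG.toDiffMetric.weylNormAt (eval p) =
    norm4 (G p.1.1 p.1.2)⁻¹ (weyl (G p.1.1) p.1.2) := by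
  have h1 : eval p hG.toDiffMetric.scal = scalar (G p.1.1) p.1.2 := hG.scal_apply p
  have h2 : ∀ i j k l, eval p (hG.toDiffMetric.riem i j k l) = riemann (G p.1.1) p.1.2 i j k l :=
    fun i j k l => hG.riem_apply p i j k l
  rw [DiffMetric.weylNormAt, hG.A_map, hG.Ric_map, h1]
  simp only [h2]
  rfl

end IsMetricOn

/-! ### Coordinate changes -/

/-- The extension of a change of space coordinates to space-time. -/
def timeMap (φ : E n → E n) (p : ℝ × E n) : ℝ × E n := (p.1, φ p.2)

/-- `φ` is a smooth map of the space coordinates that takes `O'` to `O`. -/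
structure IsCoordChange (O' O : Opens (ℝ × E n)) (φ : E n → E n) : Prop where
  /-- smoothness -/
  smooth : ∀ p ∈ O', ContDiffAt ℝ ∞ φ p.2
  /-- the image of `O'` lies in `O` -/
  maps : ∀ p ∈ O', timeMap φ p ∈ O

namespace IsCoordChange

variable {O' : Opens (ℝ × E n)} {φ : E n → E n} (hφ : IsCoordChange O' O φ)

include hφ

lemma contDiffOn : ContDiffOn ℝ ∞ (timeMap φ) O' := fun p hp =>
  (contDiffAt_fst.prodMk ((hφ.smooth p hp).comp p contDiffAt_snd)).contDiffWithinAt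

/-- Composition with the coordinate change. -/
def pull : SmoothRing O →ₐ[ℝ] SmoothRing O' := comap (timeMap φ) hφ.contDiffOn hφ.maps

lemma contDiffOn_jac (a i : Fin n) :
    ContDiffOn ℝ ∞ (fun p : ℝ × E n => fderiv ℝ φ p.2 (EuclideanSpace.single i 1) a) O' := by
  intro p hp
  have h1 : ContDiffAt ℝ ∞ (fun z => fderiv ℝ φ z) p.2 :=
    (hφ.smooth p hp).fderiv_right (by simp)
  have h2 : ContDiffAt ℝ ∞ (fun z => fderiv ℝ φ z (EuclideanSpace.single i 1)) p.2 :=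
    h1.clm_apply contDiffAt_const
  have h3 : ContDiffAt ℝ ∞ (fun z => fderiv ℝ φ z (EuclideanSpace.single i 1) a) p.2 :=
    (contDiffAt_euclidean.1 h2) a
  exact (h3.comp p contDiffAt_snd).contDiffWithinAt

/-- The Jacobian matrix of the coordinate change. -/
def jac : Matrix (Fin n) (Fin n) (SmoothRing O') :=
  Matrix.of fun a i => SmoothRing.mk _ (hφ.contDiffOn_jac a i)

lemma jac_apply (a i : Fin n) (p : O') :
    (hφ.jac a i).1 p = fderiv ℝ φ p.1.2 (EuclideanSpace.single i 1) a := rfl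

lemma hasFDerivAt_timeMap (p : O') : HasFDerivAt (timeMap φ)
    ((ContinuousLinearMap.fst ℝ ℝ (E n)).prod
      ((fderiv ℝ φ p.1.2).comp (ContinuousLinearMap.snd ℝ ℝ (E n)))) p := by
  have h1 : HasFDerivAt φ (fderiv ℝ φ p.1.2) (p.1.2) :=
    ((hφ.smooth p p.2).differentiableAt (by simp)).hasFDerivAt
  exact hasFDerivAt_fst.prodMk (h1.comp (p : ℝ × E n) hasFDerivAt_snd)

lemma chain (i : Fin n) (f : SmoothRing O) :
    dir (spaceVec i) (hφ.pull f) = ∑ a, hφ.jac a i * hφ.pull (dir (spaceVec a) f) := by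
  refine ext_eval fun p => ?_
  rw [map_sum]
  simp only [map_mul, eval_apply, jac_apply]
  have e1 : (dir (spaceVec i) (hφ.pull f)).1 p = _ := dir_comap _ _ _ _ _ _
  have e2 : fderiv ℝ (timeMap φ) p (spaceVec i) =
      ∑ a, (fderiv ℝ φ p.1.2 (EuclideanSpace.single i 1) a) • (spaceVec a : ℝ × E n) := by
    rw [(hφ.hasFDerivAt_timeMap p).fderiv]
    refine Prod.ext ?_ ?_
    · simp [spaceVec, Prod.fst_sum]
    · simp only [spaceVec, Prod.snd_sum, Prod.smul_snd]
      ext b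
      simp [WithLp.ofLp_sum, Pi.single_apply]
  rw [e1, e2, map_sum]
  refine Finset.sum_congr rfl fun a _ => ?_
  rw [map_smul, smul_eq_mul]
  rfl

lemma time_chain (f : SmoothRing O) :
    dir (timeVec n) (hφ.pull f) = hφ.pull (dir (timeVec n) f) := by
  refine ext_eval fun p => ?_
  have e1 : (dir (timeVec n) (hφ.pull f)).1 p = _ := dir_comap _ _ _ _ _ _
  have e2 : fderiv ℝ (timeMap φ) p (timeVec n) = timeVec n := by
    rw [(hφ.hasFDerivAt_timeMap p).fderiv]
    simp [timeVec]
  rw [eval_apply, e1, e2]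
  rfl

lemma dir_jac (v : ℝ × E n) (a i : Fin n) (p : O') : (dir v (hφ.jac a i)).1 p =
    fderiv ℝ (fderiv ℝ φ) p.1.2 v.2 (EuclideanSpace.single i 1) a := by
  rw [dir_apply_of v _ (fun q : ℝ × E n => fderiv ℝ φ q.2 (EuclideanSpace.single i 1) a)
    (fun q => hφ.jac_apply a i q)]
  have h1 : DifferentiableAt ℝ (fderiv ℝ φ) p.1.2 :=
    ((hφ.smooth p p.2).fderiv_right (m := ∞) (by simp)).differentiableAt (by simp)
  have h2 : HasFDerivAt (fun q : ℝ × E n => fderiv ℝ φ q.2)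
      ((fderiv ℝ (fderiv ℝ φ) p.1.2).comp (ContinuousLinearMap.snd ℝ ℝ (E n))) p :=
    h1.hasFDerivAt.comp (p : ℝ × E n) hasFDerivAt_snd
  have h3 := h2.clm_apply (hasFDerivAt_const (EuclideanSpace.single i (1 : ℝ) : E n) (p : ℝ × E n))
  have h4 := ((EuclideanSpace.proj a : E n →L[ℝ] ℝ).hasFDerivAt).comp (p : ℝ × E n) h3
  have h5 := h4.fderiv
  change fderiv ℝ (fun q : ℝ × E n => fderiv ℝ φ q.2 (EuclideanSpace.single i 1) a) p v = _
  change fderiv ℝ (fun q : ℝ × E n => fderiv ℝ φ q.2 (EuclideanSpace.single i 1) a) p = _ at h5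
  rw [h5]
  simp

lemma hess (i j a : Fin n) :
    dir (spaceVec i) (hφ.jac a j) = dir (spaceVec j) (hφ.jac a i) := by
  refine ext_eval fun p => ?_
  rw [eval_apply, eval_apply, hφ.dir_jac, hφ.dir_jac]
  have hs : IsSymmSndFDerivAt ℝ φ p.1.2 := (hφ.smooth p p.2).isSymmSndFDerivAt
      (by simpa using WithTop.coe_le_coe.2 (le_top (a := (2 : ℕ∞))))
  exact congrFun (congrArg WithLp.ofLp (hs.eq (EuclideanSpace.single i 1)
    (EuclideanSpace.single j 1))) a

lemma time_jac : dMat (dir (timeVec n)) hφ.jac = 0 := by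
  refine Matrix.ext fun a i => ext_eval fun p => ?_
  rw [dMat_apply, eval_apply, hφ.dir_jac]
  simp [timeVec]

lemma isPullback {G' : ℝ → E n → Matrix (Fin n) (Fin n) ℝ} (hG : IsMetricOn O G)
    (hG' : IsMetricOn O' G')
    (h : ∀ p ∈ O', ∀ i j, G' p.1 p.2 i j = ∑ a, ∑ b, fderiv ℝ φ p.2 (EuclideanSpace.single i 1) a *
      G p.1 (φ p.2) a b * fderiv ℝ φ p.2 (EuclideanSpace.single j 1) b) :
    hG.toDiffMetric.IsPullback hG'.toDiffMetric hφ.pull hφ.jac where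
  chain i x := hφ.chain i x
  hess i j a := hφ.hess i j a
  metric := by
    refine Matrix.ext fun i j => ext_eval fun p => ?_
    have e1 : eval p (hG'.toDiffMetric.G i j) = G' p.1.1 p.1.2 i j := rfl
    rw [e1, h p p.2 i j]
    simp only [Matrix.mul_apply, map_sum, map_mul, Finset.sum_mul, Matrix.transpose_apply,
      Matrix.map_apply]
    rw [Finset.sum_comm]
    rfl

end IsCoordChange

/-- The curvature quantities do not depend on the coordinates. -/
lemma invariants_eq {O' : Opens (ℝ × E n)} {φ : E n → E n} (hφ : IsCoordChange O' O φ)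
    {G' : ℝ → E n → Matrix (Fin n) (Fin n) ℝ} (hG : IsMetricOn O G) (hG' : IsMetricOn O' G')
    (h : ∀ p ∈ O', ∀ i j, G' p.1 p.2 i j = ∑ a, ∑ b, fderiv ℝ φ p.2 (EuclideanSpace.single i 1) a *
      G p.1 (φ p.2) a b * fderiv ℝ φ p.2 (EuclideanSpace.single j 1) b)
    (t : ℝ) (z : E n) (hz : (t, z) ∈ O') :
    scalar (G' t) z = scalar (G t) (φ z) ∧ tracelessSq (G' t) z = tracelessSq (G t) (φ z) ∧
      norm4 (G' t z)⁻¹ (weyl (G' t) z) = norm4 (G t (φ z))⁻¹ (weyl (G t) (φ z)) := by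
  have H := hφ.isPullback hG hG' h
  refine ⟨?_, ?_, ?_⟩
  · have := congrArg (eval ⟨(t, z), hz⟩) H.scal_eq
    rw [eval_apply, hG'.scal_apply] at this
    rw [this]
    exact hG.scal_apply ⟨(t, φ z), hφ.maps _ hz⟩
  · have := congrArg (eval ⟨(t, z), hz⟩) H.tracelessSq_eq
    rw [eval_apply, hG'.tracelessSq_apply] at this
    rw [this]
    exact hG.tracelessSq_apply ⟨(t, φ z), hφ.maps _ hz⟩
  · have := H.weylNormAt_eq (eval ⟨(t, z), hz⟩)
    rw [hG'.weyl_eq] at this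
    rw [this]
    exact hG.weyl_eq ⟨(t, φ z), hφ.maps _ hz⟩

end Concrete

open Matrix TopologicalSpace SmoothRing Filter Topology

/-! ### Normal coordinates -/

section Normal

variable {n : ℕ}

/-- The quadratic map `z ↦ y₁ + L z + ½ Q(z, z)`. -/
def quadMap (y₁ : E n) (L : Matrix (Fin n) (Fin n) ℝ) (Q : Fin n → Matrix (Fin n) (Fin n) ℝ)
    (z : E n) : E n :=
  WithLp.toLp 2 fun a => y₁ a + ∑ i, L a i * z i + (1 / 2) * ∑ i, ∑ j, Q a i j * (z i * z j)

section QuadMap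

variable (y₁ : E n) (L : Matrix (Fin n) (Fin n) ℝ) (Q : Fin n → Matrix (Fin n) (Fin n) ℝ)

lemma quadMap_zero : quadMap y₁ L Q 0 = y₁ := by
  ext a; simp [quadMap]

lemma contDiff_quadMap : ContDiff ℝ ∞ (quadMap y₁ L Q) := by
  rw [contDiff_euclidean]
  intro a
  have hz : ∀ i : Fin n, ContDiff ℝ ∞ (fun z : E n => z i) := fun i =>
    (EuclideanSpace.proj i : E n →L[ℝ] ℝ).contDiff
  change ContDiff ℝ ∞ fun z : E n => y₁ a + ∑ i, L a i * z i
    + (1 / 2) * ∑ i, ∑ j, Q a i j * (z i * z j)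
  exact (contDiff_const.add (ContDiff.sum fun i _ => contDiff_const.mul (hz i))).add
    (contDiff_const.mul (ContDiff.sum fun i _ => ContDiff.sum fun j _ =>
      contDiff_const.mul ((hz i).mul (hz j))))

lemma fderiv_quadMap (hQ : ∀ a i j, Q a i j = Q a j i) (z : E n) (a k : Fin n) :
    fderiv ℝ (quadMap y₁ L Q) z (EuclideanSpace.single k 1) a = L a k + ∑ j, Q a k j * z j := by
  have hp : ∀ i : Fin n, HasFDerivAt (fun z : E n => z i) (EuclideanSpace.proj i : E n →L[ℝ] ℝ) z :=
    fun i => (EuclideanSpace.proj i : E n →L[ℝ] ℝ).hasFDerivAt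
  have h1 : HasFDerivAt (fun z : E n => y₁ a + ∑ i, L a i * z i
      + (1 / 2) * ∑ i, ∑ j, Q a i j * (z i * z j)) _ z :=
    ((hasFDerivAt_const (y₁ a) z).add (HasFDerivAt.fun_sum (u := Finset.univ)
      fun i _ => (hp i).const_mul (L a i))).add
      ((HasFDerivAt.fun_sum (u := Finset.univ) fun i _ => HasFDerivAt.fun_sum (u := Finset.univ)
        fun j _ => ((hp i).mul (hp j)).const_mul (Q a i j)).const_mul (1 / 2))
  have h2 : HasFDerivAt (quadMap y₁ L Q) (fderiv ℝ (quadMap y₁ L Q) z) z :=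
    ((contDiff_quadMap y₁ L Q).differentiable (by simp) z).hasFDerivAt
  have h3 := ((EuclideanSpace.proj a : E n →L[ℝ] ℝ).hasFDerivAt).comp z h2
  have h4 := h3.unique h1
  have h5 := congrArg (fun T => T (EuclideanSpace.single k (1 : ℝ))) h4
  have hproj : ∀ i, (EuclideanSpace.proj i : E n →L[ℝ] ℝ) (EuclideanSpace.single k 1) =
      if i = k then 1 else 0 := fun i => by simp
  have hproja : (EuclideanSpace.proj a : E n →L[ℝ] ℝ)
      (fderiv ℝ (quadMap y₁ L Q) z (EuclideanSpace.single k 1)) =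
      fderiv ℝ (quadMap y₁ L Q) z (EuclideanSpace.single k 1) a := rfl
  rw [ContinuousLinearMap.comp_apply, hproja] at h5
  simp only [_root_.add_apply, _root_.sum_apply, _root_.smul_apply, hproj, smul_eq_mul,
    _root_.zero_apply] at h5
  rw [h5]
  have e1 : ∀ i, ∑ j, Q a i j * (z i * (if j = k then 1 else 0) + z j * (if i = k then 1 else 0))
      = Q a i k * z i + if i = k then ∑ j, Q a k j * z j else 0 := by
    intro i
    by_cases h : i = k
    · subst h; simp [mul_add, Finset.sum_add_distrib]
    · simp [h]
  simp only [e1, Finset.sum_add_distrib]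
  simp only [mul_ite, mul_one, mul_zero, Finset.sum_ite_eq', Finset.mem_univ, if_true, zero_add]
  have e2 : ∑ i, Q a i k * z i = ∑ j, Q a k j * z j :=
    Finset.sum_congr rfl fun i _ => by rw [hQ a i k]
  rw [e2]; ring

end QuadMap

lemma DiffMetric.IsPullback.isFlow {C C' : Type*} [CommRing C] [Algebra ℝ C] [CommRing C']
    [Algebra ℝ C'] {g : DiffMetric n C} {g' : DiffMetric n C'} {f : C →ₐ[ℝ] C'}
    {J : Matrix (Fin n) (Fin n) C'} (H : g.IsPullback g' f J) {dt : Derivation ℝ C C}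
    {dt' : Derivation ℝ C' C'} (h1 : ∀ x, dt' (f x) = f (dt x)) (h2 : dMat dt' J = 0)
    (hc : ∀ i x, dt' (g'.d i x) = g'.d i (dt' x)) (hf : g.IsFlow dt) : g'.IsFlow dt' where
  comm := hc
  flow := by
    have e1 : dMat dt' (g.G.map f) = (dMat dt g.G).map f := by ext; simp [h1]
    have e2 : (-(2 : ℝ) • g.Ric).map f = -(2 : ℝ) • g.Ric.map f := by ext; simp
    rw [H.metric, dMat_mul, dMat_mul, dMat_transpose, h2, e1, hf.flow, e2, H.Ric_eq]
    simp [Matrix.mul_assoc]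

open scoped MatrixOrder Matrix.Norms.L2Operator in
/-- Every positive definite matrix is congruent to the identity. -/
lemma exists_congr_one {X : Matrix (Fin n) (Fin n) ℝ} (hX : X.PosDef) :
    ∃ L : Matrix (Fin n) (Fin n) ℝ, Lᵀ * X * L = 1 := by
  obtain ⟨B, hB⟩ := (CStarAlgebra.nonneg_iff_eq_star_mul_self (a := X)).1 hX.posSemidef.nonneg
  have hB' : X = Bᵀ * B := by 
    rw [hB, Matrix.star_eq_conjTranspose, Matrix.conjTranspose_eq_transpose_of_trivial]
  have hdet : IsUnit B.det := by
    have : X.det ≠ 0 := hX.det_pos.ne'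
    rw [hB', Matrix.det_mul, Matrix.det_transpose] at this
    exact isUnit_iff_ne_zero.2 (left_ne_zero_of_mul this)
  refine ⟨B⁻¹, ?_⟩
  rw [hB', Matrix.transpose_nonsing_inv]
  have h1 : Bᵀ⁻¹ * Bᵀ = 1 := Matrix.nonsing_inv_mul _ (by rwa [Matrix.det_transpose])
  have h2 : B * B⁻¹ = 1 := Matrix.mul_nonsing_inv _ hdet
  calc Bᵀ⁻¹ * (Bᵀ * B) * B⁻¹ = (Bᵀ⁻¹ * Bᵀ) * (B * B⁻¹) := by noncomm_ring
    _ = 1 := by rw [h1, h2, one_mul]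

variable {O : Opens (ℝ × E n)} {G : ℝ → E n → Matrix (Fin n) (Fin n) ℝ}

/-- Existence of normal coordinates at a point of space-time: a quadratic change of coordinates
after which the metric is the identity matrix and the Christoffel symbols vanish at the point. -/
lemma IsMetricOn.exists_normal (hG : IsMetricOn O G) (p : O) (hpos : (G p.1.1 p.1.2).PosDef) :
    ∃ (O' : Opens (ℝ × E n)) (φ : E n → E n) (hφ : IsCoordChange O' O φ)
      (g' : DiffMetric n (SmoothRing O')) (p' : O'), timeMap φ p' = p ∧
      (∀ k, g'.d k = dir (spaceVec k)) ∧
      hG.toDiffMetric.IsPullback g' hφ.pull hφ.jac ∧ g'.IsNormal (eval p') := by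
  obtain ⟨L, hL⟩ := exists_congr_one hpos
  have hLdet : L.det ≠ 0 := by
    intro h0
    have := congrArg Matrix.det hL
    simp [h0] at this
  set Γ₀ : Fin n → Fin n → Fin n → ℝ := fun a b c => eval p (hG.toDiffMetric.Γ b a c) with hΓ₀
  set Q : Fin n → Matrix (Fin n) (Fin n) ℝ :=
    fun a => Matrix.of fun i j => -∑ b, ∑ c, L b i * Γ₀ a b c * L c j with hQdef
  have hQ : ∀ a i j, Q a i j = Q a j i := by
    intro a i j
    simp only [hQdef, Matrix.of_apply]
    rw [Finset.sum_comm]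
    congr 1
    refine Finset.sum_congr rfl fun b _ => Finset.sum_congr rfl fun c _ => ?_
    have : Γ₀ a c b = Γ₀ a b c := by simp only [hΓ₀, hG.toDiffMetric.Γ_symm c b a]
    rw [this]; ring
  set φ := quadMap p.1.2 L Q with hφdef
  have hφs : ContDiff ℝ ∞ φ := contDiff_quadMap _ _ _
  have hJ : ∀ z a k, fderiv ℝ φ z (EuclideanSpace.single k 1) a = L a k + ∑ j, Q a k j * z j :=
    fun z a k => fderiv_quadMap _ _ _ hQ z a k
  set Jm : ℝ × E n → Matrix (Fin n) (Fin n) ℝ := fun q =>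
    Matrix.of fun a i => fderiv ℝ φ q.2 (EuclideanSpace.single i 1) a with hJm
  have hJc : ∀ a i, Continuous fun q : ℝ × E n => Jm q a i := by
    intro a i
    simp only [hJm, Matrix.of_apply, hJ]
    have hz : ∀ j : Fin n, Continuous (fun q : ℝ × E n => q.2 j) := fun j =>
      (EuclideanSpace.proj j : E n →L[ℝ] ℝ).continuous.comp continuous_snd
    exact continuous_const.add (continuous_finsetSum _ fun j _ => continuous_const.mul (hz j))
  have hJdet : Continuous fun q => (Jm q).det :=
    Continuous.matrix_det (continuous_matrix hJc)
  have hΦc : Continuous (timeMap φ) := continuous_fst.prodMk (hφs.continuous.comp continuous_snd)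
  set O' : Opens (ℝ × E n) := ⟨{q | (Jm q).det ≠ 0} ∩ timeMap φ ⁻¹' O,
    (isOpen_ne.preimage hJdet).inter (O.isOpen.preimage hΦc)⟩ with hO'
  have hφ : IsCoordChange O' O φ := ⟨fun q _ => hφs.contDiffAt, fun q hq => hq.2⟩
  have hJ0 : Jm (p.1.1, 0) = L := by
    ext a i
    simp only [hJm, Matrix.of_apply, hJ]
    simp
  have hΦ0 : timeMap φ (p.1.1, 0) = p := by
    rw [timeMap, hφdef, quadMap_zero]
  have hp' : (p.1.1, (0 : E n)) ∈ O' := by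
    refine ⟨?_, ?_⟩
    · change (Jm (p.1.1, 0)).det ≠ 0
      rwa [hJ0]
    · change timeMap φ (p.1.1, 0) ∈ (O : Set (ℝ × E n))
      rw [hΦ0]; exact p.2
  set p' : O' := ⟨(p.1.1, 0), hp'⟩
  -- the inverse Jacobian matrix, with smooth entries
  set K : Matrix (Fin n) (Fin n) (SmoothRing O') := Matrix.of fun a i =>
    SmoothRing.mk (fun q => (Jm q)⁻¹ a i)
      (contDiffOn_inv (G := Jm) (fun a i => hφ.contDiffOn_jac a i) (fun q hq => hq.1) a i)
    with hK
  have hKJ : K * hφ.jac = 1 := by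
    refine Matrix.ext fun i j => ext_eval fun q => ?_
    have := congrFun (congrFun (Matrix.nonsing_inv_mul (Jm q)
      (isUnit_iff_ne_zero.2 q.2.1)) i) j
    rw [Matrix.mul_apply] at this
    rw [Matrix.mul_apply, map_sum]
    simp only [map_mul, eval_apply]
    refine Eq.trans this ?_
    by_cases h : i = j
    · subst h; simp only [Matrix.one_apply_eq]; exact (map_one (eval q)).symm
    · simp only [Matrix.one_apply_ne h]; exact (map_zero (eval q)).symm
  have hJK : hφ.jac * K = 1 := mul_eq_one_comm.1 hKJ
  have hAG : hG.toDiffMetric.A.map hφ.pull * hG.toDiffMetric.G.map hφ.pull = 1 := by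
    rw [← Matrix.map_mul, hG.toDiffMetric.inv,
      Matrix.map_one _ (map_zero hφ.pull) (map_one hφ.pull)]
  let g' : DiffMetric n (SmoothRing O') :=
    { d := fun k => dir (spaceVec k)
      comm := fun i j f => dir_comm _ _ f
      G := hφ.jacᵀ * hG.toDiffMetric.G.map hφ.pull * hφ.jac
      A := K * hG.toDiffMetric.A.map hφ.pull * Kᵀ
      symm := by
        rw [Matrix.transpose_mul, Matrix.transpose_mul, Matrix.transpose_transpose,
          ← Matrix.transpose_map, hG.toDiffMetric.symm, mul_assoc]
      inv := by
        have hKt : Kᵀ * hφ.jacᵀ = 1 := by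
          rw [← Matrix.transpose_mul, hJK, Matrix.transpose_one]
        calc K * hG.toDiffMetric.A.map hφ.pull * Kᵀ
              * (hφ.jacᵀ * hG.toDiffMetric.G.map hφ.pull * hφ.jac)
            = K * (hG.toDiffMetric.A.map hφ.pull * (Kᵀ * hφ.jacᵀ)
              * hG.toDiffMetric.G.map hφ.pull) * hφ.jac := by noncomm_ring
          _ = 1 := by rw [hKt, mul_one, hAG, mul_one, hKJ] }
  have H : hG.toDiffMetric.IsPullback g' hφ.pull hφ.jac :=
    ⟨fun i x => hφ.chain i x, fun i j a => hφ.hess i j a, rfl⟩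
  have hJev : hφ.jac.map (eval p') = L := hJ0
  have hev : ∀ x, eval p' (hφ.pull x) = eval p x := by
    intro x
    have : (⟨timeMap φ p', hφ.maps p' p'.2⟩ : O) = p := Subtype.ext hΦ0
    change x.1 _ = x.1 p
    rw [this]
  have hevm : ∀ X : Matrix (Fin n) (Fin n) (SmoothRing O), (X.map hφ.pull).map (eval p') =
      X.map (eval p) := fun X => Matrix.ext fun i j => hev _
  refine ⟨O', φ, hφ, g', p', hΦ0, fun k => rfl, H, ⟨?_, ?_⟩⟩
  · change (hφ.jacᵀ * hG.toDiffMetric.G.map hφ.pull * hφ.jac).map (eval p') = 1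
    rw [DiffMetric.map_matrix_mul, DiffMetric.map_matrix_mul, Matrix.transpose_map, hJev, hevm]
    exact hL
  · intro i
    have h1 := congrArg (fun X => X.map (eval p')) (H.gauge i)
    simp only [DiffMetric.map_matrix_mul, DiffMetric.map_matrix_add, hJev] at h1
    have h2 : (hG.toDiffMetric.pullΓ hφ.pull hφ.jac i).map (eval p') * L
        + (dMat (g'.d i) hφ.jac).map (eval p') = 0 := by
      ext a j
      have e1 : ∀ c, (hG.toDiffMetric.pullΓ hφ.pull hφ.jac i).map (eval p') a c =
          ∑ b, L b i * Γ₀ a b c := by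
        intro c
        simp only [DiffMetric.pullΓ, Matrix.map_apply, Matrix.sum_apply, Matrix.smul_apply,
          smul_eq_mul, map_sum, map_mul, hev]
        refine Finset.sum_congr rfl fun b _ => ?_
        congr 1
        exact congrFun (congrFun hJ0 b) i
      have e2 : (dMat (g'.d i) hφ.jac).map (eval p') a j = Q a j i := by
        change (dir (spaceVec i) (hφ.jac a j)).1 p' = _
        rw [dir_apply_of _ _ (fun q : ℝ × E n => L a j + ∑ l, Q a j l * q.2 l)
          (fun q => (hφ.jac_apply a j q).trans (hJ _ _ _))]
        have hp : ∀ l : Fin n, HasFDerivAt (fun q : ℝ × E n => q.2 l)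
            ((EuclideanSpace.proj l : E n →L[ℝ] ℝ).comp (ContinuousLinearMap.snd ℝ ℝ (E n))) p' :=
          fun l => ((EuclideanSpace.proj l : E n →L[ℝ] ℝ).comp
            (ContinuousLinearMap.snd ℝ ℝ (E n))).hasFDerivAt
        have h1 := (hasFDerivAt_const (L a j) (p' : ℝ × E n)).add
          (HasFDerivAt.fun_sum (u := Finset.univ) fun l _ => (hp l).const_mul (Q a j l))
        have h2 : fderiv ℝ (fun q : ℝ × E n => L a j + ∑ l, Q a j l * q.2 l) p' = _ := h1.fderiv
        rw [h2]
        simp [spaceVec]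
      rw [Matrix.add_apply, Matrix.mul_apply, e2, Matrix.zero_apply]
      simp only [e1, hQdef, Matrix.of_apply, Finset.sum_mul]
      have : ∑ c, ∑ b, L b i * Γ₀ a b c * L c j = ∑ b, ∑ c, L b j * Γ₀ a b c * L c i := by
        refine Finset.sum_congr rfl fun b _ => Finset.sum_congr rfl fun c _ => ?_
        have : Γ₀ a c b = Γ₀ a b c := by simp only [hΓ₀, hG.toDiffMetric.Γ_symm c b a]
        rw [this]; ring
      rw [this, add_neg_cancel]
    rw [h2] at h1
    calc (g'.Γ i).map (eval p') = L⁻¹ * (L * (g'.Γ i).map (eval p')) := by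
          rw [← mul_assoc, Matrix.nonsing_inv_mul _ (isUnit_iff_ne_zero.2 hLdet), one_mul]
      _ = 0 := by rw [h1, mul_zero]

end Normal

/-! ### First and second order conditions at a maximum -/

section Maximum

lemma deriv_deriv_nonpos_of_isLocalMax {a b : ℝ → ℝ} {x c : ℝ}
    (ha : ∀ᶠ s in 𝓝 x, HasDerivAt a (b s) s) (hb : HasDerivAt b c x) (hmax : IsLocalMax a x) :
    b x = 0 ∧ c ≤ 0 := by
  have hda : deriv a =ᶠ[𝓝 x] b := ha.mono fun s hs => hs.deriv
  have h0 : b x = 0 := by rw [← hda.eq_of_nhds]; exact hmax.deriv_eq_zero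
  refine ⟨h0, ?_⟩
  by_contra hc
  have hdd : deriv (deriv a) x = c := by rw [hda.deriv_eq, hb.deriv]
  have hmin : IsLocalMin a x := isLocalMin_of_deriv_deriv_pos (by rw [hdd]; linarith)
    hmax.deriv_eq_zero ha.self_of_nhds.continuousAt
  have hconst : a =ᶠ[𝓝 x] fun _ => a x := by
    filter_upwards [hmin, hmax] with s h1 h2 using le_antisymm h2 h1
  have h1 : deriv a =ᶠ[𝓝 x] fun _ => 0 := by
    have := hconst.deriv
    simpa using this
  have h2 := h1.deriv_eq
  rw [hdd] at h2
  simp at h2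
  exact hc h2.le

lemma deriv_nonneg_of_le_left {a : ℝ → ℝ} {x c : ℝ} (ha : HasDerivAt a c x)
    (h : ∀ᶠ s in 𝓝 x, s ≤ x → a s ≤ a x) : 0 ≤ c := by
  have h1 : HasDerivWithinAt a c (Set.Iio x) x := ha.hasDerivWithinAt
  rw [hasDerivWithinAt_iff_tendsto_slope' (by simp)] at h1
  refine ge_of_tendsto h1 ?_
  filter_upwards [nhdsWithin_le_nhds h, self_mem_nhdsWithin] with s hs hsx
  rw [slope_def_field]
  have hsx' : s < x := hsx
  exact div_nonneg_of_nonpos (by linarith [hs hsx'.le]) (by linarith)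

variable {n : ℕ} {O : Opens (ℝ × E n)}

lemma hasDerivAt_line (f : SmoothRing O) (q : O) (v : ℝ × E n) (s : ℝ)
    (hs : (q : ℝ × E n) + s • v ∈ O) :
    HasDerivAt (fun s : ℝ => rep f (q + s • v)) (rep (dir v f) (q + s • v)) s := by
  have h1 := (differentiableAt_rep f ⟨_, hs⟩).hasFDerivAt
  have h2 : HasDerivAt (fun s : ℝ => (q : ℝ × E n) + s • v) v s := by
    simpa using ((hasDerivAt_id s).smul_const v).const_add (q : ℝ × E n)
  have h3 := h1.comp_hasDerivAt s h2
  have h4 : rep (dir v f) (q + s • v) = fderiv ℝ (rep f) (q + s • v) v := by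
    rw [rep_apply _ ⟨_, hs⟩, dir_apply]
  rw [h4]
  exact h3

/-- At a point at which a function is maximal among all nearby points at earlier or equal times,
its space derivatives vanish, its pure second space derivatives are nonpositive and its time
derivative is nonnegative. -/
lemma conditions_of_max (f : SmoothRing O) (p : O)
    (h : ∀ᶠ q in 𝓝 (p : ℝ × E n), ∀ hq : q ∈ O, q.1 ≤ p.1.1 → f.1 ⟨q, hq⟩ ≤ f.1 p) :
    (∀ k, (dir (spaceVec k) f).1 p = 0) ∧
      (∀ k, (dir (spaceVec k) (dir (spaceVec k) f)).1 p ≤ 0) ∧ 0 ≤ (dir (timeVec n) f).1 p := by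
  have hline : ∀ v : ℝ × E n, Tendsto (fun s : ℝ => (p : ℝ × E n) + s • v) (𝓝 0) (𝓝 p) := by
    intro v
    have : Continuous fun s : ℝ => (p : ℝ × E n) + s • v := by fun_prop
    simpa using this.tendsto 0
  have hmem : ∀ v : ℝ × E n, ∀ᶠ s in 𝓝 (0 : ℝ), (p : ℝ × E n) + s • v ∈ O := fun v =>
    (hline v).eventually (O.isOpen.mem_nhds p.2)
  have hspace : ∀ k, (dir (spaceVec k) f).1 p = 0 ∧
      (dir (spaceVec k) (dir (spaceVec k) f)).1 p ≤ 0 := by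
    intro k
    have hd : ∀ᶠ s in 𝓝 (0 : ℝ), HasDerivAt (fun s : ℝ => rep f (p + s • spaceVec k))
        (rep (dir (spaceVec k) f) (p + s • spaceVec k)) s := by
      filter_upwards [hmem (spaceVec k)] with s hs using hasDerivAt_line f p _ s hs
    have hd2 := hasDerivAt_line (dir (spaceVec k) f) p (spaceVec k) 0 (by simp)
    have hm : IsLocalMax (fun s : ℝ => rep f (p + s • spaceVec k)) 0 := by
      filter_upwards [(hline (spaceVec k)).eventually h, hmem (spaceVec k)] with s hs hs'
      have := hs hs' (by simp [spaceVec])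
      rw [← rep_apply, ← rep_apply] at this
      simpa using this
    have := deriv_deriv_nonpos_of_isLocalMax hd hd2 hm
    simpa using this
  refine ⟨fun k => (hspace k).1, fun k => (hspace k).2, ?_⟩
  have hd := hasDerivAt_line f p (timeVec n) 0 (by simp)
  have := deriv_nonneg_of_le_left hd (by
    filter_upwards [(hline (timeVec n)).eventually h, hmem (timeVec n)] with s hs hs' hs0
    have := hs hs' (by simpa [timeVec] using hs0)
    rw [← rep_apply, ← rep_apply] at this
    simpa using this)
  simpa using this

end Maximum

/-! ### Reaction inequalities at an extremum in space-time -/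

section Local

variable {n : ℕ}

namespace DiffMetric.IsNormal

variable {C : Type*} [CommRing C] [Algebra ℝ C] {g : DiffMetric n C} {ev : C →ₐ[ℝ] ℝ}
  (H : g.IsNormal ev)

include H

lemma scal_ev : ev g.scal = (g.Ric.map ev).trace := by
  simp [scal, Matrix.trace, H.mixed_apply_ev]

lemma d_scal_ev (l : Fin n) : ev (g.d l g.scal) = ((dMat (g.d l) g.Ric).map ev).trace := by
  simp [scal, Matrix.trace, H.d_mixed_ev]

lemma trace_sq_ev : ev (g.mixed ^ 2).trace = ∑ i, ∑ j, g.Ric.map ev i j ^ 2 := by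
  have hs : ∀ i j, g.Ric i j = g.Ric j i := fun i j => congrFun (congrFun g.Ric_symm j) i
  simp only [sq, Matrix.trace, Matrix.diag_apply, Matrix.mul_apply, map_sum, map_mul,
    H.mixed_apply_ev, Matrix.map_apply]
  refine Finset.sum_congr rfl fun i _ => Finset.sum_congr rfl fun j _ => ?_
  rw [hs j i]

lemma d_trace_sq_ev (l : Fin n) : ev (g.d l (g.mixed ^ 2).trace) =
    2 * ∑ i, ∑ j, g.Ric.map ev i j * (dMat (g.d l) g.Ric).map ev i j := by
  have hs : ∀ i j, g.Ric i j = g.Ric j i := fun i j => congrFun (congrFun g.Ric_symm j) i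
  simp only [sq, Matrix.trace, Matrix.diag_apply, Matrix.mul_apply, map_sum, map_mul, map_add,
    Derivation.leibniz, smul_eq_mul, H.mixed_apply_ev, H.d_mixed_ev, Matrix.map_apply,
    dMat_apply, Finset.mul_sum]
  refine Finset.sum_congr rfl fun i _ => Finset.sum_congr rfl fun j _ => ?_
  rw [hs j i]; ring

/-- If `|E|² - κ (R + c)²` vanishes together with its gradient and has nonpositive Laplacian and
nonnegative time derivative, then `κ (R + c) ≤ |W| + 2 √κ (R + c) + |R|`. -/
lemma pinching {dt : Derivation ℝ C C} (hf : g.IsFlow dt) (hn : 3 ≤ n) (κ c : ℝ) (hκ : 0 < κ)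
    (hpos : 0 < ev g.scal + c) (h0 : ev g.tracelessSq = κ * (ev g.scal + c) ^ 2)
    (h1 : ∀ k, ev (g.d k (g.tracelessSq - κ • (g.scal + algebraMap ℝ C c) ^ 2)) = 0)
    (h2 : ∀ k, ev (g.d k (g.d k (g.tracelessSq - κ • (g.scal + algebraMap ℝ C c) ^ 2))) ≤ 0)
    (h3 : 0 ≤ ev (dt (g.tracelessSq - κ • (g.scal + algebraMap ℝ C c) ^ 2))) :
    κ * (ev g.scal + c) ≤ g.weylNormAt ev + 2 * √κ * (ev g.scal + c) + |ev g.scal| := by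
  have hfirst : ∀ D : Derivation ℝ C C,
      ev (D (g.tracelessSq - κ • (g.scal + algebraMap ℝ C c) ^ 2)) =
        ev (D (g.mixed ^ 2).trace) - (1 / n) * (2 * ev g.scal * ev (D g.scal))
          - κ * (2 * (ev g.scal + c) * ev (D g.scal)) := by
    intro D
    simp only [tracelessSq, sq g.scal, sq (g.scal + _), map_sub, Derivation.map_smul, map_smul,
      Derivation.leibniz, map_add, map_mul, smul_eq_mul, Derivation.map_algebraMap,
      AlgHom.commutes, Algebra.algebraMap_self, RingHom.id_apply, add_zero]
    ring
  have hsecond : ∀ k, ev (g.d k (g.d k (g.tracelessSq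
      - κ • (g.scal + algebraMap ℝ C c) ^ 2))) =
        ev (g.d k (g.d k (g.mixed ^ 2).trace))
          - (1 / n) * (2 * ev g.scal * ev (g.d k (g.d k g.scal)) + 2 * ev (g.d k g.scal) ^ 2)
          - κ * (2 * (ev g.scal + c) * ev (g.d k (g.d k g.scal)) + 2 * ev (g.d k g.scal) ^ 2) := by
    intro k
    simp only [tracelessSq, sq g.scal, sq (g.scal + _), map_sub, Derivation.map_smul, map_smul,
      Derivation.leibniz, map_add, map_mul, smul_eq_mul, Derivation.map_algebraMap,
      AlgHom.commutes, Algebra.algebraMap_self, RingHom.id_apply, add_zero]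
    ring
  have hlap : ∑ k, ev (g.d k (g.d k (g.tracelessSq
      - κ • (g.scal + algebraMap ℝ C c) ^ 2))) ≤ 0 :=
    Finset.sum_nonpos fun k _ => h2 k
  simp only [hsecond, Finset.sum_sub_distrib, ← Finset.mul_sum, Finset.sum_add_distrib] at hlap
  rw [hfirst dt] at h3
  have hs := H.scal_box hf
  have hN := H.trace_sq_box hf
  have hsq : ∑ i, ∑ j, ev (g.Ric i j) ^ 2 = ∑ i, ∑ j, g.Ric.map ev i j ^ 2 := rfl
  set r := g.Ric.map ev with hr
  set D : Fin n → Matrix (Fin n) (Fin n) ℝ := fun l => (dMat (g.d l) g.Ric).map ev with hD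
  have hn0 : (n : ℝ) ≠ 0 := by
    have : n ≠ 0 := by omega
    exact_mod_cast this
  rw [H.weylNormAt_eq]
  refine pinching_at_max hn (fun i j k l => ev (g.Rm i j k l)) _ r D (ev g.scal) c κ ?_
    H.scal_ev (fun i k => (Ric_ev ev i k).symm) (fun i k => (H.Ric_ev' i k).symm)
    (fun i j k l => rfl) hκ hpos ?_ ?_ ?_
  · rw [hr, ← Matrix.transpose_map, g.Ric_symm]
  · rw [← h0, tracelessSq, map_sub, map_smul, map_pow, H.trace_sq_ev, smul_eq_mul]
    ring
  · intro l
    have := h1 l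
    rw [hfirst, H.d_trace_sq_ev, H.d_scal_ev] at this
    have e : ev g.scal * (D l).trace / n = (1 / n) * (ev g.scal * (D l).trace) := by ring
    rw [e]
    linarith
  · have hds : ∀ l, ev (g.d l g.scal) = (D l).trace := fun l => H.d_scal_ev l
    have hDD : ∑ l, ∑ i, ∑ j, ev (g.d l (g.Ric i j)) ^ 2 = ∑ l, ∑ i, ∑ j, D l i j ^ 2 := rfl
    have hRR : ∑ i, ∑ k, ∑ l, ∑ m, ev (g.Ric i k) * ev (g.Ric l m) * ev (g.Rm l i m k) =
      ∑ i, ∑ k, ∑ l, ∑ m, r i k * r l m * ev (g.Rm l i m k) := rfl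
    rw [hDD, hRR] at hN
    rw [hsq] at hs
    simp only [hds] at hlap
    have e1 := eq_add_of_sub_eq hs
    have e2 := eq_add_of_sub_eq hN
    rw [e1, e2] at h3
    generalize ∑ l, ev (g.d l (g.d l g.scal)) = Ls at *
    generalize ∑ l, ev (g.d l (g.d l (g.mixed ^ 2).trace)) = LN at *
    generalize ∑ i, ∑ j, r i j ^ 2 = rr at *
    generalize ∑ l, (D l).trace ^ 2 = tt at *
    generalize ∑ l, ∑ i, ∑ j, D l i j ^ 2 = dd at *
    have e3 : (4 * ev g.scal * rr - 2 * tt) / n = (1 / n) * (4 * ev g.scal * rr - 2 * tt) := by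
      ring
    rw [e3]
    linarith

end DiffMetric.IsNormal

variable {O : Opens (ℝ × E n)} {G : ℝ → E n → Matrix (Fin n) (Fin n) ℝ}

lemma IsCoordChange.eval_comp_pull {O' : Opens (ℝ × E n)} {φ : E n → E n}
    (hφ : IsCoordChange O' O φ) (q : O') (p : O) (h : timeMap φ q = p) :
    (eval q).comp hφ.pull = eval p := by
  ext x
  have : (⟨timeMap φ q, hφ.maps q q.2⟩ : O) = p := Subtype.ext h
  change x.1 _ = x.1 p
  rw [this]

lemma IsCoordChange.continuousAt {O' : Opens (ℝ × E n)} {φ : E n → E n}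
    (hφ : IsCoordChange O' O φ) (q : O') : ContinuousAt (timeMap φ) q :=
  (hφ.hasFDerivAt_timeMap q).continuousAt

/-- If `R + ε t` is minimal at a point among all nearby points at earlier or equal times, then
`ε ≤ 0`. -/
lemma nonpos_of_scalar_min (hG : IsMetricOn O G) (hflow : hG.toDiffMetric.IsFlow (dir (timeVec n)))
    (p : O) (hpos : (G p.1.1 p.1.2).PosDef) (ε : ℝ)
    (hmin : ∀ᶠ q in 𝓝 (p : ℝ × E n), q.1 ≤ p.1.1 →
      scalar (G p.1.1) p.1.2 + ε * p.1.1 ≤ scalar (G q.1) q.2 + ε * q.1) : ε ≤ 0 := by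
  obtain ⟨O', φ, hφ, g', p', hp', hd, H, N⟩ := hG.exists_normal p hpos
  have hf' : g'.IsFlow (dir (timeVec n)) := H.isFlow hφ.time_chain hφ.time_jac
    (fun i x => by rw [hd]; exact dir_comm _ _ _) hflow
  have hτ : ContDiffOn ℝ ∞ (fun q : ℝ × E n => q.1) O' := contDiff_fst.contDiffOn
  set τ : SmoothRing O' := SmoothRing.mk (fun q : ℝ × E n => q.1) hτ with hτd
  have hdτ : ∀ v : ℝ × E n, dir v τ = algebraMap ℝ _ v.1 := by
    intro v
    refine ext_eval fun q => ?_
    rw [eval_apply, dir_apply_of v τ (fun q : ℝ × E n => q.1) (fun q => rfl), fderiv_fst]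
    rfl
  set f : SmoothRing O' := -(g'.scal + ε • τ) with hfd
  have hval : ∀ q : O', f.1 q = -(scalar (G q.1.1) (φ q.1.2) + ε * q.1.1) := by
    intro q
    have e : (g'.scal).1 q = scalar (G q.1.1) (φ q.1.2) := by
      rw [H.scal_eq]
      exact hG.scal_apply ⟨timeMap φ q, hφ.maps q q.2⟩
    change -((g'.scal).1 q + ε * q.1.1) = _
    rw [e]
  have ht : p'.1.1 = p.1.1 := by
    rw [← hp']; rfl
  have hy : φ p'.1.2 = p.1.2 := by
    rw [← hp']; rfl
  have hcont : Tendsto (timeMap φ) (𝓝 (p' : ℝ × E n)) (𝓝 (p : ℝ × E n)) := by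
    rw [← hp']; exact hφ.continuousAt p'
  obtain ⟨-, h2, h3⟩ := conditions_of_max f p' (by
    filter_upwards [hcont.eventually hmin] with q hq hqO hqt
    rw [hval, hval, ht, hy]
    have := hq (by rw [← ht]; exact hqt)
    simp only [timeMap] at this
    linarith)
  have h2' : ∀ k, 0 ≤ eval p' (g'.d k (g'.d k g'.scal)) := by
    intro k
    have := h2 k
    simp only [hfd, map_neg, map_add, Derivation.map_smul, hdτ, smul_zero, add_zero, spaceVec,
      map_zero] at this
    rw [hd]
    change -(dir (spaceVec k) (dir (spaceVec k) g'.scal)).1 p' ≤ 0 at this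
    change 0 ≤ (dir (spaceVec k) (dir (spaceVec k) g'.scal)).1 p'
    linarith
  have h3' : 0 ≤ -(eval p' (dir (timeVec n) g'.scal) + ε) := by
    have e : eval p' (dir (timeVec n) f) = -(eval p' (dir (timeVec n) g'.scal) + ε) := by
      simp only [hfd, map_neg, map_add, Derivation.map_smul, map_smul, hdτ, timeVec, map_one,
        smul_eq_mul, mul_one]
    rw [← e]; exact h3
  have hbox := N.scal_box hf'
  have hsum : 0 ≤ ∑ l, eval p' (g'.d l (g'.d l g'.scal)) := Finset.sum_nonneg fun k _ => h2' k
  have hr : 0 ≤ 2 * ∑ i, ∑ j, eval p' (g'.Ric i j) ^ 2 := by positivity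
  linarith

/-- If `|E|² - κ (R + c)²` attains the maximal value zero at a point, among all nearby points at
earlier or equal times, then `κ (R + c) ≤ |W| + 2 √κ (R + c) + |R|` there. -/
lemma pinching_of_max (hn : 3 ≤ n) (hG : IsMetricOn O G)
    (hflow : hG.toDiffMetric.IsFlow (dir (timeVec n)))
    (p : O) (hpos : (G p.1.1 p.1.2).PosDef) (κ c : ℝ) (hκ : 0 < κ)
    (hR : 0 < scalar (G p.1.1) p.1.2 + c)
    (h0 : tracelessSq (G p.1.1) p.1.2 = κ * (scalar (G p.1.1) p.1.2 + c) ^ 2)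
    (hmax : ∀ᶠ q in 𝓝 (p : ℝ × E n), q.1 ≤ p.1.1 →
      tracelessSq (G q.1) q.2 ≤ κ * (scalar (G q.1) q.2 + c) ^ 2) :
    κ * (scalar (G p.1.1) p.1.2 + c) ≤ norm4 (G p.1.1 p.1.2)⁻¹ (weyl (G p.1.1) p.1.2)
      + 2 * √κ * (scalar (G p.1.1) p.1.2 + c) + |scalar (G p.1.1) p.1.2| := by
  obtain ⟨O', φ, hφ, g', p', hp', hd, H, N⟩ := hG.exists_normal p hpos
  have hf' : g'.IsFlow (dir (timeVec n)) := H.isFlow hφ.time_chain hφ.time_jac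
    (fun i x => by rw [hd]; exact dir_comm _ _ _) hflow
  set f : SmoothRing O' := g'.tracelessSq - κ • (g'.scal + algebraMap ℝ _ c) ^ 2 with hfd
  have hs : ∀ q : O', (g'.scal).1 q = scalar (G q.1.1) (φ q.1.2) := by
    intro q
    rw [H.scal_eq]
    exact hG.scal_apply ⟨timeMap φ q, hφ.maps q q.2⟩
  have ht : ∀ q : O', (g'.tracelessSq).1 q = tracelessSq (G q.1.1) (φ q.1.2) := by
    intro q
    rw [H.tracelessSq_eq]
    exact hG.tracelessSq_apply ⟨timeMap φ q, hφ.maps q q.2⟩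
  have hval : ∀ q : O', f.1 q = tracelessSq (G q.1.1) (φ q.1.2)
      - κ * (scalar (G q.1.1) (φ q.1.2) + c) ^ 2 := by
    intro q
    rw [← hs, ← ht]
    rfl
  have ht' : p'.1.1 = p.1.1 := by
    rw [← hp']; rfl
  have hy : φ p'.1.2 = p.1.2 := by
    rw [← hp']; rfl
  have hcont : Tendsto (timeMap φ) (𝓝 (p' : ℝ × E n)) (𝓝 (p : ℝ × E n)) := by
    rw [← hp']; exact hφ.continuousAt p'
  obtain ⟨h1, h2, h3⟩ := conditions_of_max f p' (by
    filter_upwards [hcont.eventually hmax] with q hq hqO hqt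
    rw [hval, hval, ht', hy, h0, sub_self]
    have := hq (by rw [← ht']; exact hqt)
    simpa [timeMap] using this)
  have es : eval p' g'.scal = scalar (G p.1.1) p.1.2 := by
    rw [eval_apply, hs, ht', hy]
  have et : eval p' g'.tracelessSq = tracelessSq (G p.1.1) p.1.2 := by
    rw [eval_apply, ht, ht', hy]
  have key := N.pinching hf' hn κ c hκ (by rwa [es]) (by rw [es, et, h0])
    (fun k => by rw [hd]; exact h1 k) (fun k => by rw [hd]; exact h2 k) h3
  rw [es, H.weylNormAt_eq, hφ.eval_comp_pull p' p hp', hG.weyl_eq] at key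
  exact key

end Local

/-! ### Metrics on manifolds in coordinates -/

section Charts

variable {n : ℕ} {M : Type*} [TopologicalSpace M] [ChartedSpace (E n) M] [IsManifold (𝓡 n) ∞ M]

omit [IsManifold (𝓡 n) ∞ M] in
lemma mdifferentiableAt_chart {e : OpenPartialHomeomorph M (E n)}
    (he : e ∈ IsManifold.maximalAtlas (𝓡 n) ∞ M) {x : M} (hx : x ∈ e.source) :
    MDifferentiableAt (𝓡 n) (𝓡 n) e x :=
  (contMDiffAt_of_mem_maximalAtlas he hx).mdifferentiableAt (by simp)

omit [IsManifold (𝓡 n) ∞ M] in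
lemma mdifferentiableAt_chart_symm {e : OpenPartialHomeomorph M (E n)}
    (he : e ∈ IsManifold.maximalAtlas (𝓡 n) ∞ M) {y : E n} (hy : y ∈ e.target) :
    MDifferentiableAt (𝓡 n) (𝓡 n) e.symm y :=
  (contMDiffAt_symm_of_mem_maximalAtlas he hy).mdifferentiableAt (by simp)

/-- The differential of the inverse of a chart, as a map out of the model space. -/
def frame (e : OpenPartialHomeomorph M (E n)) (y : E n) :
    E n →L[ℝ] TangentSpace (𝓡 n) (e.symm y) := mfderiv (𝓡 n) (𝓡 n) e.symm y

omit [IsManifold (𝓡 n) ∞ M] in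
lemma frame_injective {e : OpenPartialHomeomorph M (E n)}
    (he : e ∈ IsManifold.maximalAtlas (𝓡 n) ∞ M) {y : E n} (hy : y ∈ e.target) (v : E n)
    (hv : frame e y v = 0) : v = 0 := by
  have h1 := mdifferentiableAt_chart he (e.map_target hy)
  have h2 := mdifferentiableAt_chart_symm he hy
  have h3 := mfderiv_comp y h1 h2
  have h4 : (e ∘ e.symm) =ᶠ[𝓝 y] id := by
    filter_upwards [e.open_target.mem_nhds hy] with z hz using e.right_inv hz
  rw [h4.mfderiv_eq, mfderiv_id] at h3
  have h5 := congrArg (fun D : E n →L[ℝ] E n => D v) h3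
  change v = mfderiv (𝓡 n) (𝓡 n) e (e.symm y) (frame e y v) at h5
  rw [h5, hv]
  exact map_zero _

lemma coordMetric_apply (g : Metric n M) (e : OpenPartialHomeomorph M (E n)) (y : E n)
    (i j : Fin n) : coordMetric g e y i j = g.inner (e.symm y)
      (frame e y (EuclideanSpace.single i 1)) (frame e y (EuclideanSpace.single j 1)) := rfl

lemma coordMetric_symm (g : Metric n M) (e : OpenPartialHomeomorph M (E n)) (y : E n) :
    (coordMetric g e y)ᵀ = coordMetric g e y := by
  ext i j
  rw [Matrix.transpose_apply, coordMetric_apply, coordMetric_apply, g.symm]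

lemma sum_smul_single (v : E n) : ∑ i, v i • (EuclideanSpace.single i (1 : ℝ) : E n) = v := by
  ext b
  simp [WithLp.ofLp_sum, Pi.single_apply]

lemma sum_coordMetric (g : Metric n M) (e : OpenPartialHomeomorph M (E n)) (y : E n) (v w : E n) :
    ∑ a, ∑ b, v a * coordMetric g e y a b * w b =
      g.inner (e.symm y) (frame e y v) (frame e y w) := by
  conv_rhs => rw [← sum_smul_single v, ← sum_smul_single w]
  simp only [map_sum, map_smul, _root_.sum_apply, _root_.smul_apply,
    smul_eq_mul, coordMetric_apply, Finset.mul_sum]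
  rw [Finset.sum_comm]
  exact Finset.sum_congr rfl fun a _ => Finset.sum_congr rfl fun b _ => by ring

lemma coordMetric_posDef (g : Metric n M) {e : OpenPartialHomeomorph M (E n)}
    (he : e ∈ IsManifold.maximalAtlas (𝓡 n) ∞ M) {y : E n} (hy : y ∈ e.target) :
    (coordMetric g e y).PosDef := by
  refine Matrix.PosDef.of_dotProduct_mulVec_pos ?_ ?_
  · rw [Matrix.IsHermitian, Matrix.conjTranspose_eq_transpose_of_trivial, coordMetric_symm]
  · intro v hv
    have hv' : (WithLp.toLp 2 v : E n) ≠ 0 := by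
      intro h
      exact hv (by simpa using congrArg WithLp.ofLp h)
    have h := g.pos (e.symm y) (frame e y (WithLp.toLp 2 v))
      (fun h0 => hv' (frame_injective he hy _ h0))
    rw [← sum_coordMetric] at h
    simp only [dotProduct, Matrix.mulVec, Finset.mul_sum, Pi.star_apply, star_trivial]
    simpa only [mul_assoc] using h

lemma inner_congr (g : Metric n M) {x x' : M} (h : x = x') (v w : E n) :
    (g.inner x : E n →L[ℝ] E n →L[ℝ] ℝ) v w = (g.inner x' : E n →L[ℝ] E n →L[ℝ] ℝ) v w := by
  subst h; rfl

/-- The transformation law of the components of a metric. -/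
lemma coordMetric_change (g : Metric n M) {e e' : OpenPartialHomeomorph M (E n)}
    (he : e ∈ IsManifold.maximalAtlas (𝓡 n) ∞ M) {z : E n} (hz : z ∈ e'.target) (hz' : e'.symm z ∈ e.source)
    (hφ : DifferentiableAt ℝ (e ∘ e'.symm) z) (i j : Fin n) :
    coordMetric g e' z i j = ∑ a, ∑ b,
      fderiv ℝ (e ∘ e'.symm) z (EuclideanSpace.single i 1) a * coordMetric g e (e (e'.symm z)) a b
        * fderiv ℝ (e ∘ e'.symm) z (EuclideanSpace.single j 1) b := by
  have hev : (e'.symm : E n → M) =ᶠ[𝓝 z] e.symm ∘ (e ∘ e'.symm) := by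
    have hc : ContinuousAt e'.symm z := e'.continuousAt_symm hz
    filter_upwards [hc.eventually (e.open_source.mem_nhds hz')] with w hw
    exact (e.left_inv hw).symm
  have h1 : MDifferentiableAt (𝓡 n) (𝓡 n) e.symm ((e ∘ e'.symm) z) :=
    mdifferentiableAt_chart_symm he (e.map_source hz')
  have h3 := mfderiv_comp z h1 hφ.mdifferentiableAt
  have h4 : ∀ v : E n, (frame e' z v : E n) = frame e (e (e'.symm z))
      (fderiv ℝ (e ∘ e'.symm) z v) := by
    intro v
    have h5 := hev.mfderiv_eq (I := 𝓡 n) (I' := 𝓡 n)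
    have h6 : (mfderiv (𝓡 n) (𝓡 n) e'.symm z : E n →L[ℝ] E n) =
      (mfderiv (𝓡 n) (𝓡 n) (e.symm ∘ (e ∘ e'.symm)) z : E n →L[ℝ] E n) := h5
    have h7 : (mfderiv (𝓡 n) (𝓡 n) (e ∘ e'.symm) z : E n →L[ℝ] E n) =
      fderiv ℝ (e ∘ e'.symm) z := mfderiv_eq_fderiv
    have h8 := congrArg (fun D : E n →L[ℝ] E n => D v) (h6.trans h3)
    rw [← h7]
    exact h8
  rw [sum_coordMetric, coordMetric_apply]
  have hx : e'.symm z = e.symm (e (e'.symm z)) := (e.left_inv hz').symm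
  refine Eq.trans ?_ (inner_congr g hx _ _)
  rw [← h4, ← h4]

/-- The components of the metric are smooth in each chart. -/
def IsSmoothMetric (g : Metric n M) : Prop :=
  ∀ e ∈ IsManifold.maximalAtlas (𝓡 n) ∞ M, ∀ i j : Fin n,
    ContDiffOn ℝ ∞ (fun y => coordMetric g e y i j) e.target

/-- The open subset `ℝ × U` of space-time. -/
def cylinder (U : Set (E n)) (hU : IsOpen U) : Opens (ℝ × E n) :=
  ⟨Set.univ ×ˢ U, isOpen_univ.prod hU⟩

lemma isMetricOn_cylinder (g : Metric n M) (hg : IsSmoothMetric g)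
    {e : OpenPartialHomeomorph M (E n)} (he : e ∈ IsManifold.maximalAtlas (𝓡 n) ∞ M)
    {U : Set (E n)} (hU : IsOpen U) (hUe : U ⊆ e.target) :
    IsMetricOn (cylinder U hU) (fun _ => coordMetric g e) where
  smooth i j := ((hg e he i j).mono hUe).comp contDiff_snd.contDiffOn fun _ hp => hp.2
  symm _ _ := coordMetric_symm g e _
  det_ne _ hp := (coordMetric_posDef g he (hUe hp.2)).det_pos.ne'

/-- The curvature quantities at a point do not depend on the chart. -/
lemma invariants_chart_eq (g : Metric n M) (hg : IsSmoothMetric g)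
    {e e' : OpenPartialHomeomorph M (E n)} (he : e ∈ IsManifold.maximalAtlas (𝓡 n) ∞ M)
    (he' : e' ∈ IsManifold.maximalAtlas (𝓡 n) ∞ M) {x : M} (hx : x ∈ e.source)
    (hx' : x ∈ e'.source) :
    scalar (coordMetric g e') (e' x) = scalar (coordMetric g e) (e x) ∧
    tracelessSq (coordMetric g e') (e' x) = tracelessSq (coordMetric g e) (e x) ∧
    norm4 (coordMetric g e' (e' x))⁻¹ (weyl (coordMetric g e') (e' x)) =
      norm4 (coordMetric g e (e x))⁻¹ (weyl (coordMetric g e) (e x)) := by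
  have hV : IsOpen (e'.symm ≫ₕ e).source := (e'.symm ≫ₕ e).open_source
  have hVe : (e'.symm ≫ₕ e).source ⊆ e'.target := fun z hz => by
    rw [OpenPartialHomeomorph.trans_source] at hz; exact hz.1
  have hVs : ∀ z ∈ (e'.symm ≫ₕ e).source, e'.symm z ∈ e.source := fun z hz => by
    rw [OpenPartialHomeomorph.trans_source] at hz; exact hz.2
  have hsm : ∀ z ∈ (e'.symm ≫ₕ e).source, ContDiffAt ℝ ∞ (e ∘ e'.symm) z := by
    intro z hz
    have h1 := contMDiffAt_of_mem_maximalAtlas he (hVs z hz)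
    have h2 := contMDiffAt_symm_of_mem_maximalAtlas he' (hVe hz)
    exact (h1.comp z h2).contDiffAt
  have hφ : IsCoordChange (cylinder _ hV) (cylinder e.target e.open_target) (e ∘ e'.symm) :=
    ⟨fun p hp => hsm p.2 hp.2, fun p hp => ⟨Set.mem_univ _, e.map_source (hVs _ hp.2)⟩⟩
  have hmem : e' x ∈ (e'.symm ≫ₕ e).source := by
    rw [OpenPartialHomeomorph.trans_source]
    refine ⟨e'.map_source hx', ?_⟩
    rw [Set.mem_preimage, e'.left_inv hx']
    exact hx
  have := invariants_eq hφ (isMetricOn_cylinder g hg he e.open_target subset_rfl)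
    (isMetricOn_cylinder g hg he' hV hVe)
    (fun p hp i j => coordMetric_change g he (hVe hp.2) (hVs _ hp.2)
      ((hsm _ hp.2).differentiableAt (by simp)) i j)
    0 (e' x) ⟨Set.mem_univ _, hmem⟩
  simpa only [Function.comp_apply, e'.left_inv hx'] using this

lemma scalarCurvature_eq (g : Metric n M) (hg : IsSmoothMetric g)
    {e : OpenPartialHomeomorph M (E n)} (he : e ∈ IsManifold.maximalAtlas (𝓡 n) ∞ M) {x : M}
    (hx : x ∈ e.source) : scalarCurvature g x = scalar (coordMetric g e) (e x) :=
  (invariants_chart_eq g hg he (IsManifold.chart_mem_maximalAtlas x) hx (mem_chart_source _ x)).1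

lemma tracelessRicciNorm_eq (hn : n ≠ 0) (g : Metric n M) (hg : IsSmoothMetric g)
    {e : OpenPartialHomeomorph M (E n)} (he : e ∈ IsManifold.maximalAtlas (𝓡 n) ∞ M) {x : M}
    (hx : x ∈ e.source) :
    tracelessRicciNorm g x = √(tracelessSq (coordMetric g e) (e x)) := by
  have hc : chartAt (E n) x ∈ IsManifold.maximalAtlas (𝓡 n) ∞ M :=
    IsManifold.chart_mem_maximalAtlas x
  rw [← (invariants_chart_eq g hg he hc hx (mem_chart_source _ x)).2.1]
  exact (isMetricOn_cylinder g hg hc (chartAt (E n) x).open_target subset_rfl).norm2_eq hn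
    ⟨(0, chartAt (E n) x x), Set.mem_univ _, mem_chart_target _ x⟩

lemma weylNorm_eq (g : Metric n M) (hg : IsSmoothMetric g)
    {e : OpenPartialHomeomorph M (E n)} (he : e ∈ IsManifold.maximalAtlas (𝓡 n) ∞ M) {x : M}
    (hx : x ∈ e.source) : weylNorm g x =
      norm4 (coordMetric g e (e x))⁻¹ (weyl (coordMetric g e) (e x)) :=
  (invariants_chart_eq g hg he (IsManifold.chart_mem_maximalAtlas x) hx
    (mem_chart_source _ x)).2.2

end Charts

/-! ### Continuity of the curvature along the flow -/

section Continuity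

variable {n : ℕ}

lemma contDiffOn_partialDeriv {I : Set ℝ} {U : Set (E n)} (hI : UniqueDiffOn ℝ I) (hU : IsOpen U)
    {F : ℝ → E n → ℝ} (hF : ContDiffOn ℝ ∞ (fun p : ℝ × E n => F p.1 p.2) (I ×ˢ U)) (k : Fin n) :
    ContDiffOn ℝ ∞ (fun p : ℝ × E n => partialDeriv k (fun z => F p.1 z) p.2) (I ×ˢ U) := by
  have hS : UniqueDiffOn ℝ (I ×ˢ U) := hI.prod hU.uniqueDiffOn
  have h1 : ContDiffOn ℝ ∞ (fun p => fderivWithin ℝ (fun p : ℝ × E n => F p.1 p.2) (I ×ˢ U) p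
      (spaceVec k)) (I ×ˢ U) :=
    (hF.fderivWithin hS (m := ∞) (by simp)).clm_apply contDiffOn_const
  refine h1.congr fun p hp => ?_
  have h2 : HasFDerivWithinAt (fun p : ℝ × E n => F p.1 p.2) _ (I ×ˢ U) (p.1, p.2) :=
    ((hF.differentiableOn (by simp)) p hp).hasFDerivWithinAt
  have h3 : HasFDerivAt (fun z : E n => (p.1, z)) (ContinuousLinearMap.inr ℝ ℝ (E n)) p.2 :=
    hasFDerivAt_prodMk_right _ _
  have h4 : HasFDerivWithinAt (fun z => F p.1 z) _ U p.2 :=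
    h2.comp p.2 h3.hasFDerivWithinAt fun z hz => ⟨hp.1, hz⟩
  rw [partialDeriv, (h4.hasFDerivAt (hU.mem_nhds hp.2)).fderiv]
  rfl

variable {I : Set ℝ} {U : Set (E n)} (hI : UniqueDiffOn ℝ I) (hU : IsOpen U)
  {G : ℝ → E n → Matrix (Fin n) (Fin n) ℝ}
  (hG : ∀ i j, ContDiffOn ℝ ∞ (fun p : ℝ × E n => G p.1 p.2 i j) (I ×ˢ U))
  (hdet : ∀ p ∈ I ×ˢ U, (G p.1 p.2).det ≠ 0)

include hG hdet

lemma contDiffOn_inv_metric (i j : Fin n) :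
    ContDiffOn ℝ ∞ (fun p : ℝ × E n => (G p.1 p.2)⁻¹ i j) (I ×ˢ U) :=
  contDiffOn_inv (G := fun p : ℝ × E n => G p.1 p.2) hG hdet i j

include hI hU

lemma contDiffOn_christoffel (l i j : Fin n) :
    ContDiffOn ℝ ∞ (fun p : ℝ × E n => christoffel (G p.1) p.2 l i j) (I ×ˢ U) := by
  have hd : ∀ k i j, ContDiffOn ℝ ∞
      (fun p : ℝ × E n => partialDeriv k (fun z => G p.1 z i j) p.2) (I ×ˢ U) :=
    fun k i j => contDiffOn_partialDeriv hI hU (F := fun t z => G t z i j) (hG i j) k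
  exact contDiffOn_const.mul (ContDiffOn.sum fun m _ =>
    (contDiffOn_inv_metric hG hdet l m).mul (((hd _ _ _).add (hd _ _ _)).sub (hd _ _ _)))

lemma contDiffOn_riemann31 (l i j k : Fin n) :
    ContDiffOn ℝ ∞ (fun p : ℝ × E n => riemann31 (G p.1) p.2 l i j k) (I ×ˢ U) := by
  have hΓ : ∀ l i j, _ := fun l i j => contDiffOn_christoffel hI hU hG hdet l i j
  have hd : ∀ k l i j, ContDiffOn ℝ ∞
      (fun p : ℝ × E n => partialDeriv k (fun z => christoffel (G p.1) z l i j) p.2) (I ×ˢ U) :=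
    fun k l i j => contDiffOn_partialDeriv hI hU (F := fun t z => christoffel (G t) z l i j)
      (hΓ l i j) k
  exact ((hd _ _ _ _).sub (hd _ _ _ _)).add (ContDiffOn.sum fun m _ =>
    ((hΓ _ _ _).mul (hΓ _ _ _)).sub ((hΓ _ _ _).mul (hΓ _ _ _)))

lemma contDiffOn_riemann (i j k l : Fin n) :
    ContDiffOn ℝ ∞ (fun p : ℝ × E n => riemann (G p.1) p.2 i j k l) (I ×ˢ U) :=
  ContDiffOn.sum fun _ _ => (hG _ _).mul (contDiffOn_riemann31 hI hU hG hdet _ _ _ _)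

lemma contDiffOn_ricci (i k : Fin n) :
    ContDiffOn ℝ ∞ (fun p : ℝ × E n => ricci (G p.1) p.2 i k) (I ×ˢ U) :=
  ContDiffOn.sum fun _ _ => ContDiffOn.sum fun _ _ =>
    (contDiffOn_inv_metric hG hdet _ _).mul (contDiffOn_riemann hI hU hG hdet _ _ _ _)

lemma contDiffOn_scalar : ContDiffOn ℝ ∞ (fun p : ℝ × E n => scalar (G p.1) p.2) (I ×ˢ U) :=
  ContDiffOn.sum fun _ _ => ContDiffOn.sum fun _ _ =>
    (contDiffOn_inv_metric hG hdet _ _).mul (contDiffOn_ricci hI hU hG hdet _ _)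

lemma contDiffOn_tracelessSq :
    ContDiffOn ℝ ∞ (fun p : ℝ × E n => tracelessSq (G p.1) p.2) (I ×ˢ U) := by
  have hB : ∀ i j, ContDiffOn ℝ ∞ (fun p : ℝ × E n =>
      ((G p.1 p.2)⁻¹ * Matrix.of (ricci (G p.1) p.2)) i j) (I ×ˢ U) := by
    intro i j
    simp only [Matrix.mul_apply]
    exact ContDiffOn.sum fun _ _ => (contDiffOn_inv_metric hG hdet _ _).mul
      (contDiffOn_ricci hI hU hG hdet _ _)
  have hs := contDiffOn_scalar hI hU hG hdet
  simp only [tracelessSq, sq (_ * _), Matrix.trace, Matrix.diag_apply,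
    Matrix.mul_apply (M := _ * _)]
  exact (ContDiffOn.sum fun _ _ => ContDiffOn.sum fun _ _ => (hB _ _).mul (hB _ _)).sub
    (contDiffOn_const.mul (hs.pow 2))

lemma contDiffOn_weyl (i j k l : Fin n) :
    ContDiffOn ℝ ∞ (fun p : ℝ × E n => weyl (G p.1) p.2 i j k l) (I ×ˢ U) := by
  have hr : ∀ i k, _ := fun i k => contDiffOn_ricci hI hU hG hdet i k
  exact ((contDiffOn_riemann hI hU hG hdet i j k l).sub (contDiffOn_const.mul
    (((((hG i k).mul (hr j l)).add ((hG j l).mul (hr i k))).sub ((hG i l).mul (hr j k))).sub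
      ((hG j k).mul (hr i l))))).add (((contDiffOn_scalar hI hU hG hdet).div_const _).mul
        (((hG i k).mul (hG j l)).sub ((hG i l).mul (hG j k))))

lemma continuousOn_norm4_weyl : ContinuousOn
    (fun p : ℝ × E n => norm4 (G p.1 p.2)⁻¹ (weyl (G p.1) p.2)) (I ×ˢ U) := by
  have hA : ∀ i j, ContinuousOn (fun p : ℝ × E n => (G p.1 p.2)⁻¹ i j) (I ×ˢ U) :=
    fun i j => (contDiffOn_inv_metric hG hdet i j).continuousOn
  have hW : ∀ i j k l, ContinuousOn (fun p : ℝ × E n => weyl (G p.1) p.2 i j k l) (I ×ˢ U) :=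
    fun i j k l => (contDiffOn_weyl hI hU hG hdet i j k l).continuousOn
  refine Real.continuous_sqrt.comp_continuousOn ?_
  refine continuousOn_finsetSum _ fun i _ => continuousOn_finsetSum _ fun j _ =>
    continuousOn_finsetSum _ fun k _ => continuousOn_finsetSum _ fun l _ =>
    continuousOn_finsetSum _ fun a _ => continuousOn_finsetSum _ fun b _ =>
    continuousOn_finsetSum _ fun c _ => continuousOn_finsetSum _ fun d _ => ?_
  exact (((((hA i a).mul (hA j b)).mul (hA k c)).mul (hA l d)).mul (hW i j k l)).mul (hW a b c d)

end Continuity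

/-! ### The maximum principle on a closed manifold -/

section Global

-- the unifier must not unfold the curvature when it compares expressions at different points
attribute [local irreducible] scalarCurvature tracelessRicciNorm weylNorm scalar tracelessSq norm4
  weyl coordMetric

variable {n : ℕ} {M : Type*} [TopologicalSpace M] [ChartedSpace (E n) M] [IsManifold (𝓡 n) ∞ M]

lemma convex_timeInterval (T : EReal) : Convex ℝ (timeInterval T) := by
  refine Set.OrdConnected.convex ⟨fun a ha b hb s hs => ⟨ha.1.trans hs.1, ?_⟩⟩
  exact lt_of_le_of_lt (EReal.coe_le_coe_iff.2 hs.2) hb.2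

lemma timeInterval_mem_nhds {T : EReal} {t : ℝ} (h0 : 0 < t) (hT : (t : EReal) < T) :
    timeInterval T ∈ 𝓝 t := by
  have h : IsOpen {s : ℝ | (s : EReal) < T} := isOpen_lt continuous_coe_real_ereal continuous_const
  filter_upwards [lt_mem_nhds h0, h.mem_nhds hT] with s hs hs' using ⟨hs.le, hs'⟩

lemma uniqueDiffOn_timeInterval {T : EReal} (hT : 0 < T) : UniqueDiffOn ℝ (timeInterval T) := by
  refine uniqueDiffOn_convex (convex_timeInterval T) ?_
  obtain ⟨r, hr0, hrT⟩ := EReal.lt_iff_exists_real_btwn.1 hT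
  exact ⟨r, mem_interior_iff_mem_nhds.2
    (timeInterval_mem_nhds (EReal.coe_pos.1 hr0) hrT)⟩

lemma Icc_subset_timeInterval {T : EReal} {t : ℝ} (ht : t ∈ timeInterval T) :
    Set.Icc 0 t ⊆ timeInterval T :=
  fun _ hs => ⟨hs.1, lt_of_le_of_lt (EReal.coe_le_coe_iff.2 hs.2) ht.2⟩

lemma zero_mem_timeInterval {T : EReal} (hT : 0 < T) : (0 : ℝ) ∈ timeInterval T :=
  ⟨le_rfl, by simpa using hT⟩

/-- A function of time and position is continuous if its coordinate expressions are. -/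
lemma continuousOn_of_charts {I : Set ℝ} {f : ℝ → M → ℝ}
    {F : OpenPartialHomeomorph M (E n) → ℝ × E n → ℝ}
    (hF : ∀ e ∈ IsManifold.maximalAtlas (𝓡 n) ∞ M, ContinuousOn (F e) (I ×ˢ e.target))
    (hf : ∀ e ∈ IsManifold.maximalAtlas (𝓡 n) ∞ M, ∀ t ∈ I, ∀ x ∈ e.source,
      f t x = F e (t, e x)) :
    ContinuousOn (fun p : ℝ × M => f p.1 p.2) (I ×ˢ Set.univ) := by
  rintro ⟨t, x⟩ ⟨ht, -⟩
  have he : chartAt (E n) x ∈ IsManifold.maximalAtlas (𝓡 n) ∞ M :=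
    IsManifold.chart_mem_maximalAtlas x
  set e := chartAt (E n) x with hed
  have hx : x ∈ e.source := mem_chart_source _ x
  have h1 : ContinuousOn (fun p : ℝ × M => F e (p.1, e p.2)) (I ×ˢ e.source) :=
    (hF e he).comp (continuousOn_fst.prodMk (e.continuousOn.comp continuousOn_snd
      fun p hp => hp.2)) fun p hp => ⟨hp.1, e.map_source hp.2⟩
  have h2 : ContinuousOn (fun p : ℝ × M => f p.1 p.2) (I ×ˢ e.source) :=
    h1.congr fun p hp => hf e he p.1 hp.1 p.2 hp.2
  refine (h2 (t, x) ⟨ht, hx⟩).mono_of_mem_nhdsWithin ?_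
  refine mem_nhdsWithin.2 ⟨Set.univ ×ˢ e.source, isOpen_univ.prod e.open_source,
    ⟨Set.mem_univ _, hx⟩, ?_⟩
  rintro q ⟨hq, hq'⟩
  exact ⟨hq'.1, hq.2⟩

/-- The part of space-time covered by a chart, at positive times. -/
def spacetime (T : EReal) (e : OpenPartialHomeomorph M (E n)) : Opens (ℝ × E n) where
  carrier := {t : ℝ | 0 < t ∧ (t : EReal) < T} ×ˢ e.target
  is_open' := ((isOpen_lt continuous_const continuous_id).inter
    (isOpen_lt continuous_coe_real_ereal continuous_const)).prod e.open_target

namespace IsRicciFlow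

variable {T : EReal} {g : ℝ → Metric n M} (h : IsRicciFlow T g)

include h

lemma isSmoothMetric {t : ℝ} (ht : t ∈ timeInterval T) : IsSmoothMetric (g t) := by
  intro e he i j
  have hc : ContDiffOn ℝ ∞ (fun y : E n => (t, y)) e.target :=
    (contDiff_const.prodMk contDiff_id).contDiffOn
  exact (h.smooth e he i j).comp hc fun y hy => ⟨ht, hy⟩

lemma isMetricOn {e : OpenPartialHomeomorph M (E n)}
    (he : e ∈ IsManifold.maximalAtlas (𝓡 n) ∞ M) :
    IsMetricOn (spacetime T e) (fun t => coordMetric (g t) e) where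
  smooth i j := (h.smooth e he i j).mono fun _ hp => ⟨⟨hp.1.1.le, hp.1.2⟩, hp.2⟩
  symm _ _ := coordMetric_symm _ e _
  det_ne _ hp := (coordMetric_posDef _ he hp.2).det_pos.ne'

lemma isFlow {e : OpenPartialHomeomorph M (E n)}
    (he : e ∈ IsManifold.maximalAtlas (𝓡 n) ∞ M) :
    (h.isMetricOn he).toDiffMetric.IsFlow (dir (timeVec n)) where
  comm _ _ := dir_comm _ _ _
  flow := by
    refine Matrix.ext fun i j => ext_eval fun p => ?_
    have h1 := hasDerivAt_slice (spacetime T e) ((h.isMetricOn he).toDiffMetric.G i j)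
      (fun t z => coordMetric (g t) e z i j) (fun _ => rfl) p
    have h2 := (h.evolution e he p.1.2 p.2.2 p.1.1 ⟨p.2.1.1.le, p.2.1.2⟩ i j).hasDerivAt
      (timeInterval_mem_nhds p.2.1.1 p.2.1.2)
    have h3 := h1.unique h2
    rw [← (h.isMetricOn he).Ric_apply p i j] at h3
    exact h3

lemma continuousOn_scalarCurvature (hT : 0 < T) : ContinuousOn
    (fun p : ℝ × M => scalarCurvature (g p.1) p.2) (timeInterval T ×ˢ Set.univ) :=
  continuousOn_of_charts (f := fun t => scalarCurvature (g t))
    (F := fun e p => scalar (coordMetric (g p.1) e) p.2)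
    (fun e he => (contDiffOn_scalar (G := fun t => coordMetric (g t) e)
      (uniqueDiffOn_timeInterval hT) e.open_target (h.smooth e he)
      fun _ hp => (coordMetric_posDef _ he hp.2).det_pos.ne').continuousOn)
    fun _ he _ ht _ hx => scalarCurvature_eq _ (h.isSmoothMetric ht) he hx

lemma continuousOn_tracelessRicciNorm (hn : n ≠ 0) (hT : 0 < T) : ContinuousOn
    (fun p : ℝ × M => tracelessRicciNorm (g p.1) p.2) (timeInterval T ×ˢ Set.univ) :=
  continuousOn_of_charts (f := fun t => tracelessRicciNorm (g t))
    (F := fun e p => √(tracelessSq (coordMetric (g p.1) e) p.2))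
    (fun e he => Real.continuous_sqrt.comp_continuousOn
      (contDiffOn_tracelessSq (G := fun t => coordMetric (g t) e)
      (uniqueDiffOn_timeInterval hT) e.open_target (h.smooth e he)
      fun _ hp => (coordMetric_posDef _ he hp.2).det_pos.ne').continuousOn)
    fun _ he _ ht _ hx => tracelessRicciNorm_eq hn _ (h.isSmoothMetric ht) he hx

lemma continuousOn_weylNorm (hT : 0 < T) : ContinuousOn
    (fun p : ℝ × M => weylNorm (g p.1) p.2) (timeInterval T ×ˢ Set.univ) :=
  continuousOn_of_charts (f := fun t => weylNorm (g t))
    (F := fun e p => norm4 (coordMetric (g p.1) e p.2)⁻¹ (weyl (coordMetric (g p.1) e) p.2))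
    (fun e he => continuousOn_norm4_weyl (G := fun t => coordMetric (g t) e)
      (uniqueDiffOn_timeInterval hT) e.open_target
      (h.smooth e he) fun _ hp => (coordMetric_posDef _ he hp.2).det_pos.ne')
    fun _ he _ ht _ hx => weylNorm_eq _ (h.isSmoothMetric ht) he hx

lemma continuous_initial (hn : n ≠ 0) (hT : 0 < T) :
    Continuous (scalarCurvature (g 0)) ∧ Continuous (tracelessRicciNorm (g 0)) := by
  have hι : Continuous fun x : M => ((0 : ℝ), x) := by fun_prop
  have hmem : ∀ x : M, ((0 : ℝ), x) ∈ timeInterval T ×ˢ (Set.univ : Set M) :=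
    fun x => ⟨zero_mem_timeInterval hT, Set.mem_univ _⟩
  exact ⟨(h.continuousOn_scalarCurvature hT).comp_continuous hι hmem,
    (h.continuousOn_tracelessRicciNorm hn hT).comp_continuous hι hmem⟩

/-- Coordinate points near a point at a positive time come from points of the manifold. -/
lemma eventually_chart {e : OpenPartialHomeomorph M (E n)}
    (p : spacetime T e) {P : ℝ → M → Prop}
    (hP : ∀ s ∈ Set.Icc 0 p.1.1, ∀ x, P s x) :
    ∀ᶠ q in 𝓝 (p : ℝ × E n), q.1 ≤ p.1.1 → ∃ x ∈ e.source, e x = q.2 ∧ IsSmoothMetric (g q.1) ∧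
      P q.1 x := by
  filter_upwards [(spacetime T e).isOpen.mem_nhds p.2] with q hq hqt
  exact ⟨e.symm q.2, e.map_target hq.2, e.right_inv hq.2,
    h.isSmoothMetric ⟨hq.1.1.le, hq.1.2⟩, hP _ ⟨hq.1.1.le, hqt⟩ _⟩

/-- The minimum of the scalar curvature does not decrease along the flow. -/
lemma le_scalarCurvature [CompactSpace M] (hT : 0 < T) {δ : ℝ}
    (hδ : ∀ x, δ ≤ scalarCurvature (g 0) x) {t : ℝ} (ht : t ∈ timeInterval T) (x : M) :
    δ ≤ scalarCurvature (g t) x := by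
  have key : ∀ ε > 0, δ ≤ scalarCurvature (g t) x + ε * t := by
    intro ε hε
    have hcont : ContinuousOn (fun p : ℝ × M => scalarCurvature (g p.1) p.2 + ε * p.1)
        (Set.Icc 0 t ×ˢ Set.univ) :=
      ((h.continuousOn_scalarCurvature hT).mono
        (Set.prod_mono (Icc_subset_timeInterval ht) subset_rfl)).add (by fun_prop)
    obtain ⟨⟨s, z⟩, ⟨hs, -⟩, hmin⟩ := (isCompact_Icc.prod isCompact_univ).exists_isMinOn
      ⟨(t, x), ⟨ht.1, le_rfl⟩, Set.mem_univ _⟩ hcont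
    have hle : ∀ s' ∈ Set.Icc 0 t, ∀ z', scalarCurvature (g s) z + ε * s ≤
        scalarCurvature (g s') z' + ε * s' := fun s' hs' z' => hmin (a := (s', z')) ⟨hs', trivial⟩
    have hs0 : s = 0 := by
      by_contra hne
      have hspos : 0 < s := lt_of_le_of_ne hs.1 (Ne.symm hne)
      have hsT := Icc_subset_timeInterval ht hs
      have he : chartAt (E n) z ∈ IsManifold.maximalAtlas (𝓡 n) ∞ M :=
        IsManifold.chart_mem_maximalAtlas z
      have hz := mem_chart_source (E n) z
      set e := chartAt (E n) z
      set p : spacetime T e := ⟨(s, e z), ⟨hspos, hsT.2⟩, e.map_source hz⟩ with hp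
      refine absurd (nonpos_of_scalar_min (h.isMetricOn he) (h.isFlow he) p
        (coordMetric_posDef _ he (e.map_source hz)) ε ?_) (not_le.2 hε)
      filter_upwards [h.eventually_chart p (P := fun s' z' => scalarCurvature (g s) z + ε * s ≤
        scalarCurvature (g s') z' + ε * s') fun s' hs' z' => hle s' ⟨hs'.1, hs'.2.trans hs.2⟩ z']
        with q hq hqt
      obtain ⟨z', hz', hez, hsm, hle'⟩ := hq hqt
      rw [scalarCurvature_eq _ (h.isSmoothMetric hsT) he hz, scalarCurvature_eq _ hsm he hz', hez]
        at hle'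
      exact hle'
    subst hs0
    have := hle t ⟨ht.1, le_rfl⟩ x
    have := hδ z
    linarith
  by_contra! hlt
  have ht1 : 0 < t + 1 := by linarith [ht.1]
  have h1 := key ((δ - scalarCurvature (g t) x) / (t + 1)) (div_pos (by linarith) ht1)
  have h2 : (δ - scalarCurvature (g t) x) / (t + 1) * t < δ - scalarCurvature (g t) x := by
    rw [div_mul_eq_mul_div, div_lt_iff₀ ht1]
    nlinarith
  linarith

/-- The estimate of `|E| / (R + c)` along the flow. The condition `4 + 2 c / δ ≤ C` is what makes
the reaction inequality at a maximum of `|E| / (R + c)` contradictory, since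
`|R| ≤ (1 + c / δ) (R + c)` when `R + c ≥ δ`. -/
lemma pinching [CompactSpace M] (hn : 3 ≤ n) (hT : 0 < T) {c δ C : ℝ} (hc : 0 ≤ c) (hδ : 0 < δ)
    (hR : ∀ x, δ ≤ scalarCurvature (g 0) x + c) (hC : 4 + 2 * (c / δ) ≤ C)
    (hE : ∀ x, tracelessRicciNorm (g 0) x / (scalarCurvature (g 0) x + c) ≤ C)
    {t : ℝ} (ht : t ∈ timeInterval T) (x : M) :
    0 < scalarCurvature (g t) x + c ∧ ∃ m : ℝ,
      IsGreatest ((fun p : ℝ × M => √(weylNorm (g p.1) p.2 / (scalarCurvature (g p.1) p.2 + c))) ''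
        (Set.Icc 0 t ×ˢ Set.univ)) m ∧
      tracelessRicciNorm (g t) x / (scalarCurvature (g t) x + c) ≤ C + m := by
  have hφ : ∀ s ∈ timeInterval T, ∀ z, δ ≤ scalarCurvature (g s) z + c := by
    intro s hs z
    have := h.le_scalarCurvature hT (δ := δ - c) (fun z => by linarith [hR z]) hs z
    linarith
  refine ⟨hδ.trans_le (hφ t ht x), ?_⟩
  have hK : IsCompact (Set.Icc 0 t ×ˢ (Set.univ : Set M)) := isCompact_Icc.prod isCompact_univ
  have hne : (Set.Icc 0 t ×ˢ (Set.univ : Set M)).Nonempty :=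
    ⟨(t, x), ⟨ht.1, le_rfl⟩, Set.mem_univ _⟩
  have hsub : Set.Icc 0 t ×ˢ (Set.univ : Set M) ⊆ timeInterval T ×ˢ Set.univ :=
    Set.prod_mono (Icc_subset_timeInterval ht) subset_rfl
  have hcR : ContinuousOn (fun p : ℝ × M => scalarCurvature (g p.1) p.2 + c)
      (Set.Icc 0 t ×ˢ Set.univ) :=
    ((h.continuousOn_scalarCurvature hT).mono hsub).add continuousOn_const
  have hR0 : ∀ p ∈ Set.Icc 0 t ×ˢ (Set.univ : Set M), scalarCurvature (g p.1) p.2 + c ≠ 0 :=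
    fun p hp => (hδ.trans_le (hφ p.1 (hsub hp).1 p.2)).ne'
  obtain ⟨p₀, hp₀, hmax₀⟩ := hK.exists_isMaxOn hne (Real.continuous_sqrt.comp_continuousOn
    (((h.continuousOn_weylNorm hT).mono hsub).div hcR hR0))
  refine ⟨_, ⟨Set.mem_image_of_mem _ hp₀, ?_⟩, ?_⟩
  · rintro _ ⟨p, hp, rfl⟩
    exact hmax₀ hp
  set m : ℝ := √(weylNorm (g p₀.1) p₀.2 / (scalarCurvature (g p₀.1) p₀.2 + c)) with hm
  have hm0 : 0 ≤ m := Real.sqrt_nonneg _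
  obtain ⟨⟨s, z⟩, hsz, hmax⟩ := hK.exists_isMaxOn hne
    (((h.continuousOn_tracelessRicciNorm (by omega) hT).mono hsub).div hcR hR0)
  have hle : ∀ s' ∈ Set.Icc 0 t, ∀ z',
      tracelessRicciNorm (g s') z' / (scalarCurvature (g s') z' + c) ≤
        tracelessRicciNorm (g s) z / (scalarCurvature (g s) z + c) :=
    fun s' hs' z' => hmax (a := (s', z')) ⟨hs', trivial⟩
  refine (hle t ⟨ht.1, le_rfl⟩ x).trans ?_
  by_contra! hlt
  have hs : s ∈ Set.Icc 0 t := hsz.1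
  have hs0 : 0 < s := by
    refine lt_of_le_of_ne hs.1 fun h0 => ?_
    subst h0
    linarith [hE z]
  have hsT := Icc_subset_timeInterval ht hs
  have he : chartAt (E n) z ∈ IsManifold.maximalAtlas (𝓡 n) ∞ M :=
    IsManifold.chart_mem_maximalAtlas z
  have hz := mem_chart_source (E n) z
  set e := chartAt (E n) z
  set p : spacetime T e := ⟨(s, e z), ⟨hs0, hsT.2⟩, e.map_source hz⟩ with hp
  have hφz := hφ s hsT z
  have hφpos := hδ.trans_le hφz
  set ρ := tracelessRicciNorm (g s) z / (scalarCurvature (g s) z + c) with hρ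
  have hcδ : 0 ≤ c / δ := div_nonneg hc hδ.le
  have hρ0 : 0 < ρ := by linarith
  have eR := scalarCurvature_eq _ (h.isSmoothMetric hsT) he hz
  have eE := tracelessRicciNorm_eq (by omega) _ (h.isSmoothMetric hsT) he hz
  have eW := weylNorm_eq _ (h.isSmoothMetric hsT) he hz
  have key := pinching_of_max hn (h.isMetricOn he) (h.isFlow he) p
    (coordMetric_posDef _ he (e.map_source hz)) (ρ ^ 2) c (by positivity)
    (by change 0 < scalar (coordMetric (g s) e) (e z) + c; rwa [← eR])
    (by
      change tracelessSq (coordMetric (g s) e) (e z) =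
        ρ ^ 2 * (scalar (coordMetric (g s) e) (e z) + c) ^ 2
      have h1 : √(tracelessSq (coordMetric (g s) e) (e z)) =
          ρ * (scalarCurvature (g s) z + c) := by
        rw [← eE, hρ, div_mul_cancel₀ _ hφpos.ne']
      have h2 : 0 < √(tracelessSq (coordMetric (g s) e) (e z)) := by
        rw [h1]; positivity
      rw [← Real.sq_sqrt (Real.sqrt_pos.1 h2).le, h1, ← eR]
      ring)
    (by
      filter_upwards [h.eventually_chart p (P := fun s' z' =>
        tracelessRicciNorm (g s') z' / (scalarCurvature (g s') z' + c) ≤ ρ ∧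
          0 < scalarCurvature (g s') z' + c) fun s' hs' z' =>
          have hs'' : s' ∈ Set.Icc 0 t := ⟨hs'.1, hs'.2.trans hs.2⟩
          ⟨hle s' hs'' z', hδ.trans_le (hφ s' (Icc_subset_timeInterval ht hs'') z')⟩]
        with q hq hqt
      obtain ⟨z', hz', hez, hsm, hle', hpos'⟩ := hq hqt
      rw [div_le_iff₀ hpos', tracelessRicciNorm_eq (by omega) _ hsm he hz',
        Real.sqrt_le_left (by positivity), scalarCurvature_eq _ hsm he hz', hez, mul_pow] at hle'
      exact hle')
  change ρ ^ 2 * (scalar (coordMetric (g s) e) (e z) + c) ≤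
    norm4 (coordMetric (g s) e (e z))⁻¹ (weyl (coordMetric (g s) e) (e z))
      + 2 * √(ρ ^ 2) * (scalar (coordMetric (g s) e) (e z) + c)
      + |scalar (coordMetric (g s) e) (e z)| at key
  rw [← eW, ← eR, Real.sqrt_sq hρ0.le] at key
  have hW : weylNorm (g s) z ≤ m ^ 2 * (scalarCurvature (g s) z + c) := by
    have h1 : √(weylNorm (g s) z / (scalarCurvature (g s) z + c)) ≤ m := hmax₀ hsz
    rwa [Real.sqrt_le_left hm0, div_le_iff₀ hφpos] at h1
  have hRabs : |scalarCurvature (g s) z| ≤ (1 + 2 * (c / δ)) * (scalarCurvature (g s) z + c) := by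
    have h1 : c ≤ c / δ * (scalarCurvature (g s) z + c) := by
      rw [div_mul_eq_mul_div, le_div_iff₀ hδ]
      exact mul_le_mul_of_nonneg_left hφz hc
    rw [abs_le]
    constructor <;> nlinarith
  have hquad : ρ ^ 2 ≤ m ^ 2 + 2 * ρ + (1 + 2 * (c / δ)) := by
    refine le_of_mul_le_mul_right ?_ hφpos
    nlinarith
  -- with `ρ > m + 4 + 2 c / δ` the left side exceeds the right one
  have h1 : 4 + 2 * (c / δ) + m < ρ := by linarith
  nlinarith [mul_pos (sub_pos.2 h1) hρ0, mul_nonneg hm0 hm0, mul_nonneg hcδ hm0,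
    mul_nonneg hcδ hcδ]

end IsRicciFlow

/-- The constants of the theorem, for initial scalar curvature `R` and traceless Ricci norm `N`: a
shift `c` that makes `R + c` positive, and a bound `C` which serves both for this shift and, if `R`
is positive already, for the shift zero. -/
lemma exists_initial_bounds [CompactSpace M] [Nonempty M] {R N : M → ℝ} (hR : Continuous R)
    (hN : Continuous N) : ∃ c C : ℝ, 0 ≤ c ∧ 0 < C ∧
      (∃ δ > 0, (∀ x, δ ≤ R x + c) ∧ 4 + 2 * (c / δ) ≤ C ∧ ∀ x, N x / (R x + c) ≤ C) ∧
      ((∀ x, 0 < R x) → ∃ δ > 0, (∀ x, δ ≤ R x) ∧ 4 ≤ C ∧ ∀ x, N x / R x ≤ C) := by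
  obtain ⟨x₀, -, hx₀⟩ := isCompact_univ.exists_isMinOn Set.univ_nonempty hR.continuousOn
  have hmin : ∀ x, R x₀ ≤ R x := fun x => hx₀ (Set.mem_univ x)
  have hbdd : ∀ c, (∀ x, 0 < R x + c) → ∃ C, ∀ x, N x / (R x + c) ≤ C := by
    intro c hc
    have hq : Continuous fun x => N x / (R x + c) :=
      hN.div (hR.add continuous_const) fun x => (hc x).ne'
    obtain ⟨x₁, -, hx₁⟩ := isCompact_univ.exists_isMaxOn Set.univ_nonempty hq.continuousOn
    exact ⟨_, fun x => hx₁ (Set.mem_univ x)⟩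
  have hc1 : ∀ x, 1 ≤ R x + max 0 (1 - R x₀) := fun x => by
    linarith [hmin x, le_max_right 0 (1 - R x₀)]
  obtain ⟨C, hC⟩ := hbdd (max 0 (1 - R x₀)) fun x => by linarith [hc1 x]
  have hc0 : 0 ≤ max 0 (1 - R x₀) := le_max_left _ _
  set c := max 0 (1 - R x₀)
  by_cases hpos : ∀ x, 0 < R x
  · obtain ⟨C', hC'⟩ := hbdd 0 fun x => by simpa using hpos x
    refine ⟨c, max (4 + 2 * c) (max C C'), hc0,
      lt_of_lt_of_le (by linarith) (le_max_left _ _), ⟨1, one_pos, hc1, by simp, fun x =>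
        (hC x).trans ((le_max_left _ _).trans (le_max_right _ _))⟩, fun _ =>
      ⟨R x₀, hpos x₀, hmin, le_trans (by linarith) (le_max_left _ _), fun x => ?_⟩⟩
    have := hC' x
    rw [add_zero] at this
    exact this.trans ((le_max_right _ _).trans (le_max_right _ _))
  · exact ⟨c, max (4 + 2 * c) C, hc0, lt_of_lt_of_le (by linarith) (le_max_left _ _),
      ⟨1, one_pos, hc1, by simp, fun x => (hC x).trans (le_max_right _ _)⟩,
      fun hp => absurd hp hpos⟩

end Global

end RicciFlow

end

theorem theorem3p1 (n : ℕ) (hn : 3 ≤ n) :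
    -- `c₂` depends on the dimension only
    ∃ c₂ : ℝ, 0 ≤ c₂ ∧
      ∀ (M : Type*) [TopologicalSpace M] [T2Space M] [CompactSpace M]
        [ChartedSpace (RicciFlow.E n) M] [IsManifold (𝓡 n) ∞ M]
        (g₀ : RicciFlow.Metric n M),
        -- `c` and `C₁` depend on the initial metric, but not on the flow or on `T`
        ∃ c C₁ : ℝ, 0 ≤ c ∧ 0 < C₁ ∧
          ∀ (T : EReal) (g : ℝ → RicciFlow.Metric n M), 0 < T →
            RicciFlow.IsRicciFlow T g → g 0 = g₀ →
            (∀ t ∈ RicciFlow.timeInterval T, ∀ x : M,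
              0 < RicciFlow.scalarCurvature (g t) x + c ∧
              ∃ m : ℝ,
                IsGreatest
                  ((fun p : ℝ × M => √(RicciFlow.weylNorm (g p.1) p.2 /
                    (RicciFlow.scalarCurvature (g p.1) p.2 + c))) ''
                      (Set.Icc 0 t ×ˢ Set.univ)) m ∧
                RicciFlow.tracelessRicciNorm (g t) x / (RicciFlow.scalarCurvature (g t) x + c)
                  ≤ C₁ + c₂ * m) ∧
            ((∀ x : M, 0 < RicciFlow.scalarCurvature g₀ x) →
              ∀ t ∈ RicciFlow.timeInterval T, ∀ x : M,
                0 < RicciFlow.scalarCurvature (g t) x ∧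
                ∃ m : ℝ,
                  IsGreatest
                    ((fun p : ℝ × M => √(RicciFlow.weylNorm (g p.1) p.2 /
                      RicciFlow.scalarCurvature (g p.1) p.2)) ''
                        (Set.Icc 0 t ×ˢ Set.univ)) m ∧
                  RicciFlow.tracelessRicciNorm (g t) x / RicciFlow.scalarCurvature (g t) x
                    ≤ C₁ + c₂ * m) := by
  refine ⟨1, zero_le_one, fun M _ _ _ _ _ g₀ => ?_⟩
  simp only [one_mul]
  -- a flow that starts at `g₀`, if there is one, is only used for the continuity of the curvature
  -- of `g₀`; if there is none, or if `M` is empty, any constants will do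
  by_cases hex : Nonempty M ∧ ∃ (T : EReal) (g : ℝ → RicciFlow.Metric n M), 0 < T ∧
      RicciFlow.IsRicciFlow T g ∧ g 0 = g₀
  swap
  · refine ⟨0, 1, le_rfl, one_pos, fun T g hT hg h0 => ?_⟩
    exact ⟨fun t _ x => absurd ⟨⟨x⟩, T, g, hT, hg, h0⟩ hex,
      fun _ t _ x => absurd ⟨⟨x⟩, T, g, hT, hg, h0⟩ hex⟩
  obtain ⟨_, T₁, g₁, hT₁, hg₁, h0₁⟩ := hex
  subst h0₁
  obtain ⟨hR, hN⟩ := hg₁.continuous_initial (by omega) hT₁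
  obtain ⟨c, C, hc, hC, ⟨δ, hδ, hδR, hCδ, hE⟩, hpos⟩ := RicciFlow.exists_initial_bounds hR hN
  refine ⟨c, C, hc, hC, fun T g hT hg h0 => ?_⟩
  rw [← h0] at hδR hE hpos ⊢
  refine ⟨fun t ht x => hg.pinching hn hT hc hδ hδR hCδ hE ht x, fun hp t ht x => ?_⟩
  obtain ⟨δ', hδ', hδR', hC4, hE'⟩ := hpos hp
  simpa only [add_zero] using hg.pinching hn hT (c := 0) le_rfl hδ' (by simpa only [add_zero])
    (by simpa using hC4) (by simpa only [add_zero]) ht x
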